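/- Let $X$ be a compact connected Riemann surface, $x\in X$ a point and $n\ge 0$ an integer. An \emph{orthogonal bundle} of rank $r$ on $X$ is a holomorphic vector bundle $E$ of rank $r$ with a symmetric bilinear form $\varphi:E\otimes E\to L$ with values in a holomorphic line bundle $L$ that is nondegenerate on every fibre. For a line bundle $M$ write $M(\pm x)=M\otimes\mathcal O_X(\pm x)$, and let $\mathbb C_x$ be the skyscraper sheaf of length one at $x$. Call a symmetric form $\psi:F\otimes F\to M$ ($F$ a holomorphic vector bundle, $M$ a holomorphic line bundle) \emph{simply degenerate at $x$} if it induces a short exact sequence $0\to F\to F^\vee\otimes M\to\mathbb C_x\to 0$. (1) Let $F$ have rank $2n+1$ and let $\psi:F\otimes F\to M$ be simply degenerate at $x$. Let $l_x=\ker(F_x\to F_x^\vee\otimes M_x)$, let $S_x\subset F_x/l_x$ be an $n$-dimensional subspace that is isotropic for the induced form, put $Q_x=(F_x/l_x)/S_x$, and let $E$ be the kernel of $F\to F_x\to Q_x$. Then $\psi$ induces an orthogonal structure on $E$ with values in $M(-x)$: there is a unique bilinear form $\varphi:E\otimes E\to M(-x)$ whose composition with $M(-x)\hookrightarrow M$ is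 the restriction of $\psi$ to $E\otimes E$, and $(E,\varphi)$ is an orthogonal bundle of rank $2n+1$. (2) Conversely, let $(E,\varphi:E\otimes E\to L)$ be an orthogonal bundle of rank $2n+1$, and let $\varphi^{-1}:E^\vee\otimes E^\vee\to L^\vee$ be the inverse form, i.e. the unique form with $\varphi^{-1}(a,b)=b(e)\,\nu$ for all local sections $e$ of $E$, $\nu$ of $L^\vee$ and $b$ of $E^\vee$, where $a=\nu\circ\varphi(e,-)$. Let $W_x\subset E_x^\vee$ be a $\varphi^{-1}$-isotropic subspace of dimension $n$, let $W_x^\perp$ be its orthogonal with respect to $\varphi^{-1}$, and define $F$ by the exact sequence $0\to F^\vee\to E^\vee\to E_x^\vee/W_x^\perp\to 0$ (so that there is a natural map $E\to F$). Then there is a unique bilinear form $\psi:F\otimes F\to M:=L(x)$ that extends $\varphi$ along $E\to F$ and $L\hookrightarrow L(x)$. The bundle $F$ has rank $2n+1$, the form $\psi$ is symmetric, nondegenerate on the fibres at all points other than $x$, and simply degenerate at $x$; and in suitable local frames of $F$ and $M$ in a neighbourhood of $x$ its matrix is $$\begin{pmatrix}0&0&\mathbf 1_n\\0&t&0\\\mathbf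 1_n&0&0\end{pmatrix}$$ where $t$ is a local parameter at $x$. -/

import Mathlib

open CategoryTheory TopologicalSpace Opposite AlgebraicGeometry
open scoped TensorProduct Manifold ContDiff

namespace OrthogonalHecke
universe u

noncomputable section
variable {X : LocallyRingedSpace.{u}}

variable (X) in
/-- The structure sheaf of `X`, as a sheaf of rings. -/
abbrev ringSheaf : TopCat.Sheaf RingCat.{u} X.toTopCat :=
  (sheafCompose _ (forget₂ CommRingCat RingCat.{u})).obj X.sheaf

variable (X) in
/-- Sheaves of `𝒪_X`-modules. -/
abbrev OMod := SheafOfModules.{u} (ringSheaf X)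

variable (X) in
/-- `Γ(U, 𝒪_X)`. -/
abbrev Fn (U : Opens X) : Type u := X.presheaf.obj (op U)

/-- `Γ(U, F)`. -/
def Sec (F : OMod X) (U : Opens X) : Type u := F.val.obj (op U)

instance (F : OMod X) (U : Opens X) : AddCommGroup (Sec F U) :=
  inferInstanceAs (AddCommGroup (F.val.obj (op U)))

instance (F : OMod X) (U : Opens X) : Module (Fn X U) (Sec F U) := (F.val.obj (op U)).isModule

/-- Restriction of functions. -/
abbrev resFn {V U : Opens X} (h : V ≤ U) : Fn X U →+* Fn X V :=
  (X.presheaf.map (homOfLE h).op).hom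

/-- Restriction of sections. -/
def res (F : OMod X) {V U : Opens X} (h : V ≤ U) : Sec F U →ₛₗ[resFn h] Sec F V :=
  F.val.restrictₛₗ (homOfLE h).op

theorem res_res (F : OMod X) {W V U : Opens X} (h : W ≤ V) (h' : V ≤ U) (s : Sec F U) :
    res F h (res F h' s) = res F (h.trans h') s :=
  (F.val.map_comp_apply (homOfLE h').op (homOfLE h).op s).symm

theorem res_self (F : OMod X) {U : Opens X} (s : Sec F U) : res F le_rfl s = s :=
  congr($(F.val.presheaf.map_id (op U)) s)

theorem resFn_resFn {W V U : Opens X} (h : W ≤ V) (h' : V ≤ U) (f : Fn X U) :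
    resFn h (resFn h' f) = resFn (h.trans h') f :=
  congr($(X.presheaf.map_comp (homOfLE h').op (homOfLE h).op) f).symm

theorem exists_glue (F : OMod X) {ι : Type u} (U : ι → Opens X) (W : Opens X) (hU : ∀ i, U i ≤ W)
    (hW : W ≤ iSup U) (s : ∀ i, Sec F (U i))
    (hs : ∀ i j, res F inf_le_left (s i) = res F (inf_le_right : U i ⊓ U j ≤ U j) (s j)) :
    ∃! t : Sec F W, ∀ i, res F (hU i) t = s i :=
  by
  have h := TopCat.Sheaf.existsUnique_gluing' (X := X.toTopCat) (C := Ab.{u})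
    ⟨F.val.presheaf, F.isSheaf⟩ U W (fun i ↦ homOfLE (hU i)) hW (fun i ↦ (s i : Sec F (U i)))
  exact h (fun i j ↦ hs i j)

/-- The map on sections over `U` of a morphism of `𝒪_X`-modules. -/
def app {F G : OMod X} (f : F ⟶ G) (U : Opens X) : Sec F U →ₗ[Fn X U] Sec G U :=
  (f.val.app (op U)).hom

theorem app_res {F G : OMod X} (f : F ⟶ G) {V U : Opens X} (h : V ≤ U) (s : Sec F U) :
    app f V (res F h s) = res G h (app f U s) :=
  PresheafOfModules.naturality_apply f.val (homOfLE h).op s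

/-- A morphism of `𝒪_X`-modules from its maps on sections. -/
def mkHom {F G : OMod X} (φ : ∀ U, Sec F U →ₗ[Fn X U] Sec G U)
    (hφ : ∀ {V U : Opens X} (h : V ≤ U) (s : Sec F U), φ V (res F h s) = res G h (φ U s)) :
    F ⟶ G :=
  ⟨PresheafOfModules.homMk
    { app U := AddCommGrpCat.ofHom (φ U.unop).toAddMonoidHom
      naturality U V i := by
        ext s
        exact hφ i.unop.le s }
    (fun U r s ↦ (φ U.unop).map_smul r s)⟩

theorem app_mkHom {F G : OMod X} (φ : ∀ U, Sec F U →ₗ[Fn X U] Sec G U)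
    (hφ : ∀ {V U : Opens X} (h : V ≤ U) (s : Sec F U), φ V (res F h s) = res G h (φ U s))
    (U : Opens X) : app (mkHom φ hφ) U = φ U := rfl

section mkSheaf

variable (A : Opens X → Type u) [∀ U, AddCommGroup (A U)] [∀ U, Module (Fn X U) (A U)]
  (r : ∀ {V U : Opens X}, V ≤ U → A U →+ A V)
  (r_smul : ∀ {V U : Opens X} (h : V ≤ U) (f : Fn X U) (a : A U),
    r h (f • a) = resFn h f • r h a)
  (r_self : ∀ {U : Opens X} (a : A U), r le_rfl a = a)
  (r_comp : ∀ {W V U : Opens X} (h : W ≤ V) (h' : V ≤ U) (a : A U),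
    r h (r h' a) = r (h.trans h') a)
  (glue : ∀ {ι : Type u} (U : ι → Opens X) (s : ∀ i, A (U i)),
    (∀ i j, r inf_le_left (s i) = r (inf_le_right : U i ⊓ U j ≤ U j) (s j)) →
      ∃! t : A (iSup U), ∀ i, r (le_iSup U i) t = s i)

/-- Auxiliary to `mkMod`: the underlying presheaf of abelian groups. -/
def mkAb : TopCat.Presheaf Ab.{u} X.toTopCat where
  obj U := .of (A U.unop)
  map i := AddCommGrpCat.ofHom (r i.unop.le)
  map_id U := by ext a; exact r_self a
  map_comp i j := by ext a; exact (r_comp j.unop.le i.unop.le a).symm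

/-- A sheaf of `𝒪_X`-modules from its sections, its restriction maps and unique gluing. -/
def mkMod : OMod X :=
  letI (U : (Opens X)ᵒᵖ) : Module ((ringSheaf X).obj.obj U) ((mkAb A r r_self r_comp).obj U) :=
    inferInstanceAs (Module (Fn X U.unop) (A U.unop))
  { val := PresheafOfModules.ofPresheaf (mkAb A r r_self r_comp)
      (fun _ _ i f a ↦ r_smul i.unop.le f a)
    isSheaf := by
      refine (TopCat.Presheaf.isSheaf_iff_isSheafUniqueGluing (X := X.toTopCat)
        (mkAb A r r_self r_comp)).2 ?_
      intro ι U s hs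
      exact glue U s (fun i j ↦ hs i j) }


end mkSheaf


section Stalks

abbrev toPre (F : OMod X) : PresheafOfModules.{u} (X.presheaf ⋙ forget₂ CommRingCat RingCat) :=
  F.val

/-- The stalk `F_(x)`, a module over the local ring `𝒪_{X,x}`. -/
def Stalk (F : OMod X) (x : X) : Type u :=
  TopCat.Presheaf.stalk (C := Ab.{u}) (X := X.toTopCat) (toPre F).presheaf x

instance (F : OMod X) (x : X) : AddCommGroup (Stalk F x) :=
  inferInstanceAs (AddCommGroup (TopCat.Presheaf.stalk (C := Ab.{u}) (X := X.toTopCat) (toPre F).presheaf x))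

instance (F : OMod X) (x : X) : Module (X.presheaf.stalk x) (Stalk F x) :=
  inferInstanceAs (Module (X.presheaf.stalk x)
    (TopCat.Presheaf.stalk (C := Ab.{u}) (X := X.toTopCat) (toPre F).presheaf x))

/-- The germ at `x` of a section. -/
def germ (F : OMod X) {U : Opens X} {x : X} (hx : x ∈ U) : Sec F U →+ Stalk F x :=
  (TopCat.Presheaf.germ (C := Ab.{u}) (X := X.toTopCat) F.val.presheaf U x hx).hom

/-- The germ at `x` of a function. -/
abbrev germFn {U : Opens X} {x : X} (hx : x ∈ U) : Fn X U →+* X.presheaf.stalk x :=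
  (X.presheaf.germ U x hx).hom

theorem germ_smul (F : OMod X) {U : Opens X} {x : X} (hx : x ∈ U) (f : Fn X U) (s : Sec F U) :
    germ F hx (f • s) = germFn hx f • germ F hx s :=
  PresheafOfModules.germ_smul (X := X.toTopCat) (R := X.presheaf) F.val x U hx f s

theorem germ_res (F : OMod X) {V U : Opens X} (h : V ≤ U) {x : X} (hx : x ∈ V) (s : Sec F U) :
    germ F hx (res F h s) = germ F (h hx) s :=
  TopCat.Presheaf.germ_res_apply (C := Ab.{u}) (X := X.toTopCat) F.val.presheaf (homOfLE h) x hx s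

theorem germFn_res {V U : Opens X} (h : V ≤ U) {x : X} (hx : x ∈ V) (f : Fn X U) :
    germFn hx (resFn h f) = germFn (h hx) f :=
  TopCat.Presheaf.germ_res_apply X.presheaf (homOfLE h) x hx f

theorem exists_germ_eq (F : OMod X) {x : X} (a : Stalk F x) :
    ∃ (U : Opens X) (hx : x ∈ U) (s : Sec F U), germ F hx s = a :=
  TopCat.Presheaf.exists_germ_eq (C := Ab.{u}) (X := X.toTopCat) F.val.presheaf a

theorem germ_eq_iff (F : OMod X) {U V : Opens X} {x : X} (hU : x ∈ U) (hV : x ∈ V)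
    (s : Sec F U) (t : Sec F V) (h : germ F hU s = germ F hV t) :
    ∃ (W : Opens X) (_ : x ∈ W) (hWU : W ≤ U) (hWV : W ≤ V), res F hWU s = res F hWV t := by
  obtain ⟨W, hW, i, j, e⟩ := TopCat.Presheaf.germ_eq (C := Ab.{u}) (X := X.toTopCat)
    F.val.presheaf x hU hV s t h
  exact ⟨W, hW, i.le, j.le, e⟩

/-- The residue field `𝒪_{X,x} / 𝔪_x` (for a Riemann surface this is `ℂ`, by evaluation). -/
abbrev κ (x : X) : Type u := IsLocalRing.ResidueField (X.presheaf.stalk x)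
/-- The fibre `F_x = F_(x) ⊗ 𝒪_{X,x} / 𝔪_x`. -/
abbrev Fiber (F : OMod X) (x : X) : Type u := κ x ⊗[X.presheaf.stalk x] Stalk F x
/-- The value `s(x) ∈ F_x` of a section `s`. -/
def value (F : OMod X) {U : Opens X} {x : X} (hx : x ∈ U) (s : Sec F U) : Fiber F x :=
  1 ⊗ₜ germ F hx s
end Stalks

/-- A bilinear form on `F` with values in `M`, i.e. a morphism `F ⊗ F ⟶ M` of `𝒪_X`-modules,
given (universal property of the tensor product) by compatible bilinear maps on sections. -/
structure BilinForm (F M : OMod X) where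
  pair (U : Opens X) : Sec F U →ₗ[Fn X U] Sec F U →ₗ[Fn X U] Sec M U
  pair_res {V U : Opens X} (h : V ≤ U) (s t : Sec F U) :
    pair V (res F h s) (res F h t) = res M h (pair U s t)

section FiberForm
variable {F M : OMod X} (ψ : BilinForm F M) (x : X)

theorem BilinForm.exists_stalk :
    ∃ b : Stalk F x →ₗ[X.presheaf.stalk x] Stalk F x →ₗ[X.presheaf.stalk x] Stalk M x,
      ∀ (U : Opens X) (hx : x ∈ U) (s t : Sec F U),
        b (germ F hx s) (germ F hx t) = germ M hx (ψ.pair U s t) := by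
  choose U hU s hs using fun a : Stalk F x ↦ exists_germ_eq F a
  let b (a a' : Stalk F x) : Stalk M x :=
    germ M (show x ∈ U a ⊓ U a' from ⟨hU a, hU a'⟩)
      (ψ.pair _ (res F inf_le_left (s a)) (res F inf_le_right (s a')))
  have key (V : Opens X) (hx : x ∈ V) (p q : Sec F V) :
      b (germ F hx p) (germ F hx q) = germ M hx (ψ.pair V p q) := by
    obtain ⟨W, hW, h1, h2, e⟩ := germ_eq_iff F _ hx _ p (hs (germ F hx p))
    obtain ⟨W', hW', h1', h2', e'⟩ := germ_eq_iff F _ hx _ q (hs (germ F hx q))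
    have hle : W ⊓ W' ≤ U (germ F hx p) ⊓ U (germ F hx q) := inf_le_inf h1 h1'
    have hx' : x ∈ W ⊓ W' := ⟨hW, hW'⟩
    have hV : W ⊓ W' ≤ V := inf_le_left.trans h2
    have E := congrArg (res F (inf_le_left : W ⊓ W' ≤ W)) e
    have E' := congrArg (res F (inf_le_right : W ⊓ W' ≤ W')) e'
    rw [res_res, res_res] at E E'
    calc _ = germ M hx' (res M hle (ψ.pair _ (res F inf_le_left (s (germ F hx p)))
            (res F inf_le_right (s (germ F hx q))))) := (germ_res M hle hx' _).symm
      _ = germ M hx' (ψ.pair _ (res F hV p) (res F hV q)) := by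
        rw [← ψ.pair_res, res_res, res_res, E, E']
      _ = _ := by rw [ψ.pair_res, germ_res]
  have two (a a' : Stalk F x) : ∃ (V : Opens X) (hx : x ∈ V) (p q : Sec F V),
      germ F hx p = a ∧ germ F hx q = a' :=
    ⟨U a ⊓ U a', ⟨hU a, hU a'⟩, res F inf_le_left (s a), res F inf_le_right (s a'), 
      (germ_res _ _ _ _).trans (hs a), (germ_res _ _ _ _).trans (hs a')⟩
  have three (a a' a'' : Stalk F x) : ∃ (V : Opens X) (hx : x ∈ V) (p q r : Sec F V),
      germ F hx p = a ∧ germ F hx q = a' ∧ germ F hx r = a'' := by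
    obtain ⟨V, hx, p, q, rfl, rfl⟩ := two a a'
    exact ⟨V ⊓ U a'', ⟨hx, hU a''⟩, res F inf_le_left p, res F inf_le_left q,
      res F inf_le_right (s a''), germ_res _ _ _ _, germ_res _ _ _ _, (germ_res _ _ _ _).trans (hs a'')⟩
  have scal (c : X.presheaf.stalk x) (a a' : Stalk F x) : ∃ (V : Opens X) (hx : x ∈ V)
      (f : Fn X V) (p q : Sec F V), germFn hx f = c ∧ germ F hx p = a ∧ germ F hx q = a' := by
    obtain ⟨V, hx, p, q, rfl, rfl⟩ := two a a'
    obtain ⟨W, hW, f, rfl⟩ := TopCat.Presheaf.exists_germ_eq X.presheaf c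
    exact ⟨V ⊓ W, ⟨hx, hW⟩, resFn inf_le_right f, res F inf_le_left p, res F inf_le_left q,
      germFn_res _ _ _, germ_res _ _ _ _, germ_res _ _ _ _⟩
  refine ⟨LinearMap.mk₂ _ b ?_ ?_ ?_ ?_, fun V hx p q ↦ key V hx p q⟩
  · intro a a' a''
    obtain ⟨V, hx, p, q, r, rfl, rfl, rfl⟩ := three a a' a''
    rw [← map_add, key, key, key, ← map_add, map_add (ψ.pair V), LinearMap.add_apply]
  · intro c a a'
    obtain ⟨V, hx, f, p, q, rfl, rfl, rfl⟩ := scal c a a'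
    rw [← germ_smul, key, key, ← germ_smul, map_smul, LinearMap.smul_apply]
  · intro a a' a''
    obtain ⟨V, hx, p, q, r, rfl, rfl, rfl⟩ := three a a' a''
    rw [← map_add, key, key, key, ← map_add, map_add]
  · intro c a a'
    obtain ⟨V, hx, f, p, q, rfl, rfl, rfl⟩ := scal c a a'
    rw [← germ_smul, key, key, ← germ_smul, map_smul]

/-- The bilinear form induced on the stalk. -/
def BilinForm.stalk :
    Stalk F x →ₗ[X.presheaf.stalk x] Stalk F x →ₗ[X.presheaf.stalk x] Stalk M x :=
  (ψ.exists_stalk x).choose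

theorem BilinForm.stalk_germ {U : Opens X} (hx : x ∈ U) (s t : Sec F U) :
    ψ.stalk x (germ F hx s) (germ F hx t) = germ M hx (ψ.pair U s t) :=
  (ψ.exists_stalk x).choose_spec U hx s t

/-- The bilinear form `F_x × F_x → M_x` induced on the fibre, as a map `F_x → Hom(F_x, M_x)`;
see `BilinForm.fiber_value`. -/
def BilinForm.fiber : Fiber F x →ₗ[κ x] Fiber F x →ₗ[κ x] Fiber M x :=
  LinearMap.BilinMap.baseChange (κ x) (ψ.stalk x)

theorem BilinForm.fiber_value {U : Opens X} (hx : x ∈ U) (s t : Sec F U) :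
    ψ.fiber x (value F hx s) (value F hx t) = value M hx (ψ.pair U s t) := by
  simp only [BilinForm.fiber, value, LinearMap.BilinMap.baseChange_tmul, mul_one,
    BilinForm.stalk_germ]

end FiberForm

section Skyscraper
variable (x : X) (V : Type u) [AddCommGroup V] [Module (κ x) V]

/-- The value of a function at `x`. -/
def valueFn {U : Opens X} (hx : x ∈ U) : Fn X U →+* κ x :=
  (IsLocalRing.residue (X.presheaf.stalk x)).comp (germFn hx)

/-- Sections over `U` of the skyscraper sheaf: `V` if `x ∈ U`, and `0` otherwise. -/
abbrev SkySec (U : Opens X) : Type u := PLift (x ∈ U) → V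

instance (U : Opens X) : Module (Fn X U) (SkySec x V U) where
  smul f c := fun h ↦ valueFn x h.down f • c h
  one_smul c := by funext h; exact (congrArg (· • c h) (map_one (valueFn x h.down))).trans (one_smul _ _)
  mul_smul f g c := by
    funext h; exact (congrArg (· • c h) (map_mul (valueFn x h.down) f g)).trans (mul_smul _ _ _)
  smul_zero f := by funext h; exact smul_zero _
  smul_add f c d := by funext h; exact smul_add _ _ _
  add_smul f g c := by
    funext h; exact (congrArg (· • c h) (map_add (valueFn x h.down) f g)).trans (add_smul _ _ _)
  zero_smul c := by
    funext h; exact (congrArg (· • c h) (map_zero (valueFn x h.down))).trans (zero_smul _ _)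

/-- The skyscraper sheaf at `x` with stalk the vector space `V`. -/
def skyscraper : OMod X :=
  mkMod (SkySec x V)
    (fun h ↦ { toFun := fun c hx ↦ c ⟨h hx.down⟩, map_zero' := rfl, map_add' := fun _ _ ↦ rfl })
    (fun h f c ↦ by
      funext hx
      change valueFn x (h hx.down) f • c ⟨h hx.down⟩ = valueFn x hx.down (resFn h f) • c ⟨h hx.down⟩
      simp only [valueFn, RingHom.comp_apply, germFn_res])
    (fun _ ↦ rfl) (fun _ _ _ ↦ rfl)
    (by
      intro ι U s hs
      classical
      have ex (hx : x ∈ iSup U) : ∃ i, x ∈ U i := Opens.mem_iSup.1 hx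
      refine ⟨fun hx ↦ s (ex hx.down).choose ⟨(ex hx.down).choose_spec⟩, fun i ↦ ?_, fun t ht ↦ ?_⟩
      · funext hi
        have hx : x ∈ iSup U := (le_iSup U i) hi.down
        exact congrFun (hs (ex hx).choose i) ⟨(ex hx).choose_spec, hi.down⟩
      · funext hx
        exact congrFun (ht (ex hx.down).choose) ⟨(ex hx.down).choose_spec⟩)

variable {V} in
/-- The morphism `F ⟶ F_x ⟶ V` from `F` to a skyscraper sheaf, induced by a linear map `F_x → V`. -/
def toSkyscraper (F : OMod X) (g : Fiber F x →ₗ[κ x] V) : F ⟶ skyscraper x V :=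
  mkHom (G := skyscraper x V)
    (fun U ↦
      { toFun := fun s ↦ (fun hx ↦ g (value F hx.down s) : SkySec x V U)
        map_add' := fun s t ↦ by
          funext hx
          change g (value F hx.down (s + t)) = g (value F hx.down s) + g (value F hx.down t)
          simp only [value, map_add, TensorProduct.tmul_add]
        map_smul' := fun f s ↦ by
          funext hx
          change g (value F hx.down (f • s)) = valueFn x hx.down f • g (value F hx.down s)
          rw [← map_smul, value, germ_smul, ← TensorProduct.smul_tmul, value,
            TensorProduct.smul_tmul', valueFn, RingHom.comp_apply, Algebra.smul_def, smul_eq_mul]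
          rfl })
    (fun h s ↦ by
      funext hx
      change g (value F hx.down (res F h s)) = g (value F (h hx.down) s)
      rw [value, germ_res]; rfl)

end Skyscraper

section InternalHom
variable (F G : OMod X)

/-- Auxiliary to `HomSec`. -/
def homSub (U : Opens X) :
    AddSubgroup (∀ V : {V : Opens X // V ≤ U}, Sec F V.1 →ₗ[Fn X V.1] Sec G V.1) where
  carrier := {φ | ∀ (W V : {V : Opens X // V ≤ U}) (h : W.1 ≤ V.1) (s : Sec F V.1),
    φ W (res F h s) = res G h (φ V s)}
  zero_mem' := fun W V h s ↦ (map_zero (res G h)).symm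
  add_mem' := fun {a b} ha hb W V h s ↦ by
    change a W _ + b W _ = res G h (a V s + b V s)
    rw [ha W V h s, hb W V h s, map_add]
  neg_mem' := fun {a} ha W V h s ↦ by
    change -a W _ = res G h (-a V s)
    rw [ha W V h s, map_neg]

/-- Morphisms `F|_U ⟶ G|_U` of `𝒪_U`-modules: compatible `Γ(V, 𝒪_X)`-linear maps
`Γ(V, F) → Γ(V, G)` for all open `V ⊆ U`. -/
def HomSec (U : Opens X) : Type u := homSub F G U

instance (U : Opens X) : AddCommGroup (HomSec F G U) := inferInstanceAs (AddCommGroup (homSub F G U))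

variable {F G} in
/-- The map on sections over `V ⊆ U`. -/
def HomSec.app {U : Opens X} (φ : HomSec F G U) {V : Opens X} (h : V ≤ U) :
    Sec F V →ₗ[Fn X V] Sec G V :=
  φ.1 ⟨V, h⟩

variable {F G}

theorem HomSec.app_res {U : Opens X} (φ : HomSec F G U) {W V : Opens X} (h : W ≤ V) (h' : V ≤ U)
    (s : Sec F V) : φ.app (h.trans h') (res F h s) = res G h (φ.app h' s) :=
  φ.2 ⟨W, h.trans h'⟩ ⟨V, h'⟩ h s

theorem HomSec.ext {U : Opens X} {φ φ' : HomSec F G U}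
    (H : ∀ (V : Opens X) (h : V ≤ U) (s : Sec F V), φ.app h s = φ'.app h s) : φ = φ' :=
  Subtype.ext (funext fun V ↦ LinearMap.ext fun s ↦ H V.1 V.2 s)

/-- Constructor for `HomSec`. -/
def HomSec.mk {U : Opens X} (a : ∀ {V : Opens X}, V ≤ U → (Sec F V →ₗ[Fn X V] Sec G V))
    (ha : ∀ {W V : Opens X} (h : W ≤ V) (h' : V ≤ U) (s : Sec F V),
      a (h.trans h') (res F h s) = res G h (a h' s)) : HomSec F G U :=
  ⟨fun V ↦ a V.2, fun _ V h s ↦ ha h V.2 s⟩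

instance (U : Opens X) : SMul (Fn X U) (HomSec F G U) where
  smul f φ := HomSec.mk (fun {V} h ↦ resFn h f • φ.app h) (fun {W V} h h' s ↦ by
    rw [LinearMap.smul_apply, LinearMap.smul_apply, HomSec.app_res φ h h', (res G h).map_smulₛₗ,
      resFn_resFn])

theorem HomSec.smul_app {U : Opens X} (f : Fn X U) (φ : HomSec F G U) {V : Opens X} (h : V ≤ U)
    (s : Sec F V) : (f • φ).app h s = resFn h f • φ.app h s := rfl

theorem HomSec.add_app {U : Opens X} (φ φ' : HomSec F G U) {V : Opens X} (h : V ≤ U)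
    (s : Sec F V) : (φ + φ').app h s = φ.app h s + φ'.app h s := rfl

theorem HomSec.zero_app {U : Opens X} {V : Opens X} (h : V ≤ U)
    (s : Sec F V) : (0 : HomSec F G U).app h s = 0 := rfl

instance (U : Opens X) : Module (Fn X U) (HomSec F G U) where
  one_smul φ := HomSec.ext fun V h s ↦ by rw [HomSec.smul_app, map_one, one_smul]
  mul_smul f g φ := HomSec.ext fun V h s ↦ by
    rw [HomSec.smul_app, HomSec.smul_app, HomSec.smul_app, map_mul, mul_smul]
  smul_zero f := HomSec.ext fun V h s ↦ by
    rw [HomSec.smul_app, HomSec.zero_app, smul_zero]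
  smul_add f φ φ' := HomSec.ext fun V h s ↦ by
    rw [HomSec.add_app, HomSec.smul_app, HomSec.smul_app, HomSec.smul_app, HomSec.add_app, smul_add]
  add_smul f g φ := HomSec.ext fun V h s ↦ by
    rw [HomSec.add_app, HomSec.smul_app, HomSec.smul_app, HomSec.smul_app, map_add, add_smul]
  zero_smul φ := HomSec.ext fun V h s ↦ by
    rw [HomSec.smul_app, HomSec.zero_app, map_zero, zero_smul]

variable (F G) in
/-- Restriction of morphisms to a smaller open set. -/
def HomSec.restrict {V U : Opens X} (h : V ≤ U) : HomSec F G U →+ HomSec F G V where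
  toFun φ := HomSec.mk (fun h' ↦ φ.app (h'.trans h)) (fun h₁ h₂ s ↦ φ.app_res h₁ (h₂.trans h) s)
  map_zero' := rfl
  map_add' _ _ := rfl

theorem HomSec.glue {ι : Type u} (U : ι → Opens X) (φ : ∀ i, HomSec F G (U i))
    (hφ : ∀ i j, HomSec.restrict F G inf_le_left (φ i) =
      HomSec.restrict F G (inf_le_right : U i ⊓ U j ≤ U j) (φ j)) :
    ∃! Φ : HomSec F G (iSup U), ∀ i, HomSec.restrict F G (le_iSup U i) Φ = φ i := by
  have hφ' (i j : ι) (W : Opens X) (hi : W ≤ U i) (hj : W ≤ U j) (s : Sec F W) :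
      (φ i).app hi s = (φ j).app hj s :=
    congrArg (fun Φ : HomSec F G (U i ⊓ U j) ↦ Φ.app (le_inf hi hj) s) (hφ i j)
  have cov {V : Opens X} (h : V ≤ iSup U) : V ≤ ⨆ i, V ⊓ U i := by
    rw [← inf_iSup_eq]; exact le_inf le_rfl h
  have ex {V : Opens X} (h : V ≤ iSup U) (s : Sec F V) :
      ∃! t : Sec G V, ∀ i, res G (inf_le_left : V ⊓ U i ≤ V) t =
        (φ i).app inf_le_right (res F inf_le_left s) := by
    refine exists_glue G (fun i ↦ V ⊓ U i) V (fun i ↦ inf_le_left) (cov h) _ (fun i j ↦ ?_)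
    rw [← HomSec.app_res, ← HomSec.app_res, res_res, res_res]
    exact hφ' i j _ _ _ _
  choose t ht ht' using @ex
  let Φ : HomSec F G (iSup U) := HomSec.mk
    (fun {V} h ↦
      { toFun := t h
        map_add' := fun s s' ↦ by
          refine (ht' h _ _ fun i ↦ ?_).symm
          rw [map_add, ht, ht, map_add, map_add]
        map_smul' := fun f s ↦ by
          refine (ht' h _ _ fun i ↦ ?_).symm
          rw [RingHom.id_apply, (res G _).map_smulₛₗ, ht, (res F _).map_smulₛₗ, map_smul] })
    (fun {W V} h h' s ↦ by
      refine (ht' (h.trans h') _ _ fun i ↦ ?_).symm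
      have e := congrArg (res G (inf_le_inf_right (U i) h)) (ht h' s i)
      rw [← HomSec.app_res, res_res, res_res] at e
      change res G _ (res G h (t h' s)) = _
      rw [res_res, res_res]
      exact e)
  have hΦ {V : Opens X} (h : V ≤ iSup U) (s : Sec F V) : Φ.app h s = t h s := rfl
  refine ⟨Φ, fun i ↦ HomSec.ext fun V h s ↦ ?_, fun Ψ hΨ ↦ HomSec.ext fun V h s ↦ ?_⟩
  · change t (h.trans (le_iSup U i)) s = _
    refine (ht' (h.trans (le_iSup U i)) _ _ fun j ↦ ?_).symm
    rw [← HomSec.app_res]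
    exact hφ' i j _ _ _ _
  · rw [hΦ]
    refine ht' h _ _ fun i ↦ ?_
    rw [← HomSec.app_res]
    exact congrArg (fun Θ : HomSec F G (U i) ↦ Θ.app (inf_le_right : V ⊓ U i ≤ U i) _) (hΨ i)

variable (F G) in
/-- The sheaf `ℋom(F, G)` of local morphisms; for `F` a vector bundle it is `F^∨ ⊗ G`. -/
def ihom : OMod X :=
  mkMod (HomSec F G) (HomSec.restrict F G)
    (fun {V U} h f φ ↦ HomSec.ext fun W h' s ↦ by
      change resFn (h'.trans h) f • φ.app (h'.trans h) s = resFn h' (resFn h f) • _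
      rw [resFn_resFn]; rfl)
    (fun _ ↦ rfl) (fun _ _ _ ↦ rfl) HomSec.glue

/-- A local section of `ℋom(F, G)` over `U`, applied to sections of `F` over `V ⊆ U`. -/
def homApply {U V : Opens X} (φ : Sec (ihom F G) U) (h : V ≤ U) : Sec F V →ₗ[Fn X V] Sec G V :=
  HomSec.app (F := F) (G := G) φ h

theorem homApply_res {U W V : Opens X} (φ : Sec (ihom F G) U) (h : W ≤ V) (h' : V ≤ U)
    (s : Sec F V) : homApply φ (h.trans h') (res F h s) = res G h (homApply φ h' s) :=
  HomSec.app_res (F := F) (G := G) φ h h' s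

/-- The morphism `F ⟶ ℋom(F, M) = F^∨ ⊗ M` induced by a bilinear form. -/
def BilinForm.adjoint (ψ : BilinForm F G) : F ⟶ ihom F G :=
  mkHom (G := ihom F G)
    (fun U ↦
      { toFun := fun s ↦ HomSec.mk (fun {V} h ↦ ψ.pair V (res F h s)) (fun {W V} h h' t ↦ by
          rw [← ψ.pair_res, res_res])
        map_add' := fun s s' ↦ HomSec.ext fun V h t ↦ by
          change ψ.pair V (res F h (s + s')) t = ψ.pair V (res F h s) t + ψ.pair V (res F h s') t
          rw [map_add, map_add, LinearMap.add_apply]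
        map_smul' := fun f s ↦ HomSec.ext fun V h t ↦ by
          change ψ.pair V (res F h (f • s)) t = resFn h f • ψ.pair V (res F h s) t
          rw [(res F h).map_smulₛₗ, map_smul, LinearMap.smul_apply] })
    (fun {V U} h s ↦ HomSec.ext fun W h' t ↦ by
      change ψ.pair W (res F h' (res F h s)) t = ψ.pair W (res F (h'.trans h) s) t
      rw [res_res])

theorem BilinForm.homApply_adjoint (ψ : BilinForm F G) {U V : Opens X} (h : V ≤ U) (s : Sec F U)
    (t : Sec F V) : homApply (app ψ.adjoint U s) h t = ψ.pair V (res F h s) t := rfl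

/-- The morphism `E ⟶ ℋom(G, N)`, `e ↦ (g ↦ ι(g)(e))`, attached to `ι : G ⟶ ℋom(E, N)`. -/
def transpose {E N : OMod X} (ι : G ⟶ ihom E N) : E ⟶ ihom G N :=
  mkHom (G := ihom G N)
    (fun U ↦
      { toFun := fun e ↦ HomSec.mk
          (fun {V} h ↦
            { toFun := fun g ↦ homApply (app ι V g) le_rfl (res E h e)
              map_add' := fun g g' ↦ by rw [map_add]; rfl
              map_smul' := fun f g ↦ by
                rw [map_smul]
                exact (HomSec.smul_app f (app ι V g : HomSec E N V) le_rfl _).trans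
                  (congrArg (· • _) (congr($(X.presheaf.map_id (op V)) f))) })
          (fun {W V} h h' g ↦ by
            change homApply (app ι W (res G h g)) le_rfl (res E (h.trans h') e) =
              res N h (homApply (app ι V g) le_rfl (res E h' e))
            rw [← homApply_res, res_res, app_res]
            rfl)
        map_add' := fun e e' ↦ HomSec.ext fun V h g ↦ by
          change homApply (app ι V g) le_rfl (res E h (e + e')) =
            homApply (app ι V g) le_rfl (res E h e) + homApply (app ι V g) le_rfl (res E h e')
          rw [map_add, map_add]
        map_smul' := fun f e ↦ HomSec.ext fun V h g ↦ by
          change homApply (app ι V g) le_rfl (res E h (f • e)) =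
            resFn h f • homApply (app ι V g) le_rfl (res E h e)
          rw [(res E h).map_smulₛₗ, map_smul] })
    (fun {V U} h e ↦ HomSec.ext fun W h' g ↦ by
      change homApply (app ι W g) le_rfl (res E h' (res E h e)) =
        homApply (app ι W g) le_rfl (res E (h'.trans h) e)
      rw [res_res])

theorem homApply_transpose {E N : OMod X} (ι : G ⟶ ihom E N) {U V : Opens X} (h : V ≤ U)
    (e : Sec E U) (g : Sec G V) :
    homApply (app (transpose ι) U e) h g = homApply (app ι V g) le_rfl (res E h e) := rfl

end InternalHom

section Bundles

variable (X) in
/-- The structure sheaf, as a module over itself. -/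
def structureMod : OMod X := SheafOfModules.unit (ringSheaf X)

/-- Sections of `𝒪_X` as a module are functions. -/
def toFn {U : Opens X} : Sec (structureMod X) U ≃ₗ[Fn X U] Fn X U where
  toFun f := f
  invFun f := f
  map_add' _ _ := rfl
  map_smul' _ _ := rfl
  left_inv _ := rfl
  right_inv _ := rfl

theorem toFn_res {V U : Opens X} (h : V ≤ U) (f : Sec (structureMod X) U) :
    toFn (res _ h f) = resFn h (toFn f) := rfl

/-- The sections `e i` form a frame of `F` over `U`. -/
def IsFrame {F : OMod X} {r : ℕ} {U : Opens X} (e : Fin r → Sec F U) : Prop :=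
  ∀ (V : Opens X) (h : V ≤ U),
    Function.Bijective fun c : Fin r → Fn X V ↦ ∑ i, c i • res F h (e i)

/-- `F` is (the sheaf of sections of) a vector bundle of rank `r`, i.e. a locally free sheaf. -/
def IsVectorBundle (F : OMod X) (r : ℕ) : Prop :=
  ∀ p : X, ∃ (U : Opens X) (_ : p ∈ U) (e : Fin r → Sec F U), IsFrame e

/-- Line bundles. -/
def IsLineBundle (M : OMod X) : Prop := IsVectorBundle M 1

/-- The dual sheaf `F^∨`. -/
def dual (F : OMod X) : OMod X := ihom F (structureMod X)

/-- `M(-x) = M ⊗ 𝒪_X(-x)`, as the sheaf of sections of the line bundle `M` that vanish at `x`,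
i.e. the kernel of `M ⟶ M_x`. -/
def twistDown (M : OMod X) (x : X) : OMod X :=
  Limits.kernel (toSkyscraper x M LinearMap.id)

/-- The inclusion `M(-x) ⟶ M`. -/
def twistDownι (M : OMod X) (x : X) : twistDown M x ⟶ M := Limits.kernel.ι _

/-- `L(x) = L ⊗ 𝒪_X(-x)^∨`, as the sheaf `ℋom(𝒪_X(-x), L)`. -/
def twistUp (L : OMod X) (x : X) : OMod X := ihom (twistDown (structureMod X) x) L

/-- The inclusion `L ⟶ L(x)`, sending `l` to the multiplication `f ↦ f l`. -/
def toTwistUp (L : OMod X) (x : X) : L ⟶ twistUp L x :=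
  mkHom (G := ihom (twistDown (structureMod X) x) L)
    (fun U ↦
      { toFun := fun l ↦ HomSec.mk
          (fun {V} h ↦
            { toFun := fun f ↦ toFn (app (twistDownι (structureMod X) x) V f) • res L h l
              map_add' := fun f f' ↦ by rw [map_add, map_add, add_smul]
              map_smul' := fun c f ↦ by
                rw [map_smul, map_smul, smul_assoc, RingHom.id_apply] })
          (fun {W V} h h' f ↦ by
            change toFn (app (twistDownι (structureMod X) x) W (res _ h f)) • res L (h.trans h') l =
              res L h (toFn (app (twistDownι (structureMod X) x) V f) • res L h' l)
            rw [(res L h).map_smulₛₗ, res_res, app_res, toFn_res])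
        map_add' := fun l l' ↦ HomSec.ext fun V h f ↦ by
          change toFn (app (twistDownι (structureMod X) x) V f) • res L h (l + l') =
            toFn (app (twistDownι (structureMod X) x) V f) • res L h l +
              toFn (app (twistDownι (structureMod X) x) V f) • res L h l'
          rw [map_add, smul_add]
        map_smul' := fun c l ↦ HomSec.ext fun V h f ↦ by
          change toFn (app (twistDownι (structureMod X) x) V f) • res L h (c • l) =
            resFn h c • toFn (app (twistDownι (structureMod X) x) V f) • res L h l
          rw [(res L h).map_smulₛₗ, smul_comm] })
    (fun {V U} h l ↦ HomSec.ext fun W h' f ↦ by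
      change toFn (app (twistDownι (structureMod X) x) W f) • res L h' (res L h l) =
        toFn (app (twistDownι (structureMod X) x) W f) • res L (h'.trans h) l
      rw [res_res])

end Bundles

section Forms

variable {F M : OMod X}

/-- Symmetric forms. -/
def BilinForm.IsSymmetric (ψ : BilinForm F M) : Prop :=
  ∀ (U : Opens X) (s t : Sec F U), ψ.pair U s t = ψ.pair U t s

/-- The annihilator `l_p = ker (F_p → F_p^∨ ⊗ M_p)` of the fibre at `p`. -/
def BilinForm.annihilator (ψ : BilinForm F M) (p : X) : Submodule (κ p) (Fiber F p) :=
  LinearMap.ker (ψ.fiber p)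

/-- Nondegeneracy of the form on the fibre at `p`. -/
def BilinForm.NondegenerateAt (ψ : BilinForm F M) (p : X) : Prop := ψ.annihilator p = ⊥

/-- `(E, φ : E ⊗ E ⟶ L)` is an orthogonal bundle of rank `r`. -/
structure IsOrthogonalBundle {E L : OMod X} (φ : BilinForm E L) (r : ℕ) : Prop where
  bundle : IsVectorBundle E r
  line : IsLineBundle L
  symm : φ.IsSymmetric
  nondegenerate : ∀ p, φ.NondegenerateAt p

/-- A vector bundle `F` of rank `r` with a symmetric form `ψ : F ⊗ F ⟶ M`, `M` a line bundle, that
induces a short exact sequence `0 ⟶ F ⟶ F^∨ ⊗ M ⟶ ℂ_x ⟶ 0`, where `ℂ_x` is the skyscraper sheaf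
of length one at `x`. -/
structure IsSimplyDegenerate (ψ : BilinForm F M) (x : X) (r : ℕ) : Prop where
  bundle : IsVectorBundle F r
  line : IsLineBundle M
  symm : ψ.IsSymmetric
  exact : ∃ (q : ihom F M ⟶ skyscraper x (κ x)) (w : ψ.adjoint ≫ q = 0),
    (ShortComplex.mk ψ.adjoint q w).ShortExact

/-- `t` is a local parameter at `x`. -/
def IsLocalParameter {U : Opens X} {x : X} (hx : x ∈ U) (t : Fn X U) : Prop :=
  Ideal.span {germFn hx t} = IsLocalRing.maximalIdeal (X.presheaf.stalk x)

/-- The entries of the block matrix with rows `(0, 0, 1_n)`, `(0, t, 0)`, `(1_n, 0, 0)`. -/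
def standardEntry (n : ℕ) {R : Type*} [CommRing R] (t : R) (i j : Fin (2 * n + 1)) : R :=
  if (i : ℕ) = n ∧ (j : ℕ) = n then t
  else if (i : ℕ) = j + (n + 1) ∨ (j : ℕ) = i + (n + 1) then 1
  else 0

/-- In a neighbourhood of `x`, for suitable frames, `ψ` is given by the block matrix with rows
`(0, 0, 1_n)`, `(0, t, 0)`, `(1_n, 0, 0)`, where `t` is a local parameter at `x`. -/
def HasStandardFormAt (ψ : BilinForm F M) (x : X) (n : ℕ) : Prop :=
  ∃ (U : Opens X) (hx : x ∈ U) (e : Fin (2 * n + 1) → Sec F U) (m : Sec M U) (t : Fn X U),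
    IsFrame e ∧ IsFrame (fun _ : Fin 1 ↦ m) ∧ IsLocalParameter hx t ∧
      ∀ i j, ψ.pair U (e i) (e j) = standardEntry n t i j • m

/-- The inverse form `φ⁻¹ : E^∨ ⊗ E^∨ ⟶ L^∨` of an orthogonal bundle `(E, φ : E ⊗ E ⟶ L)`: it is
adjoint to the inverse of the map `E ⊗ L^∨ ⟶ E^∨`, `e ⊗ ν ↦ ν(φ(e, -))`. In other words,
`φ⁻¹(a, b) = b(e) ν` whenever `a = ν(φ(e, -))`. -/
def IsInverseForm {E L : OMod X} (φ : BilinForm E L) (φ' : BilinForm (dual E) (dual L)) : Prop :=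
  ∀ (U : Opens X) (e : Sec E U) (ν : Sec (dual L) U) (a b : Sec (dual E) U),
    (∀ (V : Opens X) (h : V ≤ U) (s : Sec E V),
      homApply a h s = homApply ν h (φ.pair V (res E h e) s)) →
    φ'.pair U a b = toFn (homApply b le_rfl e) • ν

/-- The form `ψ` on `F` and the form `φ` on `E` correspond to each other under `β : E ⟶ F` and
`i : L ⟶ M`, i.e. `i ∘ φ = ψ ∘ (β ⊗ β)`. -/
def FormsCompatible {E L : OMod X} (φ : BilinForm E L) (ψ : BilinForm F M) (β : E ⟶ F)
    (i : L ⟶ M) : Prop :=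
  ∀ (U : Opens X) (s t : Sec E U), app i U (φ.pair U s t) = ψ.pair U (app β U s) (app β U t)

/-- A subspace of a fibre is isotropic. -/
def IsIsotropicIn (ψ : BilinForm F M) (x : X) (T : Submodule (κ x) (Fiber F x)) : Prop :=
  T ≤ T.orthogonalBilin (ψ.fiber x)

/-- A subspace `S` of `F_x / l_x` is isotropic for the form induced on `F_x / l_x`. -/
def IsIsotropicModAnnihilator (ψ : BilinForm F M) (x : X)
    (S : Submodule (κ x) (Fiber F x ⧸ ψ.annihilator x)) : Prop :=
  ∀ v w : Fiber F x, (ψ.annihilator x).mkQ v ∈ S → (ψ.annihilator x).mkQ w ∈ S →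
    ψ.fiber x v w = 0

/-- The kernel of `F ⟶ F_x ⟶ F_x / T`. -/
def elementaryTransform (F : OMod X) (x : X) (T : Submodule (κ x) (Fiber F x)) : OMod X :=
  Limits.kernel (toSkyscraper x F T.mkQ)

/-- The inclusion of the kernel of `F ⟶ F_x ⟶ F_x / T` in `F`. -/
def elementaryTransformι (F : OMod X) (x : X) (T : Submodule (κ x) (Fiber F x)) :
    elementaryTransform F x T ⟶ F :=
  Limits.kernel.ι _

/-- The kernel `E` of `F ⟶ F_x ⟶ F_x / l_x ⟶ (F_x / l_x) / S = Q_x`. -/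
def heckeTransform (ψ : BilinForm F M) (x : X)
    (S : Submodule (κ x) (Fiber F x ⧸ ψ.annihilator x)) : OMod X :=
  Limits.kernel (toSkyscraper x F (S.mkQ ∘ₗ (ψ.annihilator x).mkQ))

/-- The inclusion `E ⟶ F`. -/
def heckeTransformι (ψ : BilinForm F M) (x : X)
    (S : Submodule (κ x) (Fiber F x ⧸ ψ.annihilator x)) : heckeTransform ψ x S ⟶ F :=
  Limits.kernel.ι _

end Forms

end

/-- A Riemann surface as a locally ringed space, with its sheaf of holomorphic functions
(complex differentiable to any order). -/
noncomputable abbrev holomorphicSpace (X : Type) [TopologicalSpace X] [ChartedSpace ℂ X] :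
    LocallyRingedSpace.{0} :=
  ChartedSpace.locallyRingedSpace 𝓘(ℂ) X

end OrthogonalHecke

open OrthogonalHecke

namespace OrthogonalHecke
universe u
noncomputable section
open Module
variable {X : LocallyRingedSpace.{u}}

/-! Both directions are determinant counts in frames adapted to a subspace `T` of a fibre. If part
of a frame `f` spans `T` at `x`, the sections with value in `T` at `x` have a frame `d_i f_i`, with
`d_i = 1` on that part and `d_i = t`, a parameter, on the rest
(`IsElementaryTransform.exists_frames`).

(1) Exactness of `0 → F → F^∨ ⊗ M → ℂ_x → 0` makes `F` the transform of `F^∨ ⊗ M` along a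
hyperplane. The Gram matrix `A` of `ψ` near `x` is therefore `diag(1, …, t, …, 1) Q` with `Q`
invertible (`IsSimplyDegenerate.exists_isGram`): its determinant is a unit times `t`, and `l_x` is a
line. The preimage `T` of `S_x` has dimension `n + 1` and is isotropic, so `ψ` takes values in
`M(-x)` on `E`. As `M(-x)` is generated by `t m`, the matrix `G` of `φ` satisfies `d_i d_j A_ij = t
G_ij`. Hence `t^(2n) det A = t^(2n+1) det G`, and `det G` is a unit.

(2) `W^⊥` has dimension `n + 1`, so `E → F` is diagonal with `n + 1` entries `1` and `n` entries
`t`, and `L → L(x)` is multiplication by `t`. If `t s` and `t s'` come from sections `a`, `a'` of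
`E`, then `ψ(s, s')` has to be `t⁻² φ(a, a')`, which lies in `L(x)` exactly when `φ(a, a')` vanishes
at `x`. For a local generator `ν` of `L^∨`, the forms `ν φ(a, -)` and `ν φ(a', -)` are orthogonal to
`W^⊥` at `x`. Since `W ⊆ W^⊥`, the second lies in `W^⊥`, so the two are orthogonal to each other,
and their product is `ν(φ(a', a)) ν` (`IsInverseForm.isExtendable`). Gluing is `exists_extension`.
The same count gives `det C = t det A` for the matrix `C` of `ψ`.

The standard form is then algebra over the local ring `𝒪_{X,x}`, where `2` is a unit and units are
squares. A symmetric form of discriminant unit times `t` splits off vectors of length one until a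
form of rank one is left; since `-1` is a square, the unit vectors pair up to hyperbolic planes
(`exists_standard_basis`). Pulling `t` out of the middle row of the standard matrix leaves an
invertible matrix, which gives back the short exact sequence (`IsGram.isSimplyDegenerate`).

The geometry enters only through `IsCurvePoint`: division by a parameter is the removable
singularity theorem, and square roots come from the complex logarithm. -/

/-! ### Locality of sections and morphisms -/

theorem sec_ext (F : OMod X) {U : Opens X} {s t : Sec F U}
    (h : ∀ p ∈ U, ∃ (V : Opens X) (_ : p ∈ V) (hV : V ≤ U), res F hV s = res F hV t) : s = t := by
  choose V hp hV e using fun p : U ↦ h p p.2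
  obtain ⟨w, -, hw⟩ := exists_glue F V U hV
    (fun p hpU ↦ Opens.mem_iSup.2 ⟨⟨p, hpU⟩, hp _⟩) (fun p ↦ res F (hV p) t)
    (fun i j ↦ by rw [res_res, res_res])
  exact (hw s e).trans (hw t fun _ ↦ rfl).symm

/-- Sections determined locally and uniquely by a property glue. -/
theorem exists_sec_of_local (F : OMod X) (U : Opens X) (P : ∀ V : Opens X, V ≤ U → Sec F V → Prop)
    (mono : ∀ {W V : Opens X} (h : W ≤ V) (hV : V ≤ U) (s : Sec F V),
      P V hV s → P W (h.trans hV) (res F h s))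
    (uniq : ∀ (V : Opens X) (hV : V ≤ U) (s t : Sec F V), P V hV s → P V hV t → s = t)
    (ex : ∀ p ∈ U, ∃ (V : Opens X) (_ : p ∈ V) (hV : V ≤ U) (s : Sec F V), P V hV s) :
    ∃ s : Sec F U, ∀ p ∈ U, ∃ (V : Opens X) (_ : p ∈ V) (hV : V ≤ U), P V hV (res F hV s) := by
  choose V hp hV s hs using fun p : U ↦ ex p p.2
  obtain ⟨w, hw, -⟩ := exists_glue F V U hV
    (fun p hpU ↦ Opens.mem_iSup.2 ⟨⟨p, hpU⟩, hp _⟩) s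
    (fun i j ↦ uniq _ (inf_le_left.trans (hV i)) _ _ (mono _ _ _ (hs i)) (mono _ _ _ (hs j)))
  exact ⟨w, fun p hpU ↦ ⟨V ⟨p, hpU⟩, hp _, hV _, by rw [hw]; exact hs _⟩⟩

theorem hom_ext {F G : OMod X} {f g : F ⟶ G} (h : ∀ U s, app f U s = app g U s) : f = g := by
  apply SheafOfModules.hom_ext
  apply PresheafOfModules.hom_ext
  intro U
  ext s
  exact h U.unop s

theorem app_comp {F G H : OMod X} (f : F ⟶ G) (g : G ⟶ H) (U : Opens X) (s : Sec F U) :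
    app (f ≫ g) U s = app g U (app f U s) := rfl

theorem app_zero {F G : OMod X} (U : Opens X) (s : Sec F U) : app (0 : F ⟶ G) U s = 0 := rfl

/-! ### Kernels and monomorphisms, computed on sections -/

section Kernel
variable {F G : OMod X} (f : F ⟶ G)

/-- The kernel of a morphism, computed on sections. -/
def kerMod : OMod X :=
  mkMod (fun U ↦ LinearMap.ker (app f U))
    (fun {V U} h ↦
      { toFun := fun s ↦ ⟨res F h s.1, by
          rw [LinearMap.mem_ker, app_res, LinearMap.mem_ker.1 s.2, map_zero]⟩
        map_zero' := Subtype.ext (map_zero _)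
        map_add' := fun _ _ ↦ Subtype.ext (map_add _ _ _) })
    (fun h a s ↦ Subtype.ext ((res F h).map_smulₛₗ a s.1))
    (fun s ↦ Subtype.ext (res_self F s.1)) (fun h h' s ↦ Subtype.ext (res_res F h h' s.1))
    (by
      intro ι U s hs
      obtain ⟨t, ht, ht'⟩ := exists_glue F U (iSup U) (le_iSup U) le_rfl (fun i ↦ (s i).1)
        (fun i j ↦ congrArg Subtype.val (hs i j))
      refine ⟨⟨t, ?_⟩, fun i ↦ Subtype.ext (ht i),
        fun t' h ↦ Subtype.ext (ht' t'.1 fun i ↦ congrArg Subtype.val (h i))⟩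
      rw [LinearMap.mem_ker]
      refine sec_ext G fun p hp ↦ ?_
      obtain ⟨i, hi⟩ := Opens.mem_iSup.1 hp
      refine ⟨U i, hi, le_iSup U i, ?_⟩
      rw [← app_res, ht, map_zero]
      exact (s i).2)

def kerModι : kerMod f ⟶ F :=
  mkHom (F := kerMod f) (fun U ↦ (LinearMap.ker (app f U)).subtype) (fun _ _ ↦ rfl)

theorem exists_app_kerModι {U : Opens X} {s : Sec F U} (h : app f U s = 0) :
    ∃ s' : Sec (kerMod f) U, app (kerModι f) U s' = s := ⟨⟨s, h⟩, rfl⟩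

theorem kerModι_comp : kerModι f ≫ f = 0 := hom_ext fun U s ↦ s.2

theorem mono_of_injective (h : ∀ U, Function.Injective (app f U)) : Mono f :=
  ⟨fun a b e ↦ hom_ext fun U s ↦ h U (by rw [← app_comp, ← app_comp, e])⟩

/-- The sectionwise kernel is itself a sheaf of modules, and a monomorphism forces its inclusion to
be zero. -/
theorem injective_of_mono [Mono f] (U : Opens X) : Function.Injective (app f U) := by
  rw [injective_iff_map_eq_zero]
  intro s hs
  have h0 : kerModι f = 0 := (cancel_mono f).1 ((kerModι_comp f).trans Limits.zero_comp.symm)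
  obtain ⟨s', rfl⟩ := exists_app_kerModι f hs
  rw [h0, app_zero]

/-- A morphism that is injective on sections with image the kernel of `f` is a kernel of `f`. -/
def isLimitOfInjective {K : OMod X} (i : K ⟶ F) (w : i ≫ f = 0)
    (inj : ∀ U, Function.Injective (app i U))
    (ex : ∀ U (s : Sec F U), app f U s = 0 → ∃ s', app i U s' = s) :
    Limits.IsLimit (Limits.KernelFork.ofι i w) := by
  have := mono_of_injective i inj
  have key {A : OMod X} (k : A ⟶ F) (hk : k ≫ f = 0) : ∃ l : A ⟶ K, l ≫ i = k := by
    have hk' (U : Opens X) (a : Sec A U) : ∃ s', app i U s' = app k U a :=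
      ex U _ (by rw [← app_comp, hk, app_zero])
    choose l hl using hk'
    refine ⟨mkHom (fun U ↦
      { toFun := l U
        map_add' := fun a b ↦ inj U (by rw [map_add, hl, hl, hl, map_add])
        map_smul' := fun c a ↦ inj U (by rw [RingHom.id_apply, map_smul, hl, hl, map_smul]) })
      (fun {V U} h s ↦ inj V ?_), hom_ext fun U s ↦ hl U s⟩
    change app i V (l V _) = app i V (res K h (l U s))
    rw [hl, app_res, app_res, hl]
  exact Limits.KernelFork.IsLimit.ofι i w (fun k hk ↦ (key k hk).choose)
    (fun k hk ↦ (key k hk).choose_spec)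
    (fun k hk m hm ↦ (cancel_mono i).1 (hm.trans (key k hk).choose_spec.symm))

/-- The sectionwise kernel maps to every categorical kernel, so the latter contains all sections
that `f` kills, over each open set and without sheafification. -/
theorem exists_of_isLimit {K : OMod X} (i : K ⟶ F) (w : i ≫ f = 0)
    (h : Limits.IsLimit (Limits.KernelFork.ofι i w)) (U : Opens X) (s : Sec F U)
    (hs : app f U s = 0) : ∃ s', app i U s' = s := by
  obtain ⟨s', rfl⟩ := exists_app_kerModι f hs
  obtain ⟨l, hl⟩ := Limits.KernelFork.IsLimit.lift' h (kerModι f) (kerModι_comp f)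
  exact ⟨app l U s', by rw [← hl]; rfl⟩

theorem kernelι_injective (U : Opens X) : Function.Injective (app (Limits.kernel.ι f) U) :=
  injective_of_mono _ U

theorem exists_app_kernelι {U : Opens X} {s : Sec F U} (h : app f U s = 0) :
    ∃ s', app (Limits.kernel.ι f) U s' = s :=
  exists_of_isLimit f _ (Limits.kernel.condition f) (Limits.kernelIsKernel f) U s h

theorem app_app_kernelι (U : Opens X) (s : Sec (Limits.kernel f) U) :
    app f U (app (Limits.kernel.ι f) U s) = 0 := by
  rw [← app_comp, Limits.kernel.condition, app_zero]

end Kernel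

/-! ### Elementary transforms as subsheaves cut out by a condition at `x` -/

theorem app_toSkyscraper_eq_zero_iff {F : OMod X} {x : X} {V : Type u} [AddCommGroup V]
    [Module (κ x) V] (g : Fiber F x →ₗ[κ x] V) {U : Opens X} (s : Sec F U) :
    app (toSkyscraper x F g) U s = 0 ↔ ∀ hx : x ∈ U, g (value F hx s) = 0 :=
  ⟨fun h hx ↦ congrFun (show (fun hx ↦ g (value F hx.down s) : SkySec x V U) = 0 from h) ⟨hx⟩,
    fun h ↦ show (fun hx ↦ g (value F hx.down s) : SkySec x V U) = 0 from
      funext fun hx ↦ h hx.down⟩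

/-- `β : E ⟶ F` is, up to isomorphism, the inclusion of the subsheaf of sections of `F` whose
value at `x` lies in `T`. -/
structure IsElementaryTransform {E F : OMod X} (β : E ⟶ F) (x : X)
    (T : Submodule (κ x) (Fiber F x)) : Prop where
  inj (U : Opens X) : Function.Injective (app β U)
  mem {U : Opens X} (s : Sec E U) (hx : x ∈ U) : value F hx (app β U s) ∈ T
  exists_lift {U : Opens X} (s : Sec F U) (h : ∀ hx : x ∈ U, value F hx s ∈ T) :
    ∃ s', app β U s' = s

theorem isElementaryTransform_kernel {F : OMod X} {x : X} {V : Type u} [AddCommGroup V]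
    [Module (κ x) V] (g : Fiber F x →ₗ[κ x] V) :
    IsElementaryTransform (Limits.kernel.ι (toSkyscraper x F g)) x (LinearMap.ker g) where
  inj := kernelι_injective _
  mem s hx := (app_toSkyscraper_eq_zero_iff g _).1 (app_app_kernelι _ _ s) hx
  exists_lift s h := exists_app_kernelι _ ((app_toSkyscraper_eq_zero_iff g s).2 h)

theorem isElementaryTransform_elementaryTransform (F : OMod X) (x : X)
    (T : Submodule (κ x) (Fiber F x)) :
    IsElementaryTransform (elementaryTransformι F x T) x T := by
  have h := isElementaryTransform_kernel T.mkQ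
  rw [Submodule.ker_mkQ] at h
  exact h

theorem isElementaryTransform_twistDown (M : OMod X) (x : X) :
    IsElementaryTransform (twistDownι M x) x ⊥ := by
  have h := isElementaryTransform_kernel (F := M) (x := x) LinearMap.id
  rw [LinearMap.ker_id] at h
  exact h

theorem isElementaryTransform_heckeTransform {F M : OMod X} (ψ : BilinForm F M) (x : X)
    (S : Submodule (κ x) (Fiber F x ⧸ ψ.annihilator x)) :
    IsElementaryTransform (heckeTransformι ψ x S) x (S.comap (ψ.annihilator x).mkQ) := by
  have h := isElementaryTransform_kernel (S.mkQ ∘ₗ (ψ.annihilator x).mkQ)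
  rw [LinearMap.ker_comp, Submodule.ker_mkQ] at h
  exact h

/-! ### Short exact sequences ending in a skyscraper sheaf -/

section ShortExact
variable {F G : OMod X} {x : X} {f : F ⟶ G} {q : G ⟶ skyscraper x (κ x)} {w : f ≫ q = 0}

theorem shortExact_injective (h : (ShortComplex.mk f q w).ShortExact) (U : Opens X) :
    Function.Injective (app f U) :=
  have := h.mono_f
  injective_of_mono f U

theorem shortExact_exists (h : (ShortComplex.mk f q w).ShortExact) {U : Opens X} {s : Sec G U}
    (hs : app q U s = 0) : ∃ s', app f U s' = s :=
  exists_of_isLimit q f w h.fIsKernel U s hs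

theorem skyscraper_ne_zero : 𝟙 (skyscraper x (κ x)) ≠ 0 := by
  intro h
  have := congrArg (fun k ↦ app k ⊤ (show Sec (skyscraper x (κ x)) ⊤ from
    (fun _ ↦ 1 : SkySec x (κ x) ⊤))) h
  exact one_ne_zero (congrFun (show (fun _ ↦ 1 : SkySec x (κ x) ⊤) = 0 from this) ⟨trivial⟩)

theorem shortExact_exists_ne_zero (h : (ShortComplex.mk f q w).ShortExact) :
    ∃ (U : Opens X) (s : Sec G U), app q U s ≠ 0 := by
  by_contra! H
  have := h.epi_g
  have h0 : q = 0 := hom_ext H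
  exact skyscraper_ne_zero ((cancel_epi q).1 (by rw [h0]; simp))

/-- The epimorphism is tested locally on the skyscraper sheaf: near `x` a section is hit by a
section of `G` with a prescribed value, and away from `x` there is nothing to lift. -/
theorem shortExact_toSkyscraper {g : Fiber G x →ₗ[κ x] κ x}
    (h : IsElementaryTransform f x (LinearMap.ker g)) (hg : Function.Surjective g)
    (hx : IsClosed ({x} : Set X))
    (hv : ∀ v : Fiber G x, ∃ (U : Opens X) (hx : x ∈ U) (s : Sec G U), value G hx s = v) :
    ∃ (q : G ⟶ skyscraper x (κ x)) (w : f ≫ q = 0), (ShortComplex.mk f q w).ShortExact := by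
  have w : f ≫ toSkyscraper x G g = 0 := hom_ext fun U s ↦
    (app_toSkyscraper_eq_zero_iff g _).2 fun hx ↦ h.mem s hx
  have := mono_of_injective f h.inj
  have : Epi (toSkyscraper x G g) := by
    refine ⟨fun {A} a b e ↦ hom_ext fun U c ↦ sec_ext A fun p hp ↦ ?_⟩
    by_cases hpx : p = x
    · subst hpx
      obtain ⟨v, hv'⟩ := hg ((show SkySec p (κ p) U from c) ⟨hp⟩)
      obtain ⟨V, hV, s, rfl⟩ := hv v
      refine ⟨U ⊓ V, ⟨hp, hV⟩, inf_le_left, ?_⟩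
      have hc : res (skyscraper p (κ p)) (inf_le_left : U ⊓ V ≤ U) c =
          app (toSkyscraper p G g) (U ⊓ V) (res G inf_le_right s) := by
        refine funext (α := PLift (p ∈ U ⊓ V)) fun i ↦ ?_
        change (show SkySec p (κ p) U from c) ⟨_⟩ = g (value G _ (res G _ s))
        rw [value, germ_res]
        exact hv'.symm
      rw [← app_res, ← app_res, hc, ← app_comp, ← app_comp, e]
    · refine ⟨U ⊓ ⟨{x}ᶜ, hx.isOpen_compl⟩, ⟨hp, hpx⟩, inf_le_left, ?_⟩
      have hc : res (skyscraper x (κ x)) (inf_le_left : U ⊓ ⟨{x}ᶜ, hx.isOpen_compl⟩ ≤ U) c = 0 :=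
        funext (α := PLift (x ∈ U ⊓ ⟨{x}ᶜ, hx.isOpen_compl⟩)) fun i ↦ (i.down.2 rfl).elim
      rw [← app_res, ← app_res, hc, map_zero, map_zero]
  refine ⟨toSkyscraper x G g, w, { exact := ?_ }⟩
  exact ShortComplex.exact_of_f_is_kernel _ (isLimitOfInjective _ _ w h.inj fun U s hs ↦
    h.exists_lift s fun hx ↦ (app_toSkyscraper_eq_zero_iff g s).1 hs hx)

end ShortExact

/-! ### Bases and invertible matrices -/

section LinearAlgebra
variable {R V : Type*} [CommRing R] [AddCommGroup V] [Module R V]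
  {ι : Type*} [Fintype ι] [DecidableEq ι]

theorem basis_det_sum (b : Basis ι R V) (P : Matrix ι ι R) :
    b.det (fun i ↦ ∑ j, P i j • b j) = P.det := by
  rw [Basis.det_apply, ← Matrix.det_transpose P]
  congr 1
  ext i j
  simp [Basis.toMatrix_apply, Finsupp.single_apply]

theorem exists_basis_of_isUnit_det (b : Basis ι R V) {P : Matrix ι ι R} (hP : IsUnit P.det) :
    ∃ b' : Basis ι R V, ∀ i, b' i = ∑ j, P i j • b j := by
  rw [← basis_det_sum b P, ← Basis.is_basis_iff_det] at hP
  exact ⟨Basis.mk hP.1 hP.2.ge, fun i ↦ Basis.mk_apply _ _ _⟩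

theorem isUnit_det_of_basis (b b' : Basis ι R V) {P : Matrix ι ι R}
    (h : ∀ i, b' i = ∑ j, P i j • b j) : IsUnit P.det := by
  rw [← basis_det_sum b P, ← funext h]
  exact b.isUnit_det b'

end LinearAlgebra

/-! ### Germs and values near a point -/

section Functions

theorem resFn_self {U : Opens X} (f : Fn X U) : resFn le_rfl f = f :=
  congr($(X.presheaf.map_id (op U)) f)

theorem exists_isUnit_resFn {U : Opens X} {x : X} (hx : x ∈ U) {f : Fn X U}
    (h : IsUnit (germFn hx f)) : ∃ (V : Opens X) (_ : x ∈ V) (hV : V ≤ U), IsUnit (resFn hV f) := by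
  obtain ⟨V, i, hxV, hu⟩ := X.toRingedSpace.isUnit_res_of_isUnit_germ U f x hx h
  exact ⟨V, hxV, i.le, hu⟩

theorem valueFn_resFn {V U : Opens X} (h : V ≤ U) {x : X} (hx : x ∈ V) (f : Fn X U) :
    valueFn x hx (resFn h f) = valueFn x (h hx) f := by
  simp only [valueFn, RingHom.comp_apply, germFn_res]

theorem valueFn_ne_zero_iff {U : Opens X} {x : X} (hx : x ∈ U) (f : Fn X U) :
    valueFn x hx f ≠ 0 ↔ IsUnit (germFn hx f) := by
  simp only [valueFn, RingHom.comp_apply, IsLocalRing.residue_ne_zero_iff_isUnit]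

variable {ι : Type*} [Finite ι]

/-- A finite family of neighbourhoods of `x` contains a common one. -/
theorem exists_le_forall_nhd {x : X} (U : Opens X) (hU : x ∈ U) (W : ι → Opens X)
    (hW : ∀ i, x ∈ W i) : ∃ (V : Opens X) (_ : x ∈ V), V ≤ U ∧ ∀ i, V ≤ W i :=
  ⟨U ⊓ ⟨⋂ i, W i, isOpen_iInter_of_finite fun i ↦ (W i).isOpen⟩,
    ⟨hU, Set.mem_iInter.2 hW⟩, inf_le_left, fun i _ h ↦ Set.mem_iInter.1 h.2 i⟩

theorem exists_germFn_eq {x : X} (U : Opens X) (hU : x ∈ U) (a : ι → X.presheaf.stalk x) :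
    ∃ (V : Opens X) (hx : x ∈ V) (_ : V ≤ U) (c : ι → Fn X V), ∀ i, germFn hx (c i) = a i := by
  choose W hW f hf using fun i ↦ TopCat.Presheaf.exists_germ_eq X.presheaf (a i)
  obtain ⟨V, hV, hVU, hVW⟩ := exists_le_forall_nhd U hU W hW
  exact ⟨V, hV, hVU, fun i ↦ resFn (hVW i) (f i), fun i ↦ (germFn_res _ _ _).trans (hf i)⟩

theorem exists_resFn_eq {U : Opens X} {x : X} (hx : x ∈ U) (a b : ι → Fn X U)
    (h : ∀ i, germFn hx (a i) = germFn hx (b i)) :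
    ∃ (V : Opens X) (_ : x ∈ V) (hV : V ≤ U), ∀ i, resFn hV (a i) = resFn hV (b i) := by
  have (i : ι) : ∃ (V : Opens X) (_ : x ∈ V) (hV : V ≤ U), resFn hV (a i) = resFn hV (b i) := by
    obtain ⟨V, hV, i₁, i₂, e⟩ := TopCat.Presheaf.germ_eq X.presheaf x hx hx _ _ (h i)
    exact ⟨V, hV, i₁.le, e⟩
  choose W hW hWU e using this
  obtain ⟨V, hV, hVU, hVW⟩ := exists_le_forall_nhd U hx W hW
  refine ⟨V, hV, hVU, fun i ↦ ?_⟩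
  rw [← resFn_resFn (hVW i) (hWU i), e, resFn_resFn]

end Functions

section Values
variable {F : OMod X} {x : X}

theorem value_res {V U : Opens X} (h : V ≤ U) (hx : x ∈ V) (s : Sec F U) :
    value F hx (res F h s) = value F (h hx) s := by
  rw [value, germ_res]; rfl

theorem value_smul {U : Opens X} (hx : x ∈ U) (f : Fn X U) (s : Sec F U) :
    value F hx (f • s) = valueFn x hx f • value F hx s := by
  rw [value, germ_smul, value, TensorProduct.smul_tmul', TensorProduct.tmul_smul,
    TensorProduct.smul_tmul']
  congr 1

/-- The value at `x`, as an additive map. -/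
def valueHom (F : OMod X) {U : Opens X} {x : X} (hx : x ∈ U) : Sec F U →+ Fiber F x :=
  (TensorProduct.mk (X.presheaf.stalk x) (κ x) (Stalk F x) 1).toAddMonoidHom.comp (germ F hx)

theorem value_sum {U : Opens X} (hx : x ∈ U) {ι : Type*} (I : Finset ι) (s : ι → Sec F U) :
    value F hx (∑ i ∈ I, s i) = ∑ i ∈ I, value F hx (s i) := map_sum (valueHom F hx) s I

theorem value_sum_smul {U : Opens X} (hx : x ∈ U) {ι : Type*} [Fintype ι] (c : ι → Fn X U)
    (s : ι → Sec F U) :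
    value F hx (∑ i, c i • s i) = ∑ i, valueFn x hx (c i) • value F hx (s i) := by
  simp only [value_sum, value_smul]

/-- The residue map is surjective, so each vector of the fibre has the form `1 ⊗ a`, and the germ
`a` spreads out to a section. -/
theorem exists_value_eq {U : Opens X} (hU : x ∈ U) (v : Fiber F x) :
    ∃ (V : Opens X) (hx : x ∈ V) (_ : V ≤ U) (s : Sec F V), value F hx s = v := by
  obtain ⟨a, rfl⟩ := TensorProduct.mk_surjective (X.presheaf.stalk x) (Stalk F x) (κ x)
    IsLocalRing.residue_surjective v
  obtain ⟨V, hV, s, rfl⟩ := exists_germ_eq F a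
  exact ⟨U ⊓ V, ⟨hU, hV⟩, inf_le_left, res F inf_le_right s, congrArg _ (germ_res F _ _ s)⟩

theorem exists_values_eq {ι : Type*} [Finite ι] {U : Opens X} (hU : x ∈ U) (v : ι → Fiber F x) :
    ∃ (V : Opens X) (hx : x ∈ V) (_ : V ≤ U) (s : ι → Sec F V), ∀ i, value F hx (s i) = v i := by
  choose W hW hWU s hs using fun i ↦ exists_value_eq hU (v i)
  obtain ⟨V, hV, hVU, hVW⟩ := exists_le_forall_nhd U hU W hW
  exact ⟨V, hV, hVU, fun i ↦ res F (hVW i) (s i), fun i ↦ (value_res _ _ _).trans (hs i)⟩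

end Values

theorem res_sum_smul {F : OMod X} {V U : Opens X} (h : V ≤ U) {ι : Type*} [Fintype ι]
    (c : ι → Fn X U) (s : ι → Sec F U) :
    res F h (∑ i, c i • s i) = ∑ i, resFn h (c i) • res F h (s i) := by
  rw [map_sum]
  exact Finset.sum_congr rfl fun i _ ↦ (res F h).map_smulₛₗ _ _

/-! ### Frames of vector bundles and line bundles -/

section Frames
variable {F : OMod X} {r : ℕ} {U : Opens X} {e : Fin r → Sec F U}

theorem isFrame_of_basis
    (h : ∀ (V : Opens X) (h : V ≤ U), ∃ b : Basis (Fin r) (Fn X V) (Sec F V),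
      ∀ i, b i = res F h (e i)) : IsFrame e := by
  intro V hV
  obtain ⟨b, hb⟩ := h V hV
  convert b.equivFun.symm.bijective using 2 with c
  simp [Basis.equivFun_symm_apply, hb]

/-- The basis of the sections over `V ⊆ U` given by a frame over `U`. -/
def IsFrame.basis (he : IsFrame e) {V : Opens X} (h : V ≤ U) :
    Basis (Fin r) (Fn X V) (Sec F V) :=
  .ofEquivFun (LinearEquiv.ofBijective (Fintype.linearCombination (Fn X V) fun i ↦ res F h (e i))
    (he V h)).symm

theorem IsFrame.basis_apply (he : IsFrame e) {V : Opens X} (h : V ≤ U) (i : Fin r) :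
    he.basis h i = res F h (e i) := by
  rw [IsFrame.basis, Basis.coe_ofEquivFun, LinearEquiv.symm_symm]
  exact (Fintype.linearCombination_apply_single _ _ _ _).trans (one_smul _ _)

theorem IsFrame.sum_repr (he : IsFrame e) {V : Opens X} (h : V ≤ U) (s : Sec F V) :
    ∑ i, (he.basis h).repr s i • res F h (e i) = s := by
  simpa only [he.basis_apply] using (he.basis h).sum_repr s

theorem IsFrame.repr_sum (he : IsFrame e) {V : Opens X} (h : V ≤ U) (c : Fin r → Fn X V)
    (i : Fin r) : (he.basis h).repr (∑ j, c j • res F h (e j)) i = c i := by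
  simp only [← he.basis_apply, Basis.repr_sum_self]

theorem IsFrame.repr_res (he : IsFrame e) {W V : Opens X} (h : W ≤ V) (h' : V ≤ U) (s : Sec F V)
    (i : Fin r) :
    (he.basis (h.trans h')).repr (res F h s) i = resFn h ((he.basis h').repr s i) := by
  conv_lhs => rw [← he.sum_repr h' s, res_sum_smul]
  simp only [res_res, he.repr_sum]

theorem IsFrame.restrict (he : IsFrame e) {V : Opens X} (h : V ≤ U) :
    IsFrame fun i ↦ res F h (e i) :=
  isFrame_of_basis fun _ h' ↦ ⟨he.basis (h'.trans h), fun i ↦ by rw [he.basis_apply, res_res]⟩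

theorem IsFrame.of_matrix (he : IsFrame e) {P : Matrix (Fin r) (Fin r) (Fn X U)}
    (hP : IsUnit P.det) : IsFrame fun i ↦ ∑ j, P i j • e j := by
  refine isFrame_of_basis fun V h ↦ ?_
  have hP' : IsUnit (P.map (resFn h)).det := by
    rw [← RingHom.mapMatrix_apply, ← RingHom.map_det]
    exact hP.map _
  obtain ⟨b, hb⟩ := exists_basis_of_isUnit_det (he.basis h) hP'
  refine ⟨b, fun i ↦ ?_⟩
  rw [hb, res_sum_smul]
  simp only [he.basis_apply, Matrix.map_apply]

theorem IsFrame.exists_matrix (he : IsFrame e) {e' : Fin r → Sec F U} (he' : IsFrame e') :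
    ∃ P : Matrix (Fin r) (Fin r) (Fn X U), IsUnit P.det ∧ ∀ i, e' i = ∑ j, P i j • e j := by
  have h (i : Fin r) := (he.sum_repr le_rfl (e' i)).symm
  simp only [res_self] at h
  refine ⟨Matrix.of fun i j ↦ (he.basis le_rfl).repr (e' i) j,
    isUnit_det_of_basis (he.basis le_rfl) (he'.basis le_rfl) fun i ↦ ?_, h⟩
  simp only [IsFrame.basis_apply, res_self]
  exact h i

/-- A relation between the germs already holds on a neighbourhood, where coordinates in the frame
are unique; every germ lives on a neighbourhood inside `U`, where the frame generates. -/
theorem IsFrame.exists_stalkBasis (he : IsFrame e) {x : X} (hx : x ∈ U) :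
    ∃ b : Basis (Fin r) (X.presheaf.stalk x) (Stalk F x), ∀ i, b i = germ F hx (e i) := by
  have hli : LinearIndependent (X.presheaf.stalk x) fun i ↦ germ F hx (e i) := by
    rw [Fintype.linearIndependent_iff]
    intro a ha
    obtain ⟨V, hV, hVU, c, hc⟩ := exists_germFn_eq U hx a
    have h0 : germ F hV (∑ i, c i • res F hVU (e i)) = germ F hV 0 := by
      rw [map_sum, map_zero, ← ha]
      exact Finset.sum_congr rfl fun i _ ↦ by rw [germ_smul, germ_res, hc]
    obtain ⟨W, hW, h1, h1', h2⟩ := germ_eq_iff F hV hV _ _ h0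
    rw [res_sum_smul, map_zero] at h2
    simp only [res_res] at h2
    intro i
    have := he.repr_sum (h1.trans hVU) (fun i ↦ resFn h1 (c i)) i
    rw [h2, map_zero, Finsupp.zero_apply] at this
    rw [← hc, ← germFn_res h1 hW, ← this, map_zero]
  have hsp : ⊤ ≤ Submodule.span (X.presheaf.stalk x) (Set.range fun i ↦ germ F hx (e i)) := by
    rintro a -
    obtain ⟨V, hV, s, rfl⟩ := exists_germ_eq F a
    have hxW : x ∈ U ⊓ V := ⟨hx, hV⟩
    rw [← germ_res F (inf_le_right : U ⊓ V ≤ V) hxW,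
      ← he.sum_repr (inf_le_left : U ⊓ V ≤ U) (res F inf_le_right s), map_sum]
    refine Submodule.sum_mem _ fun i _ ↦ ?_
    rw [germ_smul, germ_res]
    exact Submodule.smul_mem _ _ (Submodule.subset_span ⟨i, rfl⟩)
  exact ⟨Basis.mk hli hsp, fun i ↦ Basis.mk_apply _ _ _⟩

/-- The basis of the fibre given by the values of a frame. -/
def IsFrame.fiberBasis (he : IsFrame e) {x : X} (hx : x ∈ U) :
    Basis (Fin r) (κ x) (Fiber F x) :=
  (he.exists_stalkBasis hx).choose.baseChange (κ x)

theorem IsFrame.fiberBasis_apply (he : IsFrame e) {x : X} (hx : x ∈ U) (i : Fin r) :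
    he.fiberBasis hx i = value F hx (e i) := by
  rw [IsFrame.fiberBasis, Basis.baseChange_apply, (he.exists_stalkBasis hx).choose_spec]
  rfl

theorem IsFrame.fiberBasis_repr_value (he : IsFrame e) {x : X} {V : Opens X} (hV : V ≤ U)
    (hx : x ∈ V) (s : Sec F V) (i : Fin r) :
    (he.fiberBasis (hV hx)).repr (value F hx s) i = valueFn x hx ((he.basis hV).repr s i) := by
  conv_lhs => rw [← he.sum_repr hV s, value_sum_smul]
  simp only [value_res, ← he.fiberBasis_apply, Basis.repr_sum_self]

/-- Sections whose values at `x` form a basis of the fibre form a frame near `x`. -/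
theorem IsFrame.exists_frame_of_values (he : IsFrame e) {x : X} (hx : x ∈ U)
    (s : Fin r → Sec F U) (b : Basis (Fin r) (κ x) (Fiber F x))
    (hs : ∀ i, value F hx (s i) = b i) :
    ∃ (V : Opens X) (_ : x ∈ V) (hV : V ≤ U), IsFrame fun i ↦ res F hV (s i) := by
  have h (i : Fin r) := (he.sum_repr le_rfl (s i)).symm
  simp only [res_self] at h
  let P : Matrix (Fin r) (Fin r) (Fn X U) := .of fun i j ↦ (he.basis le_rfl).repr (s i) j
  -- Nakayama in matrix form: the transition determinant is nonzero at `x`, hence invertible on a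
  -- neighbourhood.
  have hP : IsUnit (P.map (valueFn x hx)).det := by
    refine isUnit_det_of_basis (he.fiberBasis hx) b fun i ↦ ?_
    rw [← hs, h i, value_sum_smul]
    simp only [he.fiberBasis_apply]
    rfl
  rw [← RingHom.mapMatrix_apply, ← RingHom.map_det] at hP
  obtain ⟨V, hxV, hV, hu⟩ := exists_isUnit_resFn hx ((valueFn_ne_zero_iff hx _).1 hP.ne_zero)
  refine ⟨V, hxV, hV, ?_⟩
  rw [RingHom.map_det] at hu
  convert (he.restrict hV).of_matrix hu using 2 with i
  rw [h i, res_sum_smul]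
  rfl

theorem IsVectorBundle.exists_frame (hF : IsVectorBundle F r) {x : X} {U : Opens X} (hx : x ∈ U)
    (b : Basis (Fin r) (κ x) (Fiber F x)) :
    ∃ (V : Opens X) (hxV : x ∈ V) (_ : V ≤ U) (e : Fin r → Sec F V),
      IsFrame e ∧ ∀ i, value F hxV (e i) = b i := by
  obtain ⟨U', hx', e', he'⟩ := hF x
  obtain ⟨W, hW, hWU, s, hs⟩ := exists_values_eq (show x ∈ U ⊓ U' from ⟨hx, hx'⟩) b
  obtain ⟨V, hxV, hV, hV'⟩ := (he'.restrict (hWU.trans inf_le_right)).exists_frame_of_values hW s b hs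
  exact ⟨V, hxV, hV.trans (hWU.trans inf_le_left), _, hV',
    fun i ↦ (value_res _ _ _).trans (hs i)⟩

theorem IsVectorBundle.exists_frame_le (hF : IsVectorBundle F r) {x : X} {U : Opens X}
    (hx : x ∈ U) :
    ∃ (V : Opens X) (_ : x ∈ V) (_ : V ≤ U) (e : Fin r → Sec F V), IsFrame e := by
  obtain ⟨U', hx', e', he'⟩ := hF x
  exact ⟨U ⊓ U', ⟨hx, hx'⟩, inf_le_left, _, he'.restrict inf_le_right⟩

theorem IsVectorBundle.finrank_fiber (hF : IsVectorBundle F r) (x : X) :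
    finrank (κ x) (Fiber F x) = r := by
  obtain ⟨U, hx, e, he⟩ := hF x
  rw [finrank_eq_card_basis (he.fiberBasis hx), Fintype.card_fin]

theorem IsVectorBundle.finite_fiber (hF : IsVectorBundle F r) (x : X) :
    Module.Finite (κ x) (Fiber F x) := by
  obtain ⟨U, hx, e, he⟩ := hF x
  exact .of_basis (he.fiberBasis hx)

end Frames

section LineFrames
variable {M : OMod X} {U : Opens X} {m : Sec M U}

theorem isFrame_one_iff : IsFrame (fun _ : Fin 1 ↦ m) ↔ ∀ (V : Opens X) (h : V ≤ U),
    Function.Bijective fun c : Fn X V ↦ c • res M h m := by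
  refine forall₂_congr fun V h ↦ ?_
  rw [← Function.Bijective.of_comp_iff _ (Equiv.funUnique (Fin 1) (Fn X V)).bijective]
  refine iff_of_eq (congrArg _ (funext fun c ↦ ?_))
  simp

theorem IsFrame.exists_smul (hm : IsFrame fun _ : Fin 1 ↦ m) {V : Opens X} (h : V ≤ U)
    (s : Sec M V) : ∃ c : Fn X V, c • res M h m = s :=
  (isFrame_one_iff.1 hm V h).2 s

theorem IsFrame.smul_cancel (hm : IsFrame fun _ : Fin 1 ↦ m) {V : Opens X} (h : V ≤ U)
    {c c' : Fn X V} (e : c • res M h m = c' • res M h m) : c = c' :=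
  (isFrame_one_iff.1 hm V h).1 e

theorem IsFrame.exists_smul_self (hm : IsFrame fun _ : Fin 1 ↦ m) (s : Sec M U) :
    ∃ c : Fn X U, c • m = s := by
  simpa only [res_self] using hm.exists_smul le_rfl s

theorem IsFrame.smul_cancel_self (hm : IsFrame fun _ : Fin 1 ↦ m) {c c' : Fn X U}
    (e : c • m = c' • m) : c = c' :=
  hm.smul_cancel le_rfl (by simpa only [res_self] using e)

theorem IsFrame.value_ne_zero (hm : IsFrame fun _ : Fin 1 ↦ m) {x : X} (hx : x ∈ U) :
    value M hx m ≠ 0 := by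
  rw [← hm.fiberBasis_apply hx 0]
  exact (hm.fiberBasis hx).ne_zero 0

theorem IsFrame.value_smul_eq_zero_iff (hm : IsFrame fun _ : Fin 1 ↦ m) {x : X} (hx : x ∈ U)
    (c : Fn X U) : value M hx (c • m) = 0 ↔ valueFn x hx c = 0 := by
  rw [value_smul, smul_eq_zero_iff_left (hm.value_ne_zero hx)]

theorem IsLineBundle.exists_frame_le (hM : IsLineBundle M) {x : X} {U : Opens X} (hx : x ∈ U) :
    ∃ (V : Opens X) (_ : x ∈ V) (_ : V ≤ U) (m : Sec M V), IsFrame fun _ : Fin 1 ↦ m := by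
  obtain ⟨V, hxV, hV, e, he⟩ := IsVectorBundle.exists_frame_le hM hx
  refine ⟨V, hxV, hV, e 0, ?_⟩
  convert he using 2 with i
  rw [Subsingleton.elim i 0]

theorem isFrame_structureMod (U : Opens X) :
    IsFrame fun _ : Fin 1 ↦ (toFn (X := X) (U := U)).symm 1 := by
  refine isFrame_one_iff.2 fun V h ↦ ?_
  convert (toFn (X := X) (U := V)).symm.bijective using 2 with c
  apply toFn.injective
  rw [map_smul, toFn_res]
  simp

end LineFrames

/-! ### Gram matrices over a ring -/

section GramMatrix
variable {R V : Type*} [CommRing R] [AddCommGroup V] [Module R V]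
  {ι : Type*} [Fintype ι] [DecidableEq ι]

/-- The Gram matrix of a family of vectors. -/
def gram (B : V →ₗ[R] V →ₗ[R] R) (v : ι → V) : Matrix ι ι R := .of fun i j ↦ B (v i) (v j)

omit [Fintype ι] [DecidableEq ι] in
theorem gram_apply (B : V →ₗ[R] V →ₗ[R] R) (v : ι → V) (i j : ι) : gram B v i j = B (v i) (v j) :=
  rfl

/-- A change of basis `P` turns the Gram matrix `G` into `P G Pᵀ`, so `u` is the square of `det P`.
-/
theorem exists_det_gram (B : V →ₗ[R] V →ₗ[R] R) (b b' : Basis ι R V) :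
    ∃ u : R, IsUnit u ∧ (gram B b').det = u * (gram B b).det := by
  let P : Matrix ι ι R := .of fun i j ↦ b.repr (b' i) j
  have hP : ∀ i, b' i = ∑ j, P i j • b j := fun i ↦ (b.sum_repr (b' i)).symm
  have hu := isUnit_det_of_basis b b' hP
  refine ⟨P.det * P.det, hu.mul hu, ?_⟩
  have : gram B b' = P * gram B b * P.transpose := by
    ext i j
    rw [gram_apply, hP i, hP j]
    simp only [map_sum, map_smul, LinearMap.sum_apply, LinearMap.smul_apply, Matrix.mul_apply,
      gram_apply, Matrix.transpose_apply, smul_eq_mul, Finset.sum_mul, Finset.mul_sum]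
    refine Finset.sum_congr rfl fun k _ ↦ Finset.sum_congr rfl fun l _ ↦ ?_
    ring
  rw [this, Matrix.det_mul, Matrix.det_mul, Matrix.det_transpose]
  ring

end GramMatrix

/-! ### Symmetric forms over a local ring -/

section LocalRing
variable {R : Type*} [CommRing R] [IsLocalRing R]

/-- `V = R v ⊕ v^⊥` if `B v v = 1`, and `v^⊥` is free. -/
theorem exists_basis_cons {V : Type*} [AddCommGroup V] [Module R V] {k : ℕ}
    (b : Basis (Fin (k + 1)) R V) (B : V →ₗ[R] V →ₗ[R] R) (v : V) (hv : B v v = 1) :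
    ∃ (b₀ : Basis (Fin k) R (LinearMap.ker (B v))) (b' : Basis (Fin (k + 1)) R V),
      ⇑b' = Fin.cons v (Subtype.val ∘ ⇑b₀) := by
  have := Module.Finite.of_basis b
  have := Module.Free.of_basis b
  let s : V →ₗ[R] LinearMap.ker (B v) :=
    LinearMap.codRestrict _ (LinearMap.id - (B v).smulRight v) (fun z ↦ by
      rw [LinearMap.mem_ker, LinearMap.sub_apply, map_sub, LinearMap.smulRight_apply, map_smul, hv]
      simp)
  have hs : s ∘ₗ (LinearMap.ker (B v)).subtype = LinearMap.id := by
    ext z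
    have hz : B v z = 0 := z.2
    simp [s, hz]
  -- The complement is a retract of a free module, hence projective, hence free over a local ring;
  -- its rank is found by adding `v` back.
  have := Projective.of_split _ _ hs
  have : Module.Finite R (LinearMap.ker (B v)) :=
    Module.Finite.of_surjective s fun z ↦ ⟨z, LinearMap.congr_fun hs z⟩
  have : Module.Free R (LinearMap.ker (B v)) := free_of_flat_of_isLocalRing
  have hli : ∀ (c : R), ∀ z ∈ LinearMap.ker (B v), c • v + z = 0 → c = 0 := by
    intro c z hz h
    have := congrArg (B v) h
    rwa [map_add, map_smul, hv, LinearMap.mem_ker.1 hz, map_zero, smul_eq_mul, mul_one,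
      add_zero] at this
  have hsp : ∀ z : V, ∃ c : R, z + c • v ∈ LinearMap.ker (B v) := fun z ↦
    ⟨-(B v z), by rw [LinearMap.mem_ker, map_add, map_smul, hv]; simp⟩
  have hr : finrank R (LinearMap.ker (B v)) = k := by
    have h1 := finrank_eq_card_basis (Basis.mkFinCons v (finBasis R _) hli hsp)
    have h2 := finrank_eq_card_basis b
    simp only [Fintype.card_fin] at h1 h2
    omega
  exact ⟨finBasisOfFinrankEq R _ hr, Basis.mkFinCons v _ hli hsp, Basis.coe_mkFinCons _ _ _ _⟩

variable {t : R} (ht : Ideal.span {t} = IsLocalRing.maximalIdeal R) (ht0 : IsLeftRegular t)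
  (h2 : IsUnit (2 : R)) (hsq : ∀ a : R, IsUnit a → IsSquare a)

include ht ht0 in
-- In size at least two, a common factor `t` of the entries would make `t²` divide `u t`; after
-- cancelling, `t` divides a unit.
theorem not_forall_dvd_of_det {k : ℕ} {A : Matrix (Fin (k + 2)) (Fin (k + 2)) R} {u : R}
    (hu : IsUnit u) (hA : A.det = u * t) : ¬ ∀ i j, t ∣ A i j := by
  intro h
  choose A' hA' using h
  have e : A = t • Matrix.of A' := by
    ext i j
    exact hA' i j
  rw [e, Matrix.det_smul, Fintype.card_fin, pow_succ', mul_assoc, mul_comm u] at hA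
  have h1 := ht0 hA
  rw [pow_succ', mul_assoc] at h1
  have h3 : IsUnit t := isUnit_of_dvd_unit (Dvd.intro _ h1) hu
  have h4 : t ∈ IsLocalRing.maximalIdeal R := ht ▸ Ideal.mem_span_singleton_self t
  exact h4 h3

include h2 hsq in
-- By polarisation `2 B(v, w)` is a combination of values `B(z, z)`, which therefore cannot all lie
-- in the maximal ideal. A vector with `B(z, z)` a unit is rescaled by the inverse of a square root.
theorem exists_apply_self_eq_one {V : Type*} [AddCommGroup V] [Module R V]
    (B : V →ₗ[R] V →ₗ[R] R) (hB : ∀ v w, B v w = B w v) (v w : V) (h : IsUnit (B v w)) :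
    ∃ v, B v v = 1 := by
  have key : ∃ v, IsUnit (B v v) := by
    by_contra! H
    have e : B (v + w) (v + w) - B v v - B w w = 2 * B v w := by
      simp only [map_add, LinearMap.add_apply, hB w v]
      ring
    have : 2 * B v w ∈ IsLocalRing.maximalIdeal R := by
      rw [← e]
      exact sub_mem (sub_mem (H _) (H _)) (H _)
    exact this (h2.mul h)
  obtain ⟨v, hv⟩ := key
  obtain ⟨c, hc⟩ := hsq _ hv
  have hcu : IsUnit c := isUnit_of_dvd_unit (Dvd.intro _ hc.symm) hv
  obtain ⟨d, hd⟩ := hcu.exists_right_inv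
  refine ⟨d • v, ?_⟩
  simp only [map_smul, LinearMap.smul_apply, smul_eq_mul, hc]
  linear_combination (d * c + 1) * hd

include ht ht0 h2 hsq in
/-- A symmetric form over a local ring whose discriminant generates the maximal ideal is
diagonalisable with entries `1, …, 1, u t`. -/
theorem exists_diagonal_basis (k : ℕ) : ∀ {V : Type u} [AddCommGroup V] [Module R V]
    (b : Basis (Fin (k + 1)) R V) (B : V →ₗ[R] V →ₗ[R] R) (_ : ∀ v w, B v w = B w v)
    (u : R) (_ : IsUnit u) (_ : (gram B b).det = u * t),
    ∃ (b' : Basis (Fin (k + 1)) R V) (u' : R), IsUnit u' ∧ ∀ i j,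
      B (b' i) (b' j) = if i = j then (if i = Fin.last k then u' * t else 1) else 0 := by
  induction k with
  | zero =>
    intro V _ _ b B hB u hu h
    refine ⟨b, u, hu, fun i j ↦ ?_⟩
    obtain rfl : i = 0 := by omega
    obtain rfl : j = 0 := by omega
    rw [Matrix.det_fin_one, gram_apply] at h
    simpa using h
  | succ k ih =>
    intro V _ _ b B hB u hu h
    -- Over a local ring non-units lie in the ideal `(t)`, so if no entry were a unit, `t` would
    -- divide them all.
    have hex : ∃ i j, IsUnit (gram B b i j) := by
      by_contra! H
      refine not_forall_dvd_of_det ht ht0 hu h fun i j ↦ ?_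
      rw [← Ideal.mem_span_singleton, ht]
      exact H i j
    obtain ⟨i, j, hij⟩ := hex
    obtain ⟨v, hv⟩ := exists_apply_self_eq_one h2 hsq B hB _ _ hij
    obtain ⟨b₀, b', hb'⟩ := exists_basis_cons b B v hv
    let B₀ : LinearMap.ker (B v) →ₗ[R] LinearMap.ker (B v) →ₗ[R] R :=
      B.domRestrict₁₂ (LinearMap.ker (B v)) (LinearMap.ker (B v))
    have hv0 (z : LinearMap.ker (B v)) : B v z = 0 := z.2
    have hv0' (z : LinearMap.ker (B v)) : B z v = 0 := (hB _ _).trans z.2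
    -- The first row of the Gram matrix is `(1, 0, …, 0)`, so the discriminant passes to the
    -- complement of `v` unchanged.
    have hdet : (gram B b').det = (gram B₀ b₀).det := by
      rw [Matrix.det_succ_row_zero, Fin.sum_univ_succ, Finset.sum_eq_zero]
      · simp only [gram_apply, hb', Fin.cons_zero, hv, Fin.val_zero, pow_zero, one_mul, add_zero]
        congr 1
      · intro i _
        simp [gram_apply, hb', hv0]
    obtain ⟨w, hw, hww⟩ := exists_det_gram B b b'
    obtain ⟨c, u', hu', hc⟩ := ih b₀ B₀ (fun _ _ ↦ hB _ _) (w * u) (hw.mul hu)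
      (by rw [← hdet, hww, h, mul_assoc])
    obtain ⟨b'', hb''⟩ : ∃ b'' : Basis (Fin (k + 2)) R V, ⇑b'' = Fin.cons v (Subtype.val ∘ ⇑c) := by
      refine ⟨Basis.mkFinCons v c ?_ ?_, Basis.coe_mkFinCons _ _ _ _⟩
      · intro a z hz h
        have := congrArg (B v) h
        rwa [map_add, map_smul, hv, LinearMap.mem_ker.1 hz, map_zero, smul_eq_mul, mul_one,
          add_zero] at this
      · exact fun z ↦ ⟨-(B v z), by rw [LinearMap.mem_ker, map_add, map_smul, hv]; simp⟩
    refine ⟨b'', u', hu', fun i j ↦ ?_⟩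
    rw [hb'']
    refine Fin.cases ?_ (fun i ↦ ?_) i <;> refine Fin.cases ?_ (fun j ↦ ?_) j
    · simp [hv, (Fin.last_pos).ne]
    · simp [hv0, (Fin.succ_ne_zero _).symm]
    · simp [hv0']
    · have := hc i j
      simp only [B₀, LinearMap.domRestrict₁₂_apply] at this
      simpa [← Fin.succ_last] using this

/-- The indices of the first, the middle and the last basis vectors. -/
def blockIndex (n : ℕ) : Fin n ⊕ Unit ⊕ Fin n → Fin (2 * n + 1)
  | .inl i => ⟨i, by omega⟩
  | .inr (.inl _) => ⟨n, by omega⟩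
  | .inr (.inr i) => ⟨n + 1 + i, by omega⟩

theorem blockIndex_bijective (n : ℕ) : Function.Bijective (blockIndex n) := by
  rw [Fintype.bijective_iff_injective_and_card]
  refine ⟨?_, by simp; omega⟩
  rintro (i | _ | i) (j | _ | j) h <;> simp [blockIndex, Fin.ext_iff] at h ⊢ <;> omega

include ht ht0 h2 hsq in
-- Of the diagonal basis, the vector of length `u' t` is put in the middle, and the `2n` unit
-- vectors are paired to hyperbolic planes.
theorem exists_standard_basis (n : ℕ) {V : Type u} [AddCommGroup V] [Module R V]
    (b : Basis (Fin (2 * n + 1)) R V) (B : V →ₗ[R] V →ₗ[R] R) (hB : ∀ v w, B v w = B w v)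
    (u : R) (hu : IsUnit u) (h : (gram B b).det = u * t) :
    ∃ (b' : Basis (Fin (2 * n + 1)) R V) (u' : R), IsUnit u' ∧ ∀ i j,
      B (b' i) (b' j) = standardEntry n (u' * t) i j := by
  obtain ⟨e, u', hu', he⟩ := exists_diagonal_basis ht ht0 h2 hsq _ b B hB u hu h
  let σ := Equiv.ofBijective _ (blockIndex_bijective n)
  -- The swap moves the exceptional vector from the last position to the middle one.
  let τ : Fin (2 * n + 1) ≃ Fin n ⊕ Unit ⊕ Fin n :=
    (Equiv.swap (Fin.last (2 * n)) (σ (.inr (.inl ())))).trans σ.symm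
  have hτ : τ (Fin.last (2 * n)) = .inr (.inl ()) := by simp [τ]
  let c := e.reindex τ
  have hc (i j) : B (c i) (c j) =
      if i = j then (if i = .inr (.inl ()) then u' * t else 1) else 0 := by
    simp only [c, Basis.reindex_apply, he, EmbeddingLike.apply_eq_iff_eq, Equiv.symm_apply_eq, hτ]
  -- With `ι² = -1` and `a = 1/2`, orthogonal unit vectors `c`, `c'` give the isotropic vectors `c +
  -- ι c'` and `a (c - ι c')`, whose product is `a (1 - ι²) = 1`.
  obtain ⟨ι, hι⟩ := hsq (-1) isUnit_one.neg
  obtain ⟨a, ha⟩ := h2.exists_right_inv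
  let f : Fin n ⊕ Unit ⊕ Fin n → V
    | .inl i => c (.inl i) + ι • c (.inr (.inr i))
    | .inr (.inl _) => c (.inr (.inl ()))
    | .inr (.inr i) => a • (c (.inl i) - ι • c (.inr (.inr i)))
  have hf : ⊤ ≤ Submodule.span R (Set.range f) := by
    have hmem (i) : f i ∈ Submodule.span R (Set.range f) := Submodule.subset_span ⟨i, rfl⟩
    rw [← c.span_eq, Submodule.span_le]
    rintro _ ⟨(i | _ | i), rfl⟩
    · have : c (.inl i) = a • f (.inl i) + f (.inr (.inr i)) := by
        simp only [f, ← smul_add]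
        rw [add_add_sub_cancel, ← two_smul R, smul_smul, mul_comm, ha, one_smul]
      rw [this]
      exact add_mem (Submodule.smul_mem _ _ (hmem (.inl i))) (hmem (.inr (.inr i)))
    · exact hmem (.inr (.inl ()))
    · have : c (.inr (.inr i)) = -ι • (a • f (.inl i) - f (.inr (.inr i))) := by
        simp only [f, ← smul_sub]
        rw [add_sub_sub_cancel, ← two_smul R, smul_smul, smul_smul, smul_smul]
        have : -ι * (a * 2 * ι) = 1 := by linear_combination (-a * 2) * (-hι) + ha
        rw [← mul_assoc] at this
        conv_lhs => rw [← one_smul R (c (.inr (.inr i))), ← this]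
        congr 1
        ring
      rw [this]
      exact Submodule.smul_mem _ _ (sub_mem (Submodule.smul_mem _ _ (hmem (.inl i)))
        (hmem (.inr (.inr i))))
  let g : Basis (Fin n ⊕ Unit ⊕ Fin n) R V :=
    basisOfTopLeSpanOfCardEqFinrank f hf (finrank_eq_card_basis c).symm
  have hg : ⇑g = f := coe_basisOfTopLeSpanOfCardEqFinrank _ _ _
  refine ⟨g.reindex σ, u', hu', fun i j ↦ ?_⟩
  obtain ⟨i, rfl⟩ := σ.surjective i
  obtain ⟨j, rfl⟩ := σ.surjective j
  rw [Basis.reindex_apply, Basis.reindex_apply, Equiv.symm_apply_apply, Equiv.symm_apply_apply, hg]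
  rcases i with (i | _ | i) <;> rcases j with (j | _ | j) <;>
    simp [f, hc, standardEntry, σ, blockIndex, Fin.ext_iff]
  all_goals clear_value c τ σ
  all_goals clear hc hg g hf f he e
  all_goals try have hi := i.isLt
  all_goals try have hj := j.isLt
  all_goals split_ifs <;> first
    | omega
    | ring1
    | linear_combination -hι
    | linear_combination ha + a * hι
    | linear_combination -a * a * hι

end LocalRing

/-! ### Local parameters -/

section Parameters
variable {x : X}

/-- `t` vanishes at `x`, and every function on an open subset of `U` that vanishes at `x` is
uniquely a multiple of `t`. -/
structure IsParameter {U : Opens X} (hx : x ∈ U) (t : Fn X U) : Prop where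
  value_eq_zero : valueFn x hx t = 0
  existsUnique {V : Opens X} (h : V ≤ U) (f : Fn X V) (hf : ∀ hx : x ∈ V, valueFn x hx f = 0) :
    ∃! g, resFn h t * g = f

variable (x) in
/-- The properties of a point of a Riemann surface that are used below. -/
structure IsCurvePoint : Prop where
  closed : IsClosed ({x} : Set X)
  exists_parameter : ∃ (U : Opens X) (hx : x ∈ U) (t : Fn X U), IsParameter hx t
  isUnit_two : IsUnit (2 : X.presheaf.stalk x)
  isSquare (a : X.presheaf.stalk x) (ha : IsUnit a) : IsSquare a

variable {U : Opens X} {hx : x ∈ U} {t : Fn X U} (ht : IsParameter hx t)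
include ht

theorem IsParameter.restrict {V : Opens X} (h : V ≤ U) (hxV : x ∈ V) :
    IsParameter hxV (resFn h t) where
  value_eq_zero := by rw [valueFn_resFn, ht.value_eq_zero]
  existsUnique h' f hf := by
    rw [resFn_resFn]
    exact ht.existsUnique (h'.trans h) f hf

/-- Multiples of `t` vanish at `x`, so the uniqueness of division applies to `t g` itself. -/
theorem IsParameter.mul_cancel {V : Opens X} (h : V ≤ U) {f g : Fn X V}
    (e : resFn h t * f = resFn h t * g) : f = g :=
  (ht.existsUnique h (resFn h t * g) fun hxV ↦ by
    rw [map_mul, valueFn_resFn, ht.value_eq_zero, zero_mul]).unique e rfl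

theorem IsParameter.exists_mul {V : Opens X} (h : V ≤ U) (f : Fn X V)
    (hf : ∀ hx : x ∈ V, valueFn x hx f = 0) : ∃ g, resFn h t * g = f :=
  (ht.existsUnique h f hf).exists

theorem IsParameter.isLocalParameter : IsLocalParameter hx t := by
  refine le_antisymm ?_ fun a ha ↦ ?_
  · rw [Ideal.span_singleton_le_iff_mem, ← IsLocalRing.residue_eq_zero_iff]
    exact ht.value_eq_zero
  · obtain ⟨V, hV, hVU, c, hc⟩ := exists_germFn_eq U hx fun _ : Unit ↦ a
    obtain ⟨g, hg⟩ := ht.exists_mul hVU (c ()) fun _ ↦ by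
      rw [valueFn, RingHom.comp_apply, hc, IsLocalRing.residue_eq_zero_iff]
      exact ha
    rw [Ideal.mem_span_singleton, ← hc (), ← hg, map_mul, germFn_res]
    exact Dvd.intro _ rfl

theorem IsParameter.isLeftRegular_germ : IsLeftRegular (germFn hx t) := by
  intro a b hab
  obtain ⟨V, hV, hVU, c, hc⟩ := exists_germFn_eq U hx ![a, b]
  obtain ⟨W, hW, hWV, e⟩ := exists_resFn_eq hV (fun _ : Unit ↦ resFn hVU t * c 0)
    (fun _ ↦ resFn hVU t * c 1) fun _ ↦ by
      rw [map_mul, map_mul, germFn_res, hc, hc]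
      exact hab
  have e' := e ()
  rw [map_mul, map_mul, resFn_resFn] at e'
  have := congrArg (germFn hW) (ht.mul_cancel _ e')
  rw [germFn_res, germFn_res, hc, hc] at this
  exact this

end Parameters

/-! ### Sheaves of homomorphisms and dual frames -/

section Hom
variable {E M : OMod X} {U : Opens X}

theorem homApply_ext {φ φ' : Sec (ihom E M) U}
    (h : ∀ (V : Opens X) (hV : V ≤ U) (s : Sec E V), homApply φ hV s = homApply φ' hV s) :
    φ = φ' := HomSec.ext h

theorem homApply_smul (f : Fn X U) (φ : Sec (ihom E M) U) {V : Opens X} (h : V ≤ U)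
    (s : Sec E V) : homApply (f • φ) h s = resFn h f • homApply φ h s := rfl

/-- Evaluation of local homomorphisms. -/
def homEval {V : Opens X} (h : V ≤ U) (s : Sec E V) : Sec (ihom E M) U →+ Sec M V where
  toFun φ := homApply φ h s
  map_zero' := rfl
  map_add' _ _ := rfl

theorem homApply_sum_smul {ι : Type*} [Fintype ι] (c : ι → Fn X U) (φ : ι → Sec (ihom E M) U)
    {V : Opens X} (h : V ≤ U) (s : Sec E V) :
    homApply (∑ i, c i • φ i) h s = ∑ i, resFn h (c i) • homApply (φ i) h s :=
  map_sum (homEval h s) (fun i ↦ c i • φ i) Finset.univ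

variable {r : ℕ} {e : Fin r → Sec E U}

theorem IsFrame.homApply_eq (he : IsFrame e) {φ φ' : Sec (ihom E M) U}
    (h : ∀ j, homApply φ le_rfl (e j) = homApply φ' le_rfl (e j)) : φ = φ' := by
  refine homApply_ext fun V hV s ↦ ?_
  rw [← he.sum_repr hV s, map_sum, map_sum]
  refine Finset.sum_congr rfl fun j _ ↦ ?_
  rw [map_smul, map_smul]
  exact congrArg _ ((homApply_res φ hV le_rfl _).trans
    ((congrArg _ (h j)).trans (homApply_res φ' hV le_rfl _).symm))

theorem IsFrame.exists_homApply_eq (he : IsFrame e) (m : Fin r → Sec M U) :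
    ∃ φ : Sec (ihom E M) U, ∀ j, homApply φ le_rfl (e j) = m j := by
  refine ⟨(HomSec.mk (fun {V} h ↦
    ((he.basis h).constr (Fn X V) fun j ↦ res M h (m j) : Sec E V →ₗ[Fn X V] Sec M V))
    (fun {W V} h h' s ↦ ?_) : HomSec E M U), fun j ↦ ?_⟩
  · rw [Basis.constr_apply_fintype, Basis.constr_apply_fintype, res_sum_smul]
    simp only [Basis.equivFun_apply, res_res]
    exact Finset.sum_congr rfl fun i _ ↦ congrArg (· • _) (he.repr_res h h' s i)
  · refine Eq.trans ?_ (((he.basis le_rfl).constr_basis (Fn X U)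
      (fun j ↦ res M le_rfl (m j)) j).trans (res_self M (m j)))
    rw [he.basis_apply, res_self]
    rfl

/-- The dual of a frame is a frame. -/
theorem IsFrame.isFrame_of_dual (he : IsFrame e) {m : Sec M U} (hm : IsFrame fun _ : Fin 1 ↦ m)
    {h : Fin r → Sec (ihom E M) U}
    (hh : ∀ i j, homApply (h i) le_rfl (e j) = if i = j then m else 0) : IsFrame h := by
  intro V hV
  have key (c : Fin r → Fn X V) (j : Fin r) :
      homApply (∑ i, c i • res (ihom E M) hV (h i)) le_rfl (res E hV (e j)) =
        c j • res M hV m := by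
    rw [homApply_sum_smul, Finset.sum_eq_single j]
    · rw [resFn_self]
      refine congrArg _ ((homApply_res (h j) hV le_rfl (e j)).trans ?_)
      rw [hh, if_pos rfl]
    · intro i _ hij
      have : homApply (res (ihom E M) hV (h i)) le_rfl (res E hV (e j)) = 0 :=
        (homApply_res (h i) hV le_rfl (e j)).trans (by rw [hh, if_neg hij, map_zero])
      rw [this, smul_zero]
    · simp
  constructor
  · intro c c' hcc
    funext j
    refine hm.smul_cancel hV ?_
    rw [← key, ← key]
    exact congrArg (fun φ ↦ homApply φ le_rfl (res E hV (e j))) hcc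
  · intro φ
    choose c hc using fun j ↦ hm.exists_smul hV (homApply φ le_rfl (res E hV (e j)))
    exact ⟨c, (he.restrict hV).homApply_eq fun j ↦ (key c j).trans (hc j)⟩

theorem IsFrame.exists_dual_frame (he : IsFrame e) {m : Sec M U}
    (hm : IsFrame fun _ : Fin 1 ↦ m) : ∃ h : Fin r → Sec (ihom E M) U, IsFrame h ∧
      ∀ i j, homApply (h i) le_rfl (e j) = if i = j then m else 0 := by
  choose h hh using fun i ↦ he.exists_homApply_eq fun j ↦ if i = j then m else 0
  exact ⟨h, he.isFrame_of_dual hm hh, hh⟩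

theorem isVectorBundle_ihom (hE : IsVectorBundle E r) (hM : IsLineBundle M) :
    IsVectorBundle (ihom E M) r := by
  intro p
  obtain ⟨U, hp, e, he⟩ := hE p
  obtain ⟨V, hpV, hV, m, hm⟩ := hM.exists_frame_le hp
  obtain ⟨h, hh, -⟩ := (he.restrict hV).exists_dual_frame hm
  exact ⟨V, hpV, h, hh⟩

theorem isLineBundle_structureMod : IsLineBundle (structureMod X) :=
  fun _ ↦ ⟨⊤, trivial, _, isFrame_structureMod ⊤⟩

theorem isVectorBundle_dual (hE : IsVectorBundle E r) : IsVectorBundle (dual E) r :=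
  isVectorBundle_ihom hE isLineBundle_structureMod

end Hom

/-! ### Gram matrices of forms on bundles -/

section Gram
variable {F M : OMod X} {ψ : BilinForm F M} {r : ℕ} {U : Opens X} {e : Fin r → Sec F U}
  {m : Sec M U} {A : Matrix (Fin r) (Fin r) (Fn X U)}

/-- `A` is the matrix of `ψ` in the frames `e` and `m`. -/
structure IsGram (ψ : BilinForm F M) (e : Fin r → Sec F U) (m : Sec M U)
    (A : Matrix (Fin r) (Fin r) (Fn X U)) : Prop where
  frame : IsFrame e
  line : IsFrame fun _ : Fin 1 ↦ m
  eq (i j : Fin r) : ψ.pair U (e i) (e j) = A i j • m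

theorem exists_isGram (ψ : BilinForm F M) (he : IsFrame e) (hm : IsFrame fun _ : Fin 1 ↦ m) :
    ∃ A, IsGram ψ e m A := by
  choose A hA using fun i j ↦ hm.exists_smul_self (ψ.pair U (e i) (e j))
  exact ⟨A, he, hm, fun i j ↦ (hA i j).symm⟩

theorem IsGram.restrict (h : IsGram ψ e m A) {V : Opens X} (hV : V ≤ U) :
    IsGram ψ (fun i ↦ res F hV (e i)) (res M hV m) (A.map (resFn hV)) where
  frame := h.frame.restrict hV
  line := h.line.restrict hV
  eq i j := by rw [ψ.pair_res, h.eq, (res M hV).map_smulₛₗ]; rfl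

theorem IsGram.fiber_eq (h : IsGram ψ e m A) {p : X} (hp : p ∈ U) (i j : Fin r) :
    ψ.fiber p (h.frame.fiberBasis hp i) (h.frame.fiberBasis hp j) =
      valueFn p hp (A i j) • value M hp m := by
  rw [h.frame.fiberBasis_apply, h.frame.fiberBasis_apply, ψ.fiber_value, h.eq, value_smul]

theorem IsGram.mem_annihilator_iff (h : IsGram ψ e m A) {p : X} (hp : p ∈ U) (v : Fiber F p) :
    v ∈ ψ.annihilator p ↔
      Matrix.vecMul ((h.frame.fiberBasis hp).repr v) (A.map (valueFn p hp)) = 0 := by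
  have key (j : Fin r) : ψ.fiber p v (h.frame.fiberBasis hp j) =
      Matrix.vecMul ((h.frame.fiberBasis hp).repr v) (A.map (valueFn p hp)) j •
        value M hp m := by
    conv_lhs => rw [← (h.frame.fiberBasis hp).sum_repr v]
    simp only [map_sum, map_smul, LinearMap.sum_apply, LinearMap.smul_apply, h.fiber_eq hp,
      smul_smul, Matrix.vecMul, dotProduct, Finset.sum_smul, Matrix.map_apply]
  rw [BilinForm.annihilator, LinearMap.mem_ker]
  constructor
  · intro hv
    funext j
    have := key j
    rw [hv, LinearMap.zero_apply, eq_comm, smul_eq_zero_iff_left (h.line.value_ne_zero hp)] at this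
    exact this
  · intro hv
    refine (h.frame.fiberBasis hp).ext fun j ↦ ?_
    rw [key, hv]
    simp

/-- In the basis of the fibre given by the frame, the annihilator is the left kernel of the matrix
`A(p)`. -/
theorem IsGram.nondegenerateAt_iff (h : IsGram ψ e m A) {p : X} (hp : p ∈ U) :
    ψ.NondegenerateAt p ↔ IsUnit (germFn hp A.det) := by
  rw [← valueFn_ne_zero_iff, RingHom.map_det, RingHom.mapMatrix_apply, ne_eq,
    ← Matrix.exists_vecMul_eq_zero_iff, BilinForm.NondegenerateAt, Submodule.eq_bot_iff]
  constructor
  · rintro H ⟨v, hv0, hv⟩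
    let w := (h.frame.fiberBasis hp).equivFun.symm v
    have hw : ⇑((h.frame.fiberBasis hp).repr w) = v := (h.frame.fiberBasis hp).equivFun.apply_symm_apply v
    have := H w ((h.mem_annihilator_iff hp w).2 (by rw [hw]; exact hv))
    exact hv0 (by rw [← hw, this]; simp)
  · intro H v hv
    by_contra hv0
    refine H ⟨_, fun h0 ↦ hv0 ?_, (h.mem_annihilator_iff hp v).1 hv⟩
    exact (h.frame.fiberBasis hp).equivFun.map_eq_zero_iff.1 h0

theorem IsGram.isUnit_det (h : IsGram ψ e m A) (hn : ∀ p ∈ U, ψ.NondegenerateAt p) :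
    IsUnit A.det :=
  X.toRingedSpace.isUnit_of_isUnit_germ U A.det fun p hp ↦
    (h.nondegenerateAt_iff hp).1 (hn p hp)

theorem IsGram.symm (h : IsGram ψ e m A) (hs : ψ.IsSymmetric) (i j : Fin r) : A i j = A j i :=
  h.line.smul_cancel_self (by rw [← h.eq, ← h.eq, hs])

end Gram

/-! ### Frames of elementary transforms -/

section ElementaryTransform
variable {E F : OMod X} {β : E ⟶ F} {x : X} {T : Submodule (κ x) (Fiber F x)} {r : ℕ}
  {U : Opens X} {f : Fin r → Sec F U}

/-- The coordinates of a section of `E` are those of its image divided by the `d i`; `dvd` makes the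
division possible and `cancel` makes it unique. -/
theorem isFrame_of_lift (inj : ∀ U, Function.Injective (app β U)) (hf : IsFrame f)
    {e : Fin r → Sec E U} {d : Fin r → Fn X U} (hd : ∀ i, app β U (e i) = d i • f i)
    (cancel : ∀ (V : Opens X) (h : V ≤ U) (i : Fin r) (a b : Fn X V),
      resFn h (d i) * a = resFn h (d i) * b → a = b)
    (dvd : ∀ (V : Opens X) (h : V ≤ U) (s : Sec E V) (i : Fin r),
      ∃ c, resFn h (d i) * c = (hf.basis h).repr (app β V s) i) : IsFrame e := by
  intro V hV
  have key (c : Fin r → Fn X V) : app β V (∑ i, c i • res E hV (e i)) =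
      ∑ i, (resFn hV (d i) * c i) • res F hV (f i) := by
    rw [map_sum]
    refine Finset.sum_congr rfl fun i _ ↦ ?_
    rw [map_smul, app_res, hd, (res F hV).map_smulₛₗ, smul_smul, mul_comm]
  constructor
  · intro c c' h
    funext i
    refine cancel V hV i _ _ ?_
    rw [← hf.repr_sum hV (fun i ↦ resFn hV (d i) * c i), ← key,
      ← hf.repr_sum hV (fun i ↦ resFn hV (d i) * c' i), ← key]
    exact congrArg (fun s ↦ (hf.basis hV).repr (app β V s) i) h
  · intro s
    choose c hc using dvd V hV s
    refine ⟨c, inj V ?_⟩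
    simp only [key, hc]
    exact hf.sum_repr hV _

/-- A frame of the elementary transform of a bundle, from a frame adapted to the subspace. -/
theorem IsElementaryTransform.exists_frame (h : IsElementaryTransform β x T) {hx : x ∈ U}
    {t : Fn X U} (ht : IsParameter hx t) (hf : IsFrame f) (I : Finset (Fin r))
    (hT : ∀ v, v ∈ T ↔ ∀ i ∉ I, (hf.fiberBasis hx).repr v i = 0) :
    ∃ e : Fin r → Sec E U, IsFrame e ∧ ∀ i, app β U (e i) = (if i ∈ I then 1 else t) • f i := by
  have hex (i : Fin r) : ∃ s, app β U s = (if i ∈ I then 1 else t) • f i := by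
    refine h.exists_lift _ fun hx ↦ (hT _).2 fun j hj ↦ ?_
    rw [value_smul, ← hf.fiberBasis_apply, map_smul, Finsupp.smul_apply, Basis.repr_self,
      Finsupp.single_apply]
    split_ifs with hi hij hij
    · exact (hj (hij ▸ hi)).elim
    · simp
    · simp [ht.value_eq_zero]
    · simp
  choose e he using hex
  refine ⟨e, isFrame_of_lift h.inj hf he ?_ ?_, he⟩
  · intro V hV i a b hab
    split_ifs at hab
    · simpa using hab
    · exact ht.mul_cancel hV hab
  · intro V hV s i
    split_ifs with hi
    · simp
    · refine ht.exists_mul hV _ fun hxV ↦ ?_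
      rw [← hf.fiberBasis_repr_value hV hxV]
      exact (hT _).1 (h.mem s hxV) i hi

theorem IsElementaryTransform.exists_frame_of_notMem (h : IsElementaryTransform β x T)
    (hx : x ∉ U) (hf : IsFrame f) :
    ∃ e : Fin r → Sec E U, IsFrame e ∧ ∀ i, app β U (e i) = f i := by
  choose e he using fun i ↦ h.exists_lift (f i) fun h ↦ (hx h).elim
  refine ⟨e, isFrame_of_lift h.inj hf (d := fun _ ↦ 1) (fun i ↦ by rw [he, one_smul]) ?_ ?_, he⟩
  · intro V hV i a b hab
    simpa using hab
  · intro V hV s i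
    simp

/-- A basis of a vector space of which a part is a basis of a given subspace. -/
theorem exists_adapted_basis {K V : Type*} [Field K] [AddCommGroup V] [Module K V]
    [Module.Finite K V] (hr : finrank K V = r) (T : Submodule K V) :
    ∃ (b : Basis (Fin r) K V) (I : Finset (Fin r)), I.card = finrank K T ∧
      ∀ v, v ∈ T ↔ ∀ i ∉ I, b.repr v i = 0 := by
  obtain ⟨T', hT'⟩ := T.exists_isCompl
  let b₀ := ((finBasis K T).prod (finBasis K T')).map (T.prodEquivOfIsCompl T' hT')
  let σ : Fin (finrank K T) ⊕ Fin (finrank K T') ≃ Fin r := Fintype.equivOfCardEq (by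
    rw [← finrank_eq_card_basis b₀, hr, Fintype.card_fin])
  refine ⟨b₀.reindex σ, Finset.univ.image fun i ↦ σ (.inl i), ?_, fun v ↦ ?_⟩
  · exact (Finset.card_image_of_injective _ (σ.injective.comp Sum.inl_injective)).trans
      ((Finset.card_univ).trans (Fintype.card_fin _))
  · have h1 : (∀ i ∉ Finset.univ.image (fun i ↦ σ (.inl i)), (b₀.reindex σ).repr v i = 0) ↔
        ∀ j, b₀.repr v (.inr j) = 0 := by
      constructor
      · intro h j
        simpa using h (σ (.inr j)) (by simp)
      · intro h i hi
        obtain ⟨(j | j), rfl⟩ := σ.surjective i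
        · simp at hi
        · simpa using h j
    rw [h1]
    have h2 : ∀ j, b₀.repr v (.inr j) =
        (finBasis K T').repr ((T.prodEquivOfIsCompl T' hT').symm v).2 j := by
      intro j
      simp [b₀]
    simp only [h2]
    rw [← Submodule.prodEquivOfIsCompl_symm_apply_snd_eq_zero T T' hT']
    constructor
    · intro h j
      rw [h, map_zero, Finsupp.zero_apply]
    · intro h
      exact (finBasis K T').repr.map_eq_zero_iff.1 (Finsupp.ext h)

theorem exists_open_notMem (hx : IsClosed ({x} : Set X)) {p : X} (hp : p ≠ x) {U : Opens X}
    (hU : p ∈ U) : ∃ (V : Opens X) (_ : p ∈ V), V ≤ U ∧ x ∉ V :=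
  ⟨U ⊓ ⟨{x}ᶜ, hx.isOpen_compl⟩, ⟨hU, hp⟩, inf_le_left, fun h ↦ h.2 rfl⟩

/-- Near `x`, an elementary transform of `F` has a frame that is a multiple of a frame of `F`. -/
theorem IsElementaryTransform.exists_frames (h : IsElementaryTransform β x T)
    (hF : IsVectorBundle F r) {U₀ : Opens X} {hx₀ : x ∈ U₀} {t : Fn X U₀}
    (ht : IsParameter hx₀ t) :
    ∃ (U : Opens X) (hxU : x ∈ U) (hU : U ≤ U₀) (f : Fin r → Sec F U) (e : Fin r → Sec E U)
      (I : Finset (Fin r)), IsFrame f ∧ IsFrame e ∧ I.card = finrank (κ x) T ∧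
      (∀ i, app β U (e i) = (if i ∈ I then 1 else resFn hU t) • f i) ∧
      ∀ i ∈ I, value F hxU (f i) ∈ T := by
  have := hF.finite_fiber x
  obtain ⟨b, I, hI, hT⟩ := exists_adapted_basis (hF.finrank_fiber x) T
  obtain ⟨U, hxU, hU, f, hf, hb⟩ := hF.exists_frame hx₀ b
  have hbe : hf.fiberBasis hxU = b := by
    ext i
    rw [hf.fiberBasis_apply, hb]
  obtain ⟨e, he, hef⟩ := h.exists_frame (ht.restrict hU hxU) hf I (by rwa [hbe])
  refine ⟨U, hxU, hU, f, e, I, hf, he, hI, hef, fun i hi ↦ (hT _).2 fun j hj ↦ ?_⟩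
  rw [hb, b.repr_self, Finsupp.single_eq_of_ne]
  rintro rfl
  exact hj hi

theorem IsElementaryTransform.isVectorBundle (h : IsElementaryTransform β x T)
    (hx : IsCurvePoint x) (hF : IsVectorBundle F r) : IsVectorBundle E r := by
  intro p
  by_cases hp : p = x
  · subst hp
    obtain ⟨U₀, hx₀, t, ht⟩ := hx.exists_parameter
    obtain ⟨U, hxU, -, -, e, -, -, he, -⟩ := h.exists_frames hF ht
    exact ⟨U, hxU, e, he⟩
  · obtain ⟨U, hpU, f, hf⟩ := hF p
    obtain ⟨V, hpV, hV, hxV⟩ := exists_open_notMem hx.closed hp hpU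
    obtain ⟨e, he, -⟩ := h.exists_frame_of_notMem hxV (hf.restrict hV)
    exact ⟨V, hpV, e, he⟩

end ElementaryTransform

/-! ### From the stalk to a neighbourhood: the standard form -/

section StandardForm

theorem map_standardEntry {R S : Type*} [CommRing R] [CommRing S] (f : R →+* S) (n : ℕ) (t : R)
    (i j : Fin (2 * n + 1)) : f (standardEntry n t i j) = standardEntry n (f t) i j := by
  unfold standardEntry
  split_ifs <;> simp

variable {F M : OMod X} {ψ : BilinForm F M} {x : X} {U : Opens X} {m : Sec M U} {n : ℕ}
  {e : Fin (2 * n + 1) → Sec F U} {A : Matrix (Fin (2 * n + 1)) (Fin (2 * n + 1)) (Fn X U)}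

theorem exists_germ_family {ι : Type*} [Finite ι] (hx : x ∈ U) (a : ι → Stalk F x) :
    ∃ (V : Opens X) (hV : x ∈ V) (_ : V ≤ U) (s : ι → Sec F V), ∀ i, germ F hV (s i) = a i := by
  choose W hW s hs using fun i ↦ exists_germ_eq F (a i)
  obtain ⟨V, hV, hVU, hVW⟩ := exists_le_forall_nhd U hx W hW
  exact ⟨V, hV, hVU, fun i ↦ res F (hVW i) (s i), fun i ↦ (germ_res _ _ _ _).trans (hs i)⟩

/-- A symmetric form whose discriminant vanishes to first order at `x` has the standard form. -/
theorem IsGram.exists_standard (h : IsGram ψ e m A) (hs : ψ.IsSymmetric) (hc : IsCurvePoint x)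
    {hx : x ∈ U} {t : Fn X U} (ht : IsParameter hx t) {u : Fn X U} (hu : IsUnit u)
    (hA : A.det = u * t) :
    ∃ (V : Opens X) (_ : x ∈ V) (hV : V ≤ U) (e' : Fin (2 * n + 1) → Sec F V) (w : Fn X V),
      IsUnit w ∧ IsGram ψ e' (res M hV m) (.of (standardEntry n (w * resFn hV t))) := by
  obtain ⟨b, hb⟩ := h.frame.exists_stalkBasis hx
  obtain ⟨c, hcm⟩ := h.line.exists_stalkBasis hx
  -- The coordinate with respect to the germ of `m` makes `ψ` a form with values in the local ring,
  -- to which the classification applies.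
  let B : Stalk F x →ₗ[X.presheaf.stalk x] Stalk F x →ₗ[X.presheaf.stalk x] X.presheaf.stalk x :=
    (ψ.stalk x).compr₂ (c.coord 0)
  have hB {V : Opens X} (hV : x ∈ V) (hVU : V ≤ U) (s s' : Sec F V) (a : Fn X V)
      (hss : ψ.pair V s s' = a • res M hVU m) : B (germ F hV s) (germ F hV s') = germFn hV a := by
    rw [LinearMap.compr₂_apply, ψ.stalk_germ, hss, germ_smul, germ_res, ← hcm 0, map_smul,
      Basis.coord_apply, Basis.repr_self, Finsupp.single_eq_same, smul_eq_mul, mul_one]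
  have hBs (v w) : B v w = B w v := by
    obtain ⟨V, hV, -, s, hs'⟩ := exists_germ_family hx ![v, w]
    have h0 := hs' 0
    have h1 := hs' 1
    simp only [Matrix.cons_val_zero, Matrix.cons_val_one] at h0 h1
    rw [← h0, ← h1, LinearMap.compr₂_apply, LinearMap.compr₂_apply, ψ.stalk_germ, ψ.stalk_germ, hs]
  have hdet : (gram B b).det = germFn hx u * germFn hx t := by
    rw [← map_mul, ← hA, RingHom.map_det]
    congr 1
    ext i j
    rw [gram_apply, hb, hb, hB hx le_rfl (e i) (e j) (A i j) (by rw [h.eq, res_self])]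
    rfl
  obtain ⟨b', u', hu', hb'⟩ := exists_standard_basis ht.isLocalParameter ht.isLeftRegular_germ
    hc.isUnit_two hc.isSquare n b B hBs _ (hu.map (germFn hx)) hdet
  obtain ⟨V₁, hx₁, hV₁, s, hs'⟩ := exists_germ_family hx b'
  obtain ⟨V₂, hx₂, hV₂, hs₂⟩ := (h.frame.restrict hV₁).exists_frame_of_values hx₁ s
    (b'.baseChange (κ x)) fun i ↦ by rw [Basis.baseChange_apply, ← hs']; rfl
  obtain ⟨V₃, hx₃, hV₃, w, hw⟩ := exists_germFn_eq V₂ hx₂ fun _ : Unit ↦ u'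
  obtain ⟨V₄, hx₄, hV₄, hwu⟩ := exists_isUnit_resFn hx₃ (f := w ()) (by rwa [hw])
  have h₄ : V₄ ≤ V₁ := hV₄.trans (hV₃.trans hV₂)
  have he' := hs₂.restrict (hV₄.trans hV₃)
  simp only [res_res] at he'
  obtain ⟨A', hA'⟩ := exists_isGram ψ he' (h.line.restrict (h₄.trans hV₁))
  -- The spread-out basis has the standard matrix only on germs; these are finitely many equalities,
  -- so they hold on a common neighbourhood.
  have hg (k : Fin (2 * n + 1) × Fin (2 * n + 1)) : germFn hx₄ (A' k.1 k.2) =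
      germFn hx₄ (standardEntry n (resFn hV₄ (w ()) * resFn (h₄.trans hV₁) t) k.1 k.2) := by
    rw [← hB hx₄ (h₄.trans hV₁) _ _ _ (hA'.eq k.1 k.2), map_standardEntry, map_mul, germFn_res,
      germFn_res, hw, germ_res, germ_res, hs', hs', hb']
  obtain ⟨V, hxV, hV, hVe⟩ := exists_resFn_eq hx₄ _ _ hg
  have hfin := hA'.restrict hV
  simp only [res_res] at hfin
  refine ⟨V, hxV, hV.trans (h₄.trans hV₁), fun i ↦ res F (hV.trans h₄) (s i),
    resFn hV (resFn hV₄ (w ())), hwu.map _, ?_⟩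
  convert hfin using 1
  ext i j
  rw [Matrix.map_apply, hVe (i, j), map_standardEntry, map_mul, resFn_resFn, resFn_resFn]
  rfl

theorem IsGram.hasStandardFormAt {hx : x ∈ U} {t : Fn X U} (ht : IsParameter hx t)
    {w : Fn X U} (hw : IsUnit w) (h : IsGram ψ e m (.of (standardEntry n (w * t)))) :
    HasStandardFormAt ψ x n := by
  refine ⟨U, hx, e, m, w * t, h.frame, h.line, ?_, h.eq⟩
  rw [IsLocalParameter, map_mul, Ideal.span_singleton_mul_left_unit (hw.map _)]
  exact ht.isLocalParameter

end StandardForm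

/-! ### Counting powers of the parameter in determinants -/

section Determinants

/-- These are the determinants of `D A D = t G` with `D = diag(d)`, the count behind both directions
of the theorem. -/
theorem det_of_smul_eq {R : Type*} [CommRing R] {ι : Type*} [Fintype ι] [DecidableEq ι]
    {A G : Matrix ι ι R} {d : ι → R} {t : R} (h : ∀ i j, d i * d j * A i j = t * G i j) :
    (∏ i, d i) ^ 2 * A.det = t ^ Fintype.card ι * G.det := by
  have : Matrix.diagonal d * A * Matrix.diagonal d = t • G := by
    ext i j
    rw [Matrix.mul_diagonal, Matrix.diagonal_mul, Matrix.smul_apply, smul_eq_mul, ← h]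
    ring
  rw [← Matrix.det_smul, ← this, Matrix.det_mul, Matrix.det_mul, Matrix.det_diagonal]
  ring

theorem prod_ite_mem_one {R : Type*} [CommRing R] {r k : ℕ} {I : Finset (Fin r)}
    (h : I.card + k = r) (t : R) : ∏ i, (if i ∈ I then 1 else t) = t ^ k := by
  rw [Finset.prod_ite, Finset.prod_const_one, one_mul, Finset.prod_const]
  congr 1
  have := Finset.card_compl I
  rw [Fintype.card_fin] at this
  rw [← Finset.compl_filter, Finset.filter_univ_mem, this]
  omega

theorem IsParameter.pow_mul_cancel {x : X} {U : Opens X} {hx : x ∈ U} {t : Fn X U}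
    (ht : IsParameter hx t) (k : ℕ) {f g : Fn X U} (e : t ^ k * f = t ^ k * g) : f = g := by
  induction k with
  | zero => simpa using e
  | succ k ih =>
    refine ih (ht.mul_cancel le_rfl ?_)
    rw [resFn_self]
    linear_combination e

theorem IsGram.exists_det {F M : OMod X} {ψ : BilinForm F M} {r : ℕ} {U : Opens X}
    {m : Sec M U} {e e' : Fin r → Sec F U} {A A' : Matrix (Fin r) (Fin r) (Fn X U)}
    (h : IsGram ψ e m A) (h' : IsGram ψ e' m A') : ∃ u, IsUnit u ∧ A'.det = u * A.det := by
  obtain ⟨c, hc⟩ : ∃ c : Sec M U →ₗ[Fn X U] Fn X U, c m = 1 := by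
    refine ⟨(h.line.basis le_rfl).coord 0, ?_⟩
    have := congrArg ((h.line.basis le_rfl).coord 0)
      ((h.line.basis_apply le_rfl 0).trans (res_self M m))
    rwa [Basis.coord_apply, Basis.repr_self, Finsupp.single_eq_same, eq_comm] at this
  let B : Sec F U →ₗ[Fn X U] Sec F U →ₗ[Fn X U] Fn X U := (ψ.pair U).compr₂ c
  have key {e : Fin r → Sec F U} {A : Matrix (Fin r) (Fin r) (Fn X U)} (h : IsGram ψ e m A) :
      gram B (h.frame.basis le_rfl) = A := by
    ext i j
    rw [gram_apply, h.frame.basis_apply, h.frame.basis_apply, res_self, res_self,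
      LinearMap.compr₂_apply, h.eq, map_smul, hc, smul_eq_mul, mul_one]
  have := exists_det_gram B (h.frame.basis le_rfl) (h'.frame.basis le_rfl)
  rwa [key h, key h'] at this

end Determinants

/-! ### Local structure of simply degenerate forms -/

section SimplyDegenerate
variable {F M : OMod X} {ψ : BilinForm F M} {x : X} {r : ℕ}

/-- The Gram matrix is the matrix of the adjoint map in the frame dual to `e`, and `Q` is the
transition from that dual frame to `f`. -/
theorem exists_isGram_of_adjoint {U : Opens X} {e : Fin r → Sec F U} (he : IsFrame e)
    {m : Sec M U} (hm : IsFrame fun _ : Fin 1 ↦ m) {f : Fin r → Sec (ihom F M) U} (hf : IsFrame f)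
    {d : Fin r → Fn X U} (hd : ∀ i, app ψ.adjoint U (e i) = d i • f i) :
    ∃ Q : Matrix (Fin r) (Fin r) (Fn X U), IsUnit Q.det ∧
      IsGram ψ e m (Matrix.diagonal d * Q) := by
  obtain ⟨h, hh, hhe⟩ := he.exists_dual_frame hm
  obtain ⟨Q, hQ, hQf⟩ := hh.exists_matrix hf
  refine ⟨Q, hQ, he, hm, fun i j ↦ ?_⟩
  have h1 : homApply (app ψ.adjoint U (e i)) le_rfl (e j) = ψ.pair U (e i) (e j) := by
    rw [ψ.homApply_adjoint, res_self]
  rw [← h1, hd, homApply_smul, hQf, homApply_sum_smul, Finset.sum_eq_single j, hhe, if_pos rfl,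
    smul_smul, Matrix.diagonal_mul, resFn_self, resFn_self]
  · intro k _ hkj
    rw [hhe, if_neg hkj, smul_zero]
  · simp

/-- The kernel of a morphism to `ℂ_x` is an elementary transform along a hyperplane. -/
theorem IsSimplyDegenerate.exists_functional (h : IsSimplyDegenerate ψ x r) :
    ∃ g : Fiber (ihom F M) x →ₗ[κ x] κ x, g ≠ 0 ∧
      IsElementaryTransform ψ.adjoint x (LinearMap.ker g) := by
  obtain ⟨q, w, hS⟩ := h.exact
  obtain ⟨U, hx, f, hf⟩ := isVectorBundle_ihom h.bundle h.line x
  let qx {V : Opens X} (hx : x ∈ V) (s : Sec (ihom F M) V) : κ x :=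
    (show SkySec x (κ x) V from app q V s) ⟨hx⟩
  have qx_res {V W : Opens X} (hWV : W ≤ V) (hx : x ∈ W) (s : Sec (ihom F M) V) :
      qx hx (res _ hWV s) = qx (hWV hx) s :=
    congrFun (show (show SkySec x (κ x) W from app q W (res _ hWV s)) =
      (show SkySec x (κ x) W from res (skyscraper x (κ x)) hWV (app q V s)) from app_res q hWV s) _
  -- Functions act on the skyscraper through their value at `x`, so the linear map `q` sees only the
  -- value of a section there and is determined by a frame.
  let g := (hf.fiberBasis hx).constr (κ x) fun i ↦ qx hx (f i)
  have hg {V : Opens X} (hxV : x ∈ V) (s : Sec (ihom F M) V) : qx hxV s = g (value _ hxV s) := by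
    have hxW : x ∈ V ⊓ U := ⟨hxV, hx⟩
    rw [← qx_res inf_le_left hxW, ← value_res inf_le_left hxW,
      ← hf.sum_repr inf_le_right (res _ (inf_le_left : V ⊓ U ≤ V) s), value_sum_smul, map_sum]
    have : qx hxW (∑ i, (hf.basis inf_le_right).repr (res _ (inf_le_left : V ⊓ U ≤ V) s) i •
        res _ inf_le_right (f i)) = ∑ i, valueFn x hxW ((hf.basis inf_le_right).repr
          (res _ (inf_le_left : V ⊓ U ≤ V) s) i) • qx hxW (res _ inf_le_right (f i)) := by
      change (show SkySec x (κ x) _ from app q _ _) _ = _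
      rw [map_sum]
      refine (Finset.sum_apply (M := fun _ : PLift (x ∈ V ⊓ U) ↦ κ x) _ _ _).trans
        (Finset.sum_congr rfl fun i _ ↦ ?_)
      rw [map_smul]
      rfl
    rw [this]
    refine Finset.sum_congr rfl fun i _ ↦ ?_
    rw [map_smul, qx_res, value_res, ← hf.fiberBasis_apply, Basis.constr_basis]
  have hz {V : Opens X} (s : Sec (ihom F M) V) :
      app q V s = 0 ↔ ∀ hxV : x ∈ V, value _ hxV s ∈ LinearMap.ker g := by
    simp only [LinearMap.mem_ker, ← hg]
    exact ⟨fun h hxV ↦ congrFun (show (show SkySec x (κ x) V from app q V s) = 0 from h) ⟨hxV⟩,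
      fun h ↦ show (show SkySec x (κ x) V from app q V s) = 0 from funext fun hxV ↦ h hxV.down⟩
  refine ⟨g, ?_, shortExact_injective hS, fun {V} s hxV ↦ (hz _).1 ?_ hxV,
    fun {V} s hs ↦ shortExact_exists hS ((hz s).2 hs)⟩
  · intro h0
    obtain ⟨V, s, hs⟩ := shortExact_exists_ne_zero hS
    exact hs ((hz s).2 fun _ ↦ by rw [h0]; simp)
  · rw [← app_comp, w, app_zero]

theorem finrank_ker_of_ne_zero {K V : Type*} [Field K] [AddCommGroup V] [Module K V]
    [Module.Finite K V] {g : V →ₗ[K] K} (hg : g ≠ 0) :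
    finrank K (LinearMap.ker g) + 1 = finrank K V := by
  rw [← LinearMap.finrank_range_add_finrank_ker g, LinearMap.range_eq_top.2
    (LinearMap.surjective hg), finrank_top, finrank_self, add_comm]

/-- Near `x`, the matrix of a simply degenerate form is, up to an invertible matrix, diagonal with
one entry a local parameter and the others equal to one. -/
theorem IsSimplyDegenerate.exists_isGram (h : IsSimplyDegenerate ψ x r) {U₀ : Opens X}
    {hx₀ : x ∈ U₀} {t : Fn X U₀} (ht : IsParameter hx₀ t) :
    ∃ (U : Opens X) (_ : x ∈ U) (hU : U ≤ U₀) (e : Fin r → Sec F U) (m : Sec M U)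
      (I : Finset (Fin r)) (Q : Matrix (Fin r) (Fin r) (Fn X U)), I.card + 1 = r ∧ IsUnit Q.det ∧
      IsGram ψ e m (Matrix.diagonal (fun i ↦ if i ∈ I then 1 else resFn hU t) * Q) := by
  obtain ⟨g, hg0, hg⟩ := h.exists_functional
  have hb := isVectorBundle_ihom h.bundle h.line
  obtain ⟨U, hxU, hU, f, e, I, hf, he, hI, hd, -⟩ := hg.exists_frames hb ht
  obtain ⟨V, hxV, hV, m, hm⟩ := h.line.exists_frame_le hxU
  have := hb.finite_fiber x
  obtain ⟨Q, hQ, hA⟩ := exists_isGram_of_adjoint (ψ := ψ)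
    (d := fun i ↦ if i ∈ I then 1 else resFn (hV.trans hU) t) (he.restrict hV) hm
    (hf.restrict hV) (fun i ↦ by
      rw [app_res, hd, (res _ _).map_smulₛₗ]
      split_ifs
      · rw [map_one]
      · rw [resFn_resFn])
  exact ⟨V, hxV, hV.trans hU, _, m, I, Q,
    by rw [hI, finrank_ker_of_ne_zero hg0, hb.finrank_fiber], hQ, hA⟩

theorem IsSimplyDegenerate.exists_isGram_det (h : IsSimplyDegenerate ψ x r) {U₀ : Opens X}
    {hx₀ : x ∈ U₀} {t : Fn X U₀} (ht : IsParameter hx₀ t) :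
    ∃ (U : Opens X) (_ : x ∈ U) (hU : U ≤ U₀) (e : Fin r → Sec F U) (m : Sec M U)
      (A : Matrix (Fin r) (Fin r) (Fn X U)) (u : Fn X U), IsUnit u ∧ IsGram ψ e m A ∧
      A.det = u * resFn hU t := by
  obtain ⟨U, hxU, hU, e, m, I, Q, hI, hQ, hA⟩ := h.exists_isGram ht
  refine ⟨U, hxU, hU, e, m, _, _, hQ, hA, ?_⟩
  rw [Matrix.det_mul, Matrix.det_diagonal, prod_ite_mem_one hI, pow_one, mul_comm]

/-- At `x` the matrix is `diag(1, …, 0, …, 1) Q(x)` with `Q(x)` invertible, so its left kernel is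
spanned by the one frame vector that carries the entry `t`. -/
theorem IsSimplyDegenerate.finrank_annihilator (h : IsSimplyDegenerate ψ x r)
    (hc : IsCurvePoint x) : finrank (κ x) (ψ.annihilator x) = 1 := by
  obtain ⟨U₀, hx₀, t, ht⟩ := hc.exists_parameter
  obtain ⟨U, hxU, hU, e, m, I, Q, hI, hQ, hA⟩ := h.exists_isGram ht
  obtain ⟨i₀, hi₀⟩ : ∃ i₀, Iᶜ = {i₀} := by
    rw [← Finset.card_eq_one, Finset.card_compl, Fintype.card_fin]
    omega
  have hi (i : Fin r) : i ∉ I ↔ i = i₀ := by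
    rw [← Finset.mem_compl, hi₀, Finset.mem_singleton]
  let b := hA.frame.fiberBasis hxU
  have hQ' : IsUnit (Q.map (valueFn x hxU)) := by
    rw [Matrix.isUnit_iff_isUnit_det, ← RingHom.mapMatrix_apply, ← RingHom.map_det]
    exact hQ.map _
  have key (v : Fiber F x) : v ∈ ψ.annihilator x ↔ ∀ i ∈ I, b.repr v i = 0 := by
    rw [hA.mem_annihilator_iff hxU, ← RingHom.mapMatrix_apply, map_mul, RingHom.mapMatrix_apply,
      RingHom.mapMatrix_apply, ← Matrix.vecMul_vecMul,
      ← Matrix.zero_vecMul (Q.map (valueFn x hxU)),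
      (Matrix.vecMul_injective_of_isUnit hQ').eq_iff, funext_iff]
    refine forall_congr' fun i ↦ ?_
    rw [Matrix.diagonal_map (map_zero _), Matrix.vecMul_diagonal]
    by_cases hiI : i ∈ I
    · simp [hiI, b]
    · simp [hiI, valueFn_resFn, ht.value_eq_zero]
  have hspan : ψ.annihilator x = Submodule.span (κ x) {b i₀} := by
    refine le_antisymm (fun v hv ↦ ?_) ?_
    · rw [← b.sum_repr v, Finset.sum_eq_single i₀]
      · exact Submodule.smul_mem _ _ (Submodule.mem_span_singleton_self _)
      · intro i _ hii
        rw [(key v).1 hv i (not_not.1 fun hn ↦ hii ((hi i).1 hn)), zero_smul]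
      · simp
    · rw [Submodule.span_singleton_le_iff_mem, key]
      intro i hiI
      rw [b.repr_self, Finsupp.single_eq_of_ne]
      rintro rfl
      exact (hi _).2 rfl hiI
  rw [hspan, finrank_span_singleton (b.ne_zero i₀)]

/-- On an open set avoiding `x` the hyperplane condition is empty, so the adjoint map carries a
frame to a frame. -/
theorem IsSimplyDegenerate.exists_isGram_of_ne (h : IsSimplyDegenerate ψ x r)
    (hx : IsClosed ({x} : Set X)) {p : X} (hp : p ≠ x) :
    ∃ (U : Opens X) (_ : p ∈ U) (_ : x ∉ U) (e : Fin r → Sec F U) (m : Sec M U)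
      (A : Matrix (Fin r) (Fin r) (Fn X U)), IsUnit A.det ∧ IsGram ψ e m A := by
  obtain ⟨g, -, hg⟩ := h.exists_functional
  obtain ⟨U, hpU, f, hf⟩ := isVectorBundle_ihom h.bundle h.line p
  obtain ⟨V, hpV, hV, m, hm⟩ := h.line.exists_frame_le hpU
  obtain ⟨W, hpW, hW, hxW⟩ := exists_open_notMem hx hp hpV
  obtain ⟨e, he, hef⟩ := hg.exists_frame_of_notMem hxW (hf.restrict (hW.trans hV))
  obtain ⟨Q, hQ, hA⟩ := exists_isGram_of_adjoint (ψ := ψ) (d := fun _ ↦ 1) he (hm.restrict hW)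
    (hf.restrict (hW.trans hV)) (fun i ↦ by rw [hef, one_smul])
  exact ⟨W, hpW, hxW, e, _, _, by simpa using hQ, hA⟩

end SimplyDegenerate

/-! ### Restricting a form to a subsheaf of its values -/

section Descent
variable {E F M N : OMod X} {ψ : BilinForm F M} {β : E ⟶ F} {i : N ⟶ M}

theorem FormsCompatible.ext {φ φ' : BilinForm E N} (hi : ∀ U, Function.Injective (app i U))
    (h : FormsCompatible φ ψ β i) (h' : FormsCompatible φ' ψ β i) : φ = φ' := by
  have : φ.pair = φ'.pair := funext fun U ↦ LinearMap.ext₂ fun s t ↦ hi U (by rw [h, h'])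
  cases φ
  cases φ'
  cases this
  rfl

/-- As `i` is injective, values may be chosen one by one; bilinearity and compatibility with
restriction are inherited from `ψ`. -/
theorem exists_formsCompatible (hi : ∀ U, Function.Injective (app i U))
    (h : ∀ (U : Opens X) (s t : Sec E U), ∃ z, app i U z = ψ.pair U (app β U s) (app β U t)) :
    ∃ φ : BilinForm E N, FormsCompatible φ ψ β i := by
  choose φ hφ using h
  exact ⟨{ pair U := LinearMap.mk₂ _ (φ U)
              (fun s s' t ↦ hi U (by simp only [map_add, hφ, LinearMap.add_apply]))
              (fun c s t ↦ hi U (by simp only [map_smul, hφ, LinearMap.smul_apply]))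
              (fun s t t' ↦ hi U (by simp only [map_add, hφ]))
              (fun c s t ↦ hi U (by simp only [map_smul, hφ]))
           pair_res {V U} h s t := hi V (by
              rw [LinearMap.mk₂_apply, LinearMap.mk₂_apply, hφ, app_res, app_res, ψ.pair_res,
                app_res, hφ]) }, hφ⟩

end Descent

/-! ### From simply degenerate forms to orthogonal bundles -/

section HeckeTransform
variable {F M : OMod X} {ψ : BilinForm F M} {x : X} {n : ℕ}
  {S : Submodule (κ x) (Fiber F x ⧸ ψ.annihilator x)}

theorem finrank_comap_mkQ {K V : Type*} [Field K] [AddCommGroup V] [Module K V]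
    [Module.Finite K V] (l : Submodule K V) (S : Submodule K (V ⧸ l)) :
    finrank K (S.comap l.mkQ) = finrank K S + finrank K l := by
  have hl : l ≤ S.comap l.mkQ := fun v hv ↦ by
    rw [Submodule.mem_comap, Submodule.mkQ_apply, (Submodule.Quotient.mk_eq_zero l).2 hv]
    exact S.zero_mem
  rw [← LinearMap.finrank_range_add_finrank_ker (l.mkQ.domRestrict (S.comap l.mkQ)),
    LinearMap.range_domRestrict, Submodule.map_comap_eq_of_surjective l.mkQ_surjective,
    LinearMap.ker_domRestrict, Submodule.ker_mkQ]
  congr 1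
  exact (Submodule.comapSubtypeEquivOfLe hl).finrank_eq

/-- A simply degenerate form induces an orthogonal structure on the transform of its bundle along
a Lagrangian subspace of the fibre at `x` modulo the annihilator. -/
theorem exists_orthogonal_heckeTransform (hc : IsCurvePoint x)
    (h : IsSimplyDegenerate ψ x (2 * n + 1)) (hn : finrank (κ x) S = n)
    (hS : IsIsotropicModAnnihilator ψ x S) :
    ∃ φ : BilinForm (heckeTransform ψ x S) (twistDown M x),
      FormsCompatible φ ψ (heckeTransformι ψ x S) (twistDownι M x) ∧
      (∀ φ₁ : BilinForm (heckeTransform ψ x S) (twistDown M x),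
        FormsCompatible φ₁ ψ (heckeTransformι ψ x S) (twistDownι M x) → φ₁ = φ) ∧
      IsOrthogonalBundle φ (2 * n + 1) := by
  have hE := isElementaryTransform_heckeTransform ψ x S
  have hM := isElementaryTransform_twistDown M x
  -- Values at `x` of sections of `E` lie in the preimage of `S`, which is isotropic, so `ψ`
  -- vanishes at `x` on them.
  obtain ⟨φ, hφ⟩ := exists_formsCompatible (ψ := ψ) (β := heckeTransformι ψ x S)
    (i := twistDownι M x) hM.inj fun U s t ↦ hM.exists_lift _ fun hx ↦ by
      rw [Submodule.mem_bot, ← ψ.fiber_value]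
      exact hS _ _ (hE.mem s hx) (hE.mem t hx)
  refine ⟨φ, hφ, fun φ₁ h₁ ↦ h₁.ext hM.inj hφ, hE.isVectorBundle hc h.bundle,
    hM.isVectorBundle hc h.line, fun U s t ↦ hM.inj U (by rw [hφ, hφ, h.symm]), fun p ↦ ?_⟩
  by_cases hp : p = x
  · subst hp
    have := h.bundle.finite_fiber p
    obtain ⟨U₀, hx₀, t, ht⟩ := hc.exists_parameter
    obtain ⟨U₁, hx₁, hU₁, e₁, m, A₁, u, hu, hA₁, hdet⟩ := h.exists_isGram_det ht
    obtain ⟨U, hxU, hU, f, e, I, hf, he, hI, hef, -⟩ :=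
      hE.exists_frames h.bundle (ht.restrict hU₁ hx₁)
    -- The preimage of `S` has dimension `n + 1`, the annihilator contributing one.
    rw [finrank_comap_mkQ, hn, h.finrank_annihilator hc] at hI
    have ht' := (ht.restrict hU₁ hx₁).restrict hU hxU
    -- `M(-x)` is the transform of `M` along the zero subspace: the adapted index set is empty and
    -- the generator maps to `t m`.
    obtain ⟨m', hm', hmm⟩ := hM.exists_frame ht' (hA₁.line.restrict hU) ∅ (fun v ↦ by
      rw [Submodule.mem_bot]
      simp only [Finset.notMem_empty, not_false_eq_true, forall_const]
      exact ⟨fun h ↦ by simp [h], fun h ↦ ((hA₁.line.restrict hU).fiberBasis hxU).ext_elem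
        (by simpa using h)⟩)
    obtain ⟨A, hA⟩ := exists_isGram ψ hf (hA₁.line.restrict hU)
    obtain ⟨v, hv, hAdet⟩ := (hA₁.restrict hU).exists_det hA
    rw [← RingHom.mapMatrix_apply, ← RingHom.map_det, hdet, map_mul] at hAdet
    have hm'' : IsFrame fun _ : Fin 1 ↦ m' 0 := by
      convert hm' using 2 with i
      rw [Subsingleton.elim i 0]
    obtain ⟨G, hG⟩ := exists_isGram φ he hm''
    rw [hG.nondegenerateAt_iff hxU]
    refine IsUnit.map _ ?_
    have key (i j) : (if i ∈ I then 1 else resFn hU (resFn hU₁ t)) *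
        (if j ∈ I then 1 else resFn hU (resFn hU₁ t)) * A i j =
          resFn hU (resFn hU₁ t) * G i j := by
      refine hA.line.smul_cancel_self ?_
      have := hφ U (e i) (e j)
      rw [hef, hef, hG.eq, map_smul, hmm, if_neg (Finset.notMem_empty _)] at this
      simp only [map_smul, LinearMap.smul_apply, hA.eq, smul_smul] at this
      rw [mul_comm (resFn hU (resFn hU₁ t)), this]
      congr 1
      ring
    have hd := det_of_smul_eq key
    -- The remaining `n` frame vectors carry a factor `t`, so `t^(2n) · (v u t) = t^(2n+1) det G`.
    rw [prod_ite_mem_one (k := n) (by omega), hAdet, Fintype.card_fin] at hd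
    have : v * resFn hU u = G.det := ht'.pow_mul_cancel (2 * n + 1) (by
      rw [← hd]
      ring)
    rw [← this]
    exact hv.mul (hu.map _)
  · obtain ⟨U, hpU, hxU, f, m, A, hu, hA⟩ := h.exists_isGram_of_ne hc.closed hp
    obtain ⟨e, he, hef⟩ := hE.exists_frame_of_notMem hxU hA.frame
    obtain ⟨m', hm', hmm⟩ := hM.exists_frame_of_notMem hxU hA.line
    have hm'' : IsFrame fun _ : Fin 1 ↦ m' 0 := by
      convert hm' using 2 with i
      rw [Subsingleton.elim i 0]
    have hG : IsGram φ e (m' 0) A := ⟨he, hm'', fun i j ↦ hM.inj U (by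
      rw [hφ, hef, hef, hA.eq, map_smul, hmm])⟩
    rw [hG.nondegenerateAt_iff hpU]
    exact hu.map _

end HeckeTransform

/-! ### Local isomorphisms and the adjoint of a nondegenerate form -/

section Bijective
variable {E F : OMod X} {f : E ⟶ F}

theorem injective_app_of_local
    (h : ∀ p : X, ∃ (U : Opens X) (_ : p ∈ U), ∀ V ≤ U, Function.Injective (app f V))
    (U : Opens X) : Function.Injective (app f U) := by
  intro s t hst
  refine sec_ext E fun p hp ↦ ?_
  obtain ⟨V, hpV, hV⟩ := h p
  refine ⟨U ⊓ V, ⟨hp, hpV⟩, inf_le_left, hV _ inf_le_right ?_⟩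
  rw [app_res, app_res, hst]

theorem exists_app_eq_of_local (inj : ∀ U, Function.Injective (app f U)) {U : Opens X}
    {t : Sec F U} (h : ∀ p ∈ U, ∃ (V : Opens X) (_ : p ∈ V) (hV : V ≤ U) (s : Sec E V),
      app f V s = res F hV t) : ∃ s, app f U s = t := by
  obtain ⟨s, hs⟩ := exists_sec_of_local E U (fun V hV s ↦ app f V s = res F hV t)
    (fun h hV s e ↦ by rw [app_res, e, res_res]) (fun V hV s s' e e' ↦ inj V (e.trans e'.symm)) h
  refine ⟨s, sec_ext F fun p hp ↦ ?_⟩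
  obtain ⟨V, hpV, hV, e⟩ := hs p hp
  exact ⟨V, hpV, hV, by rw [← app_res, e]⟩

theorem bijective_app_of_frame {r : ℕ} {U : Opens X} {e : Fin r → Sec E U} (he : IsFrame e)
    (hf : IsFrame fun i ↦ app f U (e i)) {V : Opens X} (hV : V ≤ U) :
    Function.Bijective (app f V) := by
  rw [← Function.Bijective.of_comp_iff _ (he V hV)]
  convert hf V hV using 2 with c
  rw [Function.comp_apply, map_sum]
  exact Finset.sum_congr rfl fun i _ ↦ by rw [map_smul, app_res]

end Bijective

section Adjoint
variable {E L : OMod X} {φ : BilinForm E L} {r : ℕ}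

theorem IsGram.app_adjoint {U : Opens X} {e : Fin r → Sec E U} {m : Sec L U}
    {A : Matrix (Fin r) (Fin r) (Fn X U)} (h : IsGram φ e m A) {a : Fin r → Sec (ihom E L) U}
    (ha : ∀ i j, homApply (a i) le_rfl (e j) = if i = j then m else 0) (i : Fin r) :
    app φ.adjoint U (e i) = ∑ j, A i j • a j := by
  refine h.frame.homApply_eq fun j ↦ ?_
  rw [φ.homApply_adjoint, res_self, h.eq, homApply_sum_smul, Finset.sum_eq_single j, ha,
    if_pos rfl, resFn_self]
  · intro k _ hkj
    rw [ha, if_neg hkj, smul_zero]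
  · simp

theorem IsGram.bijective_adjoint {U : Opens X} {e : Fin r → Sec E U} {m : Sec L U}
    {A : Matrix (Fin r) (Fin r) (Fn X U)} (h : IsGram φ e m A) (hA : IsUnit A.det) {V : Opens X}
    (hV : V ≤ U) : Function.Bijective (app φ.adjoint V) := by
  obtain ⟨a, ha, hae⟩ := h.frame.exists_dual_frame h.line
  refine bijective_app_of_frame h.frame ?_ hV
  convert ha.of_matrix hA using 2 with i
  exact h.app_adjoint hae i

/-- Near a point where a form is nondegenerate, its matrix is invertible. -/
theorem BilinForm.NondegenerateAt.exists_isGram {p : X} (h : φ.NondegenerateAt p)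
    (hE : IsVectorBundle E r) (hL : IsLineBundle L) {U₀ : Opens X} (hp : p ∈ U₀) :
    ∃ (U : Opens X) (_ : p ∈ U) (_ : U ≤ U₀) (e : Fin r → Sec E U) (m : Sec L U)
      (A : Matrix (Fin r) (Fin r) (Fn X U)), IsUnit A.det ∧ IsGram φ e m A := by
  obtain ⟨U, hpU, hU, e, he⟩ := hE.exists_frame_le hp
  obtain ⟨V, hpV, hV, m, hm⟩ := hL.exists_frame_le hpU
  obtain ⟨A, hA⟩ := OrthogonalHecke.exists_isGram φ (he.restrict hV) hm
  obtain ⟨W, hpW, hW, hu⟩ := exists_isUnit_resFn hpV ((hA.nondegenerateAt_iff hpV).1 h)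
  rw [RingHom.map_det] at hu
  exact ⟨W, hpW, hW.trans (hV.trans hU), _, _, _, hu, hA.restrict hW⟩

/-- Local preimages glue because they are unique. Nondegeneracy is asked on `U` only, so that the
result also serves forms degenerate at `x`, on open sets avoiding `x`. -/
theorem bijective_adjoint (hE : IsVectorBundle E r) (hL : IsLineBundle L) {U : Opens X}
    (h : ∀ p ∈ U, φ.NondegenerateAt p) : Function.Bijective (app φ.adjoint U) := by
  have key (p : X) (hp : p ∈ U) : ∃ (V : Opens X) (_ : p ∈ V) (_ : V ≤ U),
      ∀ W ≤ V, Function.Bijective (app φ.adjoint W) := by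
    obtain ⟨V, hpV, hV, e, m, A, hu, hA⟩ := (h p hp).exists_isGram hE hL hp
    exact ⟨V, hpV, hV, fun W hW ↦ hA.bijective_adjoint hu hW⟩
  have inj {V : Opens X} (hV : V ≤ U) : Function.Injective (app φ.adjoint V) := by
    intro s t hst
    refine sec_ext E fun p hp ↦ ?_
    obtain ⟨W, hpW, hW, hb⟩ := key p (hV hp)
    refine ⟨V ⊓ W, ⟨hp, hpW⟩, inf_le_left, (hb _ inf_le_right).1 ?_⟩
    rw [app_res, app_res, hst]
  refine ⟨inj le_rfl, fun t ↦ ?_⟩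
  obtain ⟨s, hs⟩ := exists_sec_of_local E U
    (fun V hV s ↦ app φ.adjoint V s = res _ hV t)
    (fun h hV s e ↦ by rw [app_res, e, res_res])
    (fun V hV s s' e e' ↦ inj hV (e.trans e'.symm)) fun p hp ↦ by
      obtain ⟨V, hpV, hV, hb⟩ := key p hp
      exact ⟨V, hpV, hV, (hb V le_rfl).2 _⟩
  refine ⟨s, sec_ext _ fun p hp ↦ ?_⟩
  obtain ⟨V, hpV, hV, e⟩ := hs p hp
  exact ⟨V, hpV, hV, by rw [← app_res, e]⟩

end Adjoint

/-! ### The inverse form -/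

section InverseForm
variable {E L : OMod X} {φ : BilinForm E L} {r : ℕ}

/-- The value of a local section of the dual of `E` on a section of `E`. -/
def evalForm {U V : Opens X} (a : Sec (dual E) U) (h : V ≤ U) : Sec E V →ₗ[Fn X V] Fn X V :=
  toFn.toLinearMap ∘ₗ homApply a h

theorem evalForm_ext {U : Opens X} {a b : Sec (dual E) U}
    (H : ∀ (V : Opens X) (h : V ≤ U) (s : Sec E V), evalForm a h s = evalForm b h s) : a = b :=
  HomSec.ext H

theorem evalForm_res {U V W : Opens X} (a : Sec (dual E) U) (h : W ≤ V) (h' : V ≤ U)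
    (s : Sec E V) : evalForm a (h.trans h') (res E h s) = resFn h (evalForm a h' s) :=
  congrArg toFn (homApply_res (G := structureMod X) a h h' s)

theorem res_evalForm {U V W : Opens X} (a : Sec (dual E) U) (h : W ≤ V) (h' : V ≤ U)
    (s : Sec E W) : evalForm (res (dual E) h' a) h s = evalForm a (h.trans h') s := rfl

theorem evalForm_add_left {U V : Opens X} (a b : Sec (dual E) U) (h : V ≤ U) (s : Sec E V) :
    evalForm (a + b) h s = evalForm a h s + evalForm b h s := rfl

theorem evalForm_smul_left {U V : Opens X} (c : Fn X U) (a : Sec (dual E) U) (h : V ≤ U)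
    (s : Sec E V) : evalForm (c • a) h s = resFn h c * evalForm a h s := rfl

theorem evalForm_sum_smul {U V : Opens X} {ι : Type*} [Fintype ι] (c : ι → Fn X U)
    (a : ι → Sec (dual E) U) (h : V ≤ U) (s : Sec E V) :
    evalForm (∑ i, c i • a i) h s = ∑ i, resFn h (c i) * evalForm (a i) h s :=
  (congrArg toFn (homApply_sum_smul (M := structureMod X) c a h s)).trans (map_sum _ _ _)

theorem IsFrame.evalForm_eq {U : Opens X} {e : Fin r → Sec E U} (he : IsFrame e)
    {a b : Sec (dual E) U} (h : ∀ j, evalForm a le_rfl (e j) = evalForm b le_rfl (e j)) : a = b :=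
  he.homApply_eq h

theorem isInverseForm_iff {φ' : BilinForm (dual E) (dual L)} : IsInverseForm φ φ' ↔
    ∀ (U : Opens X) (e : Sec E U) (ν : Sec (dual L) U) (a b : Sec (dual E) U),
      (∀ (V : Opens X) (h : V ≤ U) (s : Sec E V),
        evalForm a h s = evalForm ν h (φ.pair V (res E h e) s)) →
      φ'.pair U a b = evalForm b le_rfl e • ν := Iff.rfl

/-- The product of a linear form on `E` and a section of `L`. -/
def smulHom {U : Opens X} (a : Sec (dual E) U) (l : Sec L U) : Sec (ihom E L) U :=
  (HomSec.mk (fun {V} h ↦ (evalForm a h).smulRight (res L h l))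
    (fun {W V} h h' s ↦ by
      rw [LinearMap.smulRight_apply, LinearMap.smulRight_apply, (res L h).map_smulₛₗ, res_res,
        evalForm_res]) : HomSec E L U)

theorem homApply_smulHom {U V : Opens X} (a : Sec (dual E) U) (l : Sec L U) (h : V ≤ U)
    (s : Sec E V) : homApply (smulHom a l) h s = evalForm a h s • res L h l := rfl

/-- The composition of the linear form `φ(e, -)` with a linear form on `L`. -/
def compForm (φ : BilinForm E L) {U : Opens X} (e : Sec E U) (ν : Sec (dual L) U) :
    Sec (dual E) U :=
  (HomSec.mk (fun {V} h ↦ homApply ν h ∘ₗ φ.pair V (res E h e))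
    (fun {W V} h h' s ↦ by
      change homApply ν (h.trans h') (φ.pair W (res E (h.trans h') e) (res E h s)) =
        res _ h (homApply ν h' (φ.pair V (res E h' e) s))
      rw [← res_res E h h', φ.pair_res]
      exact homApply_res (G := structureMod X) ν h h' _) : HomSec E (structureMod X) U)

theorem evalForm_compForm {U V : Opens X} (e : Sec E U) (ν : Sec (dual L) U) (h : V ≤ U)
    (s : Sec E V) : evalForm (compForm φ e ν) h s = evalForm ν h (φ.pair V (res E h e) s) := rfl

/-- Rank one is what matters: for `l = c m` and `l' = c' m` both sides are `c c' ν(m) m`. -/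
theorem evalForm_smul_comm (hL : IsLineBundle L) {U V : Opens X} (ν : Sec (dual L) U) (h : V ≤ U)
    (l l' : Sec L V) : evalForm ν h l • l' = evalForm ν h l' • l := by
  refine sec_ext L fun p hp ↦ ?_
  obtain ⟨W, hpW, hW, m, hm⟩ := hL.exists_frame_le hp
  refine ⟨W, hpW, hW, ?_⟩
  rw [(res L hW).map_smulₛₗ, (res L hW).map_smulₛₗ, ← evalForm_res, ← evalForm_res]
  obtain ⟨c, hc⟩ := hm.exists_smul_self (res L hW l)
  obtain ⟨c', hc'⟩ := hm.exists_smul_self (res L hW l')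
  rw [← hc, ← hc', map_smul, map_smul, smul_smul, smul_smul]
  congr 1
  simp only [smul_eq_mul]
  ring

theorem IsFrame.exists_dual_line {U : Opens X} {m : Sec L U} (hm : IsFrame fun _ : Fin 1 ↦ m) :
    ∃ ν : Sec (dual L) U, (IsFrame fun _ : Fin 1 ↦ ν) ∧
      ∀ (V : Opens X) (h : V ≤ U) (c : Fn X V), evalForm ν h (c • res L h m) = c := by
  obtain ⟨ν, hν, hνm⟩ := hm.exists_dual_frame (isFrame_structureMod U)
  have : ν = fun _ ↦ ν 0 := funext fun i ↦ by rw [Subsingleton.elim i 0]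
  refine ⟨ν 0, by rwa [← this], fun V h c ↦ ?_⟩
  have h1 : evalForm (ν 0) le_rfl m = 1 := congrArg toFn (hνm 0 0)
  rw [map_smul]
  refine (congrArg (c • ·) ((evalForm_res (ν 0) h le_rfl m).trans ?_)).trans (mul_one c)
  rw [h1, map_one]

/-- Since `E → ℋom(E, L)` is bijective on sections, there is a unique `ε(a, l)` with `φ(ε(a, l), -)
= a l`. Then `φ⁻¹(a, b)` is the linear form `l ↦ b(ε(a, l))` on `L`, defined without choosing
frames. -/
theorem exists_isInverseForm (hφ : IsOrthogonalBundle φ r) :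
    ∃ φ' : BilinForm (dual E) (dual L), IsInverseForm φ φ' := by
  have hb (U : Opens X) : Function.Bijective (app φ.adjoint U) :=
    bijective_adjoint hφ.bundle hφ.line fun p _ ↦ hφ.nondegenerate p
  have hex (U : Opens X) (a : Sec (dual E) U) (l : Sec L U) : ∃ e : Sec E U,
      ∀ (V : Opens X) (h : V ≤ U) (s : Sec E V),
        φ.pair V (res E h e) s = evalForm a h s • res L h l := by
    obtain ⟨e, he⟩ := (hb U).2 (smulHom a l)
    exact ⟨e, fun V h s ↦ by rw [← φ.homApply_adjoint, he, homApply_smulHom]⟩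
  have huniq {U : Opens X} {e e' : Sec E U} (H : ∀ (V : Opens X) (h : V ≤ U) (s : Sec E V),
      φ.pair V (res E h e) s = φ.pair V (res E h e') s) : e = e' :=
    (hb U).1 (homApply_ext H)
  choose ε hε using hex
  have ε_res {V U : Opens X} (h : V ≤ U) (a : Sec (dual E) U) (l : Sec L U) :
      ε V (res _ h a) (res L h l) = res E h (ε U a l) := huniq fun W hW s ↦ by
    rw [hε, res_res, res_res, hε, res_evalForm]
  have ε_add {U : Opens X} (a : Sec (dual E) U) (l l' : Sec L U) :
      ε U a (l + l') = ε U a l + ε U a l' := huniq fun W hW s ↦ by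
    rw [hε, map_add, map_add, map_add, LinearMap.add_apply, hε, hε, smul_add]
  have ε_smul {U : Opens X} (c : Fn X U) (a : Sec (dual E) U) (l : Sec L U) :
      ε U a (c • l) = c • ε U a l := huniq fun W hW s ↦ by
    rw [hε, (res L hW).map_smulₛₗ, (res E hW).map_smulₛₗ, map_smul, LinearMap.smul_apply, hε,
      smul_comm]
  have ε_add_left {U : Opens X} (a a' : Sec (dual E) U) (l : Sec L U) :
      ε U (a + a') l = ε U a l + ε U a' l := huniq fun W hW s ↦ by
    rw [hε, map_add, map_add, LinearMap.add_apply, hε, hε, evalForm_add_left, add_smul]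
  have ε_smul_left {U : Opens X} (c : Fn X U) (a : Sec (dual E) U) (l : Sec L U) :
      ε U (c • a) l = c • ε U a l := huniq fun W hW s ↦ by
    rw [hε, (res E hW).map_smulₛₗ, map_smul, LinearMap.smul_apply, hε, evalForm_smul_left,
      mul_smul]
  let pr (U : Opens X) (a b : Sec (dual E) U) : Sec (dual L) U :=
    (HomSec.mk
      (fun {V} h ↦
        { toFun := fun l ↦ homApply b h (ε V (res _ h a) l)
          map_add' := fun l l' ↦ by rw [ε_add, map_add]
          map_smul' := fun c l ↦ by rw [ε_smul, map_smul, RingHom.id_apply] })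
      (fun {W V} h h' l ↦ by
        change homApply b (h.trans h') (ε W (res _ (h.trans h') a) (res L h l)) =
          res _ h (homApply b h' (ε V (res _ h' a) l))
        rw [← res_res _ h h' a, ε_res]
        exact homApply_res (G := structureMod X) b h h' _) : HomSec L (structureMod X) U)
  have hpr {U V : Opens X} (h : V ≤ U) (a b : Sec (dual E) U) (l : Sec L V) :
      evalForm (pr U a b) h l = evalForm b h (ε V (res _ h a) l) := rfl
  refine ⟨{ pair U := LinearMap.mk₂ _ (pr U) ?_ ?_ ?_ ?_, pair_res {V U} h a b := ?_ }, ?_⟩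
  · intro a a' b
    refine evalForm_ext fun V h l ↦ ?_
    rw [hpr, evalForm_add_left, hpr, hpr, map_add, ε_add_left, map_add]
  · intro c a b
    refine evalForm_ext fun V h l ↦ ?_
    rw [hpr, evalForm_smul_left, hpr, (res _ h).map_smulₛₗ, ε_smul_left, map_smul, smul_eq_mul]
  · intro a b b'
    exact evalForm_ext fun V h l ↦ rfl
  · intro c a b
    exact evalForm_ext fun V h l ↦ rfl
  · refine evalForm_ext fun W h' l ↦ ?_
    change evalForm b _ (ε W (res _ h' (res _ h a)) l) = evalForm b _ (ε W (res _ _ a) l)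
    rw [res_res]
  · rw [isInverseForm_iff]
    intro U e ν a b hab
    refine evalForm_ext fun V h l ↦ ?_
    -- For `a = ν φ(e, -)` one has `a(s) l = ν(φ(e, s)) l = ν(l) φ(e, s)`, so `ν(l) e` solves the
    -- equation that defines `ε(a, l)`.
    have : ε V (res _ h a) l = evalForm ν h l • res E h e := by
      refine huniq fun W hW s ↦ ?_
      rw [hε, (res E hW).map_smulₛₗ, map_smul, LinearMap.smul_apply, ← evalForm_res, res_res,
        res_evalForm, hab, evalForm_smul_comm hφ.line]
    rw [evalForm_smul_left, ← evalForm_res b h le_rfl e]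
    refine (hpr h a b l).trans ?_
    rw [this, map_smul, smul_eq_mul, mul_comm]

/-- Locally every `a` is of the form `ν φ(e, -)`: take `ν` dual to a frame `m` of `L` and solve
`φ(e, -) = a m`. -/
theorem IsInverseForm.eq (hφ : IsOrthogonalBundle φ r) {φ₁ φ₂ : BilinForm (dual E) (dual L)}
    (h₁ : IsInverseForm φ φ₁) (h₂ : IsInverseForm φ φ₂) : φ₁ = φ₂ := by
  rw [isInverseForm_iff] at h₁ h₂
  have : φ₁.pair = φ₂.pair := by
    refine funext fun U ↦ LinearMap.ext₂ fun a b ↦ sec_ext _ fun p hp ↦ ?_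
    obtain ⟨V, hpV, hV, m, hm⟩ := hφ.line.exists_frame_le hp
    obtain ⟨ν, -, hν⟩ := hm.exists_dual_line
    obtain ⟨e, he⟩ := (bijective_adjoint hφ.bundle hφ.line
      fun p _ ↦ hφ.nondegenerate p).2 (smulHom (res _ hV a) m)
    have key (W : Opens X) (h : W ≤ V) (s : Sec E W) :
        evalForm (res _ hV a) h s = evalForm ν h (φ.pair W (res E h e) s) := by
      rw [← φ.homApply_adjoint, he, homApply_smulHom, hν]
    refine ⟨V, hpV, hV, ?_⟩
    rw [← φ₁.pair_res, ← φ₂.pair_res, h₁ V e ν _ _ key, h₂ V e ν _ _ key]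
  cases φ₁
  cases φ₂
  cases this
  rfl

theorem IsInverseForm.pair_compForm {φ' : BilinForm (dual E) (dual L)} (h : IsInverseForm φ φ')
    {U : Opens X} (e : Sec E U) (ν : Sec (dual L) U) (b : Sec (dual E) U) :
    φ'.pair U (compForm φ e ν) b = evalForm b le_rfl e • ν :=
  isInverseForm_iff.1 h U e ν _ b fun _ _ _ ↦ rfl

/-- In dual frames, the matrix of the inverse form is the inverse matrix. -/
theorem IsInverseForm.isGram {φ' : BilinForm (dual E) (dual L)} (h : IsInverseForm φ φ')
    {U : Opens X} {e : Fin r → Sec E U} {m : Sec L U} {A : Matrix (Fin r) (Fin r) (Fn X U)}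
    (hA : IsGram φ e m A) (hu : IsUnit A.det) {a : Fin r → Sec (dual E) U} (ha : IsFrame a)
    (hae : ∀ i j, evalForm (a i) le_rfl (e j) = if i = j then 1 else 0)
    {ν : Sec (dual L) U} (hν : IsFrame fun _ : Fin 1 ↦ ν)
    (hνm : ∀ (V : Opens X) (h : V ≤ U) (c : Fn X V), evalForm ν h (c • res L h m) = c) :
    IsGram φ' a ν A⁻¹ := by
  refine ⟨ha, hν, fun i j ↦ ?_⟩
  have key : a i = compForm φ (∑ k, A⁻¹ i k • e k) ν := by
    refine hA.frame.evalForm_eq fun l ↦ ?_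
    rw [hae, evalForm_compForm, res_self, map_sum, LinearMap.sum_apply]
    have : ∑ k, φ.pair U (A⁻¹ i k • e k) (e l) = (A⁻¹ * A) i l • res L le_rfl m := by
      simp only [map_smul, LinearMap.smul_apply, hA.eq, smul_smul, ← Finset.sum_smul,
        Matrix.mul_apply, res_self]
    rw [this, hνm, Matrix.nonsing_inv_mul _ hu, Matrix.one_apply]
  rw [key, h.pair_compForm, map_sum, Finset.sum_eq_single j]
  · rw [map_smul, hae, if_pos rfl, smul_eq_mul, mul_one]
  · intro k _ hkj
    rw [map_smul, hae, if_neg hkj.symm, smul_zero]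
  · simp

end InverseForm

/-- Frames of `E`, `F`, `L` and `N` over `U` in which `β : E ⟶ F` is diagonal with entries `1` and
`τ`, and `i : L ⟶ N` is the multiplication by `τ`, where `τ` is not a zero divisor. -/
structure IsTransfer {E F L N : OMod X} (β : E ⟶ F) (i : L ⟶ N) {r : ℕ} {U : Opens X}
    (τ : Fn X U) (I : Finset (Fin r)) (e : Fin r → Sec E U) (f : Fin r → Sec F U) (m : Sec L U)
    (m' : Sec N U) : Prop where
  frame_source : IsFrame e
  frame : IsFrame f
  line_source : IsFrame fun _ : Fin 1 ↦ m
  line : IsFrame fun _ : Fin 1 ↦ m'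
  map_frame (j : Fin r) : app β U (e j) = (if j ∈ I then 1 else τ) • f j
  map_line : app i U m = τ • m'
  cancel (V : Opens X) (h : V ≤ U) (a b : Fn X V) : resFn h τ * a = resFn h τ * b → a = b

/-! ### Morphisms that are diagonal in suitable frames -/

section Frames
variable {E F : OMod X} {β : E ⟶ F} {r : ℕ} {U : Opens X} {e : Fin r → Sec E U}
  {f : Fin r → Sec F U} {d : Fin r → Fn X U}

theorem repr_app_of_smul (he : IsFrame e) (hf : IsFrame f) (hd : ∀ i, app β U (e i) = d i • f i)
    {V : Opens X} (hV : V ≤ U) (s : Sec E V) (i : Fin r) :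
    (hf.basis hV).repr (app β V s) i = resFn hV (d i) * (he.basis hV).repr s i := by
  rw [← hf.repr_sum hV (fun i ↦ resFn hV (d i) * (he.basis hV).repr s i)]
  congr 2
  conv_lhs => rw [← he.sum_repr hV s, map_sum]
  refine Finset.sum_congr rfl fun j _ ↦ ?_
  rw [map_smul, app_res, hd, (res F hV).map_smulₛₗ, smul_smul, mul_comm]

theorem injective_app_of_smul (he : IsFrame e) (hf : IsFrame f)
    (hd : ∀ i, app β U (e i) = d i • f i) (cancel : ∀ (V : Opens X) (h : V ≤ U) (i : Fin r)
      (a b : Fn X V), resFn h (d i) * a = resFn h (d i) * b → a = b) {V : Opens X} (hV : V ≤ U) :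
    Function.Injective (app β V) := by
  intro s s' h
  refine (he.basis hV).ext_elem fun i ↦ cancel V hV i _ _ ?_
  rw [← repr_app_of_smul he hf hd, ← repr_app_of_smul he hf hd, h]

/-- A morphism that is diagonal near `x`, with entries `1` and a parameter, and is an isomorphism
away from `x`, is an elementary transform. -/
theorem isElementaryTransform_of_frame {x : X} (hxc : IsClosed ({x} : Set X))
    (hb : ∀ V : Opens X, x ∉ V → Function.Bijective (app β V)) {hx : x ∈ U} {t : Fn X U}
    (ht : IsParameter hx t) (he : IsFrame e) (hf : IsFrame f) {I : Finset (Fin r)}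
    (hd : ∀ i, app β U (e i) = (if i ∈ I then 1 else t) • f i)
    {T : Submodule (κ x) (Fiber F x)}
    (hT : ∀ v, v ∈ T ↔ ∀ i ∉ I, (hf.fiberBasis hx).repr v i = 0) :
    IsElementaryTransform β x T := by
  have inj : ∀ V, Function.Injective (app β V) := injective_app_of_local fun p ↦ by
    by_cases hp : p = x
    · subst hp
      refine ⟨U, hx, fun V hV ↦ injective_app_of_smul he hf hd (fun W hW i a b hab ↦ ?_) hV⟩
      split_ifs at hab
      · simpa using hab
      · exact ht.mul_cancel hW hab
    · obtain ⟨V, hpV, -, hxV⟩ := exists_open_notMem hxc hp (Opens.mem_top p)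
      exact ⟨V, hpV, fun W hW ↦ (hb W fun h ↦ hxV (hW h)).1⟩
  refine ⟨inj, fun {V} s hxV ↦ (hT _).2 fun i hi ↦ ?_, fun {V} s hs ↦
    exists_app_eq_of_local inj fun p hp ↦ ?_⟩
  · have hxW : x ∈ V ⊓ U := ⟨hxV, hx⟩
    rw [← value_res inf_le_left hxW, hf.fiberBasis_repr_value inf_le_right hxW, ← app_res,
      repr_app_of_smul he hf hd, map_mul, valueFn_resFn, if_neg hi, ht.value_eq_zero, zero_mul]
  · by_cases hpx : p = x
    · subst hpx
      have hc (i : Fin r) : ∃ c, resFn inf_le_right (if i ∈ I then 1 else t) * c =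
          (hf.basis inf_le_right).repr (res F (inf_le_left : V ⊓ U ≤ V) s) i := by
        split_ifs with hi
        · simp
        · refine ht.exists_mul _ _ fun hpW ↦ ?_
          rw [← hf.fiberBasis_repr_value _ hpW, value_res]
          exact (hT _).1 (hs hp) i hi
      choose c hc using hc
      refine ⟨V ⊓ U, ⟨hp, hx⟩, inf_le_left, ∑ i, c i • res E inf_le_right (e i),
        (hf.basis inf_le_right).ext_elem fun i ↦ ?_⟩
      rw [repr_app_of_smul he hf hd, he.repr_sum, hc]
    · obtain ⟨W, hpW, hW, hxW⟩ := exists_open_notMem hxc hpx hp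
      exact ⟨W, hpW, hW, (hb W hxW).2 _⟩

end Frames

namespace IsTransfer
variable {E F L N : OMod X} {β : E ⟶ F} {i : L ⟶ N} {r : ℕ} {U : Opens X} {τ : Fn X U}
  {I : Finset (Fin r)} {e : Fin r → Sec E U} {f : Fin r → Sec F U} {m : Sec L U} {m' : Sec N U}
  {φ : BilinForm E L} {ψ : BilinForm F N}

theorem injective (h : IsTransfer β i τ I e f m m') {V : Opens X} (hV : V ≤ U) :
    Function.Injective (app β V) := by
  refine injective_app_of_smul h.frame_source h.frame h.map_frame (fun W hW j a b hab ↦ ?_) hV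
  split_ifs at hab
  · simpa using hab
  · exact h.cancel W hW a b hab

theorem smul_cancel (h : IsTransfer β i τ I e f m m') {V : Opens X} (hV : V ≤ U) {z z' : Sec N V}
    (hz : resFn hV τ • z = resFn hV τ • z') : z = z' := by
  obtain ⟨c, rfl⟩ := h.line.exists_smul hV z
  obtain ⟨c', rfl⟩ := h.line.exists_smul hV z'
  rw [smul_smul, smul_smul] at hz
  rw [h.cancel V hV _ _ (h.line.smul_cancel hV hz)]

theorem smul_smul_cancel (h : IsTransfer β i τ I e f m m') {V : Opens X} (hV : V ≤ U)
    {z z' : Sec N V} (hz : resFn hV τ • resFn hV τ • z = resFn hV τ • resFn hV τ • z') : z = z' :=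
  h.smul_cancel hV (h.smul_cancel hV hz)

/-- Multiplication by `τ` clears all denominators, because both possible diagonal entries divide
`τ`. -/
theorem exists_lift (h : IsTransfer β i τ I e f m m') {V : Opens X} (hV : V ≤ U) (s : Sec F V) :
    ∃ s', app β V s' = resFn hV τ • s := by
  refine ⟨∑ j, (if j ∈ I then resFn hV τ * (h.frame.basis hV).repr s j else
    (h.frame.basis hV).repr s j) • res E hV (e j), (h.frame.basis hV).ext_elem fun j ↦ ?_⟩
  rw [repr_app_of_smul h.frame_source h.frame h.map_frame, h.frame_source.repr_sum, map_smul,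
    Finsupp.smul_apply, smul_eq_mul]
  split_ifs
  · rw [map_one, one_mul]
  · rfl

theorem mul_gram_eq (h : IsTransfer β i τ I e f m m') (hψ : FormsCompatible φ ψ β i)
    {A C : Matrix (Fin r) (Fin r) (Fn X U)} (hA : IsGram φ e m A) (hC : IsGram ψ f m' C)
    (j k : Fin r) :
    (if j ∈ I then 1 else τ) * (if k ∈ I then 1 else τ) * C j k = τ * A j k := by
  refine h.line.smul_cancel_self ?_
  have := hψ U (e j) (e k)
  rw [h.map_frame, h.map_frame, hA.eq, map_smul, h.map_line, map_smul, LinearMap.map_smul₂, hC.eq,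
    smul_smul, smul_smul, smul_smul] at this
  rw [mul_comm τ, this]
  congr 1
  ring

end IsTransfer

/-! ### Extending a form to a larger bundle -/

section Extension
variable {E F L N : OMod X} {β : E ⟶ F} {i : L ⟶ N} {r : ℕ} {φ : BilinForm E L}

/-- The form `τ² ψ = i ∘ φ` is locally divisible by `τ²`. -/
def IsExtendable (φ : BilinForm E L) (β : E ⟶ F) (i : L ⟶ N) {U : Opens X} (τ : Fn X U) : Prop :=
  ∀ (V : Opens X) (h : V ≤ U) (s s' : Sec F V) (a a' : Sec E V), app β V a = resFn h τ • s →
    app β V a' = resFn h τ • s' → ∃ z, resFn h τ • resFn h τ • z = app i V (φ.pair V a a')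

theorem FormsCompatible.smul_smul {ψ : BilinForm F N} (h : FormsCompatible φ ψ β i)
    {U : Opens X} {τ : Fn X U} {s s' : Sec F U} {a a' : Sec E U} (ha : app β U a = τ • s)
    (ha' : app β U a' = τ • s') : τ • τ • ψ.pair U s s' = app i U (φ.pair U a a') := by
  rw [h, ha, ha', map_smul, LinearMap.map_smul₂]

/-- Locally `τ F` lies in the image of `E`, so `φ` determines `τ² ψ`, and `τ` cancels. -/
theorem FormsCompatible.ext_of_transfer
    (H : ∀ p : X, ∃ (U : Opens X) (_ : p ∈ U) (τ : Fn X U) (I : Finset (Fin r))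
      (e : Fin r → Sec E U) (f : Fin r → Sec F U) (m : Sec L U) (m' : Sec N U),
      IsTransfer β i τ I e f m m')
    {ψ ψ' : BilinForm F N} (h : FormsCompatible φ ψ β i) (h' : FormsCompatible φ ψ' β i) :
    ψ = ψ' := by
  have : ψ.pair = ψ'.pair := by
    refine funext fun U ↦ LinearMap.ext₂ fun s s' ↦ sec_ext _ fun p hp ↦ ?_
    obtain ⟨V, hpV, τ, I, e, f, m, m', hT⟩ := H p
    refine ⟨U ⊓ V, ⟨hp, hpV⟩, inf_le_left, ?_⟩
    obtain ⟨a, ha⟩ := hT.exists_lift inf_le_right (res F (inf_le_left : U ⊓ V ≤ U) s)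
    obtain ⟨a', ha'⟩ := hT.exists_lift inf_le_right (res F (inf_le_left : U ⊓ V ≤ U) s')
    refine hT.smul_smul_cancel inf_le_right ?_
    rw [← ψ.pair_res, ← ψ'.pair_res, h.smul_smul ha ha', h'.smul_smul ha ha']
  cases ψ
  cases ψ'
  cases this
  rfl

/-- The flipped form extends `φ` as well, so uniqueness applies. -/
theorem FormsCompatible.isSymmetric_of_transfer
    (H : ∀ p : X, ∃ (U : Opens X) (_ : p ∈ U) (τ : Fn X U) (I : Finset (Fin r))
      (e : Fin r → Sec E U) (f : Fin r → Sec F U) (m : Sec L U) (m' : Sec N U),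
      IsTransfer β i τ I e f m m')
    {ψ : BilinForm F N} (h : FormsCompatible φ ψ β i) (hφ : φ.IsSymmetric) : ψ.IsSymmetric := by
  let ψ' : BilinForm F N := ⟨fun U ↦ (ψ.pair U).flip, fun hV s s' ↦ ψ.pair_res hV s' s⟩
  have h' : FormsCompatible φ ψ' β i := fun U s s' ↦ by rw [hφ, h]; rfl
  have e := h.ext_of_transfer H h'
  intro U s s'
  conv_lhs => rw [e]
  rfl

/-- The value `ψ(s, s')` is characterised by a property `P` that tests all multipliers `g` at once.
It does not mention the local `τ`, so local solutions agree on overlaps and glue. -/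
theorem exists_extension
    (H : ∀ p : X, ∃ (U : Opens X) (_ : p ∈ U) (τ : Fn X U) (I : Finset (Fin r))
      (e : Fin r → Sec E U) (f : Fin r → Sec F U) (m : Sec L U) (m' : Sec N U),
      IsTransfer β i τ I e f m m' ∧ IsExtendable φ β i τ) :
    ∃ ψ : BilinForm F N, FormsCompatible φ ψ β i := by
  have inj : ∀ U, Function.Injective (app β U) := injective_app_of_local fun p ↦ by
    obtain ⟨U, hpU, τ, I, e, f, m, m', hT, -⟩ := H p
    exact ⟨U, hpU, fun V hV ↦ hT.injective hV⟩
  let P (U : Opens X) (s s' : Sec F U) (z : Sec N U) : Prop :=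
    ∀ (V : Opens X) (h : V ≤ U) (g : Fn X V) (a a' : Sec E V), app β V a = g • res F h s →
      app β V a' = g • res F h s' → g • g • res N h z = app i V (φ.pair V a a')
  have hP {U : Opens X} {s s' : Sec F U} {z : Sec N U} (h : P U s s' z) {g : Fn X U}
      {a a' : Sec E U} (ha : app β U a = g • s) (ha' : app β U a' = g • s') :
      g • g • z = app i U (φ.pair U a a') := by
    have := h U le_rfl g a a'
    simp only [res_self] at this
    exact this ha ha'
  have mono {V U : Opens X} (h : V ≤ U) {s s' : Sec F U} {z : Sec N U} (hz : P U s s' z) :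
      P V (res F h s) (res F h s') (res N h z) := fun W hW g a a' ha ha' ↦ by
    rw [res_res] at ha ha' ⊢
    exact hz W _ g a a' ha ha'
  -- Equalities in `N` may be checked locally after multiplication by `τ²`, where three given
  -- sections of `F` lift to `E`; three are what additivity needs.
  have loc {U : Opens X} {z z' : Sec N U} (s s' s'' : Sec F U)
      (h : ∀ (V : Opens X) (hV : V ≤ U) (τ : Fn X V) (a a' a'' : Sec E V),
        app β V a = τ • res F hV s → app β V a' = τ • res F hV s' →
        app β V a'' = τ • res F hV s'' →
        τ • τ • res N hV z = τ • τ • res N hV z') : z = z' := by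
    refine sec_ext N fun p hp ↦ ?_
    obtain ⟨V, hpV, τ, I, e, f, m, m', hT, -⟩ := H p
    refine ⟨U ⊓ V, ⟨hp, hpV⟩, inf_le_left, ?_⟩
    obtain ⟨a, ha⟩ := hT.exists_lift inf_le_right (res F (inf_le_left : U ⊓ V ≤ U) s)
    obtain ⟨a', ha'⟩ := hT.exists_lift inf_le_right (res F (inf_le_left : U ⊓ V ≤ U) s')
    obtain ⟨a'', ha''⟩ := hT.exists_lift inf_le_right (res F (inf_le_left : U ⊓ V ≤ U) s'')
    exact hT.smul_smul_cancel inf_le_right (h _ inf_le_left _ a a' a'' ha ha' ha'')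
  have uniq {U : Opens X} {s s' : Sec F U} {z z' : Sec N U} (h : P U s s' z) (h' : P U s s' z') :
      z = z' :=
    loc s s' s' fun V hV τ a a' _ ha ha' _ ↦ by rw [h V hV τ a a' ha ha', h' V hV τ a a' ha ha']
  have ex (U : Opens X) (s s' : Sec F U) : ∃ z, P U s s' z := by
    obtain ⟨z, hz⟩ := exists_sec_of_local N U (fun V hV z ↦ P V (res F hV s) (res F hV s') z)
      (fun h hV z hz ↦ by simpa only [res_res] using mono h hz) (fun V hV z z' ↦ uniq)
      fun p hp ↦ by
        obtain ⟨V, hpV, τ, I, e, f, m, m', hT, hE⟩ := H p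
        obtain ⟨a, ha⟩ := hT.exists_lift inf_le_right (res F (inf_le_left : U ⊓ V ≤ U) s)
        obtain ⟨a', ha'⟩ := hT.exists_lift inf_le_right (res F (inf_le_left : U ⊓ V ≤ U) s')
        obtain ⟨z, hz⟩ := hE _ inf_le_right _ _ a a' ha ha'
        refine ⟨U ⊓ V, ⟨hp, hpV⟩, inf_le_left, z, fun W hW g b b' hb hb' ↦
          hT.smul_smul_cancel (hW.trans inf_le_right) ?_⟩
        -- If `a` lifts `τ s` and `b` lifts `g s`, then `τ b = g a` by injectivity of `β`. This
        -- carries the identity from the multiplier `τ` to an arbitrary `g`.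
        have key {a b : Sec E _} {s : Sec F _}
            (ha : app β _ a = resFn (inf_le_right : U ⊓ V ≤ V) τ • s)
            (hb : app β W b = g • res F hW s) :
            resFn (hW.trans inf_le_right) τ • b = g • res E hW a := inj W (by
          rw [map_smul, map_smul, app_res, ha, hb, (res F hW).map_smulₛₗ, resFn_resFn, smul_comm])
        have hz' := congrArg (res N hW) hz
        rw [(res N hW).map_smulₛₗ, (res N hW).map_smulₛₗ, resFn_resFn, ← app_res,
          ← φ.pair_res] at hz'
        have h1 : resFn (hW.trans inf_le_right) τ • resFn (hW.trans inf_le_right) τ •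
            app i W (φ.pair W b b') = g • g • app i W (φ.pair W (res E hW a) (res E hW a')) := by
          have hsm (c : Fn X W) (a a' : Sec E W) :
              c • c • app i W (φ.pair W a a') = app i W (φ.pair W (c • a) (c • a')) := by
            rw [map_smul, LinearMap.map_smul₂, map_smul, map_smul]
          rw [hsm, hsm, key ha hb, key ha' hb']
        rw [h1, ← hz']
        simp only [smul_smul]
        congr 1
        ring
    refine ⟨z, fun V hV g a a' ha ha' ↦ sec_ext N fun p hp ↦ ?_⟩
    obtain ⟨W, hpW, hW, hzW⟩ := hz p (hV hp)
    refine ⟨V ⊓ W, ⟨hp, hpW⟩, inf_le_left, ?_⟩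
    have := hzW (V ⊓ W) inf_le_right (resFn inf_le_left g) (res E inf_le_left a)
      (res E inf_le_left a') (by rw [app_res, ha, (res F _).map_smulₛₗ, res_res, res_res])
      (by rw [app_res, ha', (res F _).map_smulₛₗ, res_res, res_res])
    rw [φ.pair_res, app_res, res_res] at this
    rw [(res N _).map_smulₛₗ, (res N _).map_smulₛₗ, res_res, this]
  choose ψ hψ using ex
  refine ⟨{ pair U := LinearMap.mk₂ _ (ψ U) ?_ ?_ ?_ ?_, pair_res {V U} h s s' := ?_ },
    fun U s s' ↦ ?_⟩
  · intro s₁ s₂ s'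
    refine loc s₁ s₂ s' fun V hV τ a₁ a₂ a' h₁ h₂ h' ↦ ?_
    rw [hψ U _ _ V hV τ (a₁ + a₂) a' (by rw [map_add, h₁, h₂, map_add, smul_add]) h',
      map_add (res N hV), smul_add, smul_add, hψ U _ _ V hV τ _ _ h₁ h', hψ U _ _ V hV τ _ _ h₂ h',
      map_add (φ.pair V), LinearMap.add_apply, map_add (app i V)]
  · intro c s s'
    refine loc s s' s' fun V hV τ a a' _ h h' _ ↦ ?_
    rw [hψ U _ _ V hV τ (resFn hV c • a) a'
      (by rw [map_smul, h, (res F hV).map_smulₛₗ, smul_comm]) h', (res N hV).map_smulₛₗ,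
      smul_comm τ (resFn hV c), smul_comm τ (resFn hV c), hψ U _ _ V hV τ _ _ h h',
      LinearMap.map_smul₂, map_smul]
  · intro s s₁ s₂
    refine loc s₁ s₂ s fun V hV τ a₁ a₂ a h₁ h₂ h ↦ ?_
    rw [hψ U _ _ V hV τ a (a₁ + a₂) h (by rw [map_add, h₁, h₂, map_add, smul_add]),
      map_add (res N hV), smul_add, smul_add, hψ U _ _ V hV τ _ _ h h₁, hψ U _ _ V hV τ _ _ h h₂, map_add, map_add]
  · intro c s s'
    refine loc s s' s' fun V hV τ a a' _ h h' _ ↦ ?_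
    rw [hψ U _ _ V hV τ a (resFn hV c • a') h
      (by rw [map_smul, h', (res F hV).map_smulₛₗ, smul_comm]), (res N hV).map_smulₛₗ,
      smul_comm τ (resFn hV c), smul_comm τ (resFn hV c), hψ U _ _ V hV τ _ _ h h',
      map_smul, map_smul]
  · exact uniq (hψ V _ _) (mono h (hψ U s s'))
  -- Sections that come from `E` are tested with the multiplier `1`.
  · have := hP (hψ U (app β U s) (app β U s')) (g := 1) (one_smul _ _).symm (one_smul _ _).symm
    rw [one_smul, one_smul] at this
    exact this.symm

end Extension

/-! ### Frames of the twists by `±x` -/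

section Twist
variable {L : OMod X} {x : X} {U : Opens X}

/-- A generator of `𝒪(-x)` and a frame of `L` determine a frame of `L(x)`. -/
theorem IsFrame.exists_twistUp {m : Sec L U} (hm : IsFrame fun _ : Fin 1 ↦ m)
    {g : Sec (twistDown (structureMod X) x) U} (hg : IsFrame fun _ : Fin 1 ↦ g) {τ : Fn X U}
    (hgτ : app (twistDownι (structureMod X) x) U g = τ • toFn.symm 1) :
    ∃ m' : Sec (twistUp L x) U, (IsFrame fun _ : Fin 1 ↦ m') ∧
      app (toTwistUp L x) U m = τ • m' := by
  obtain ⟨h, hh, hhg⟩ := hg.exists_dual_frame hm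
  have : h = fun _ ↦ h 0 := funext fun i ↦ by rw [Subsingleton.elim i 0]
  refine ⟨h 0, by rwa [← this], hg.homApply_eq fun j ↦ ?_⟩
  have h1 : homApply (app (toTwistUp L x) U m) le_rfl g =
      toFn (app (twistDownι (structureMod X) x) U g) • res L le_rfl m := rfl
  have h2 : homApply (h 0) le_rfl g = m := hhg 0 0
  refine h1.trans (Eq.trans ?_ (homApply_smul τ (h 0) le_rfl g).symm)
  rw [h2, hgτ, map_smul, LinearEquiv.apply_symm_apply, smul_eq_mul, mul_one, res_self, resFn_self]

theorem IsParameter.exists_twistDown {hx : x ∈ U} {t : Fn X U} (ht : IsParameter hx t) {M : OMod X}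
    {m : Sec M U} (hm : IsFrame fun _ : Fin 1 ↦ m) :
    ∃ m' : Sec (twistDown M x) U, (IsFrame fun _ : Fin 1 ↦ m') ∧
      app (twistDownι M x) U m' = t • m := by
  obtain ⟨m', hm', hmm⟩ := (isElementaryTransform_twistDown M x).exists_frame ht hm ∅ (fun v ↦ by
    rw [Submodule.mem_bot]
    simp only [Finset.notMem_empty, not_false_eq_true, forall_const]
    exact ⟨fun h ↦ by simp [h], fun h ↦ (hm.fiberBasis hx).ext_elem (by simpa using h)⟩)
  have : m' = fun _ ↦ m' 0 := funext fun i ↦ by rw [Subsingleton.elim i 0]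
  exact ⟨m' 0, by rwa [← this], by rw [hmm, if_neg (Finset.notMem_empty _)]⟩

theorem exists_twistDown_of_notMem (hx : x ∉ U) {M : OMod X} {m : Sec M U}
    (hm : IsFrame fun _ : Fin 1 ↦ m) :
    ∃ m' : Sec (twistDown M x) U, (IsFrame fun _ : Fin 1 ↦ m') ∧
      app (twistDownι M x) U m' = m := by
  obtain ⟨m', hm', hmm⟩ := (isElementaryTransform_twistDown M x).exists_frame_of_notMem hx hm
  have : m' = fun _ ↦ m' 0 := funext fun i ↦ by rw [Subsingleton.elim i 0]
  exact ⟨m' 0, by rwa [← this], hmm 0⟩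

theorem isLineBundle_twistUp (hc : IsCurvePoint x) (hL : IsLineBundle L) :
    IsLineBundle (twistUp L x) :=
  isVectorBundle_ihom ((isElementaryTransform_twistDown _ x).isVectorBundle hc
    isLineBundle_structureMod) hL

end Twist

/-! ### The map from `E` to the dual of a transform of its dual -/

section Transpose
variable {E G L : OMod X} {ι : G ⟶ dual E} {r : ℕ} {U : Opens X} {a : Fin r → Sec (dual E) U}

theorem IsFrame.exists_dual {e : Fin r → Sec E U} (he : IsFrame e) :
    ∃ a : Fin r → Sec (dual E) U, IsFrame a ∧
      ∀ i j, evalForm (a i) le_rfl (e j) = if i = j then 1 else 0 := by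
  obtain ⟨a, ha, hae⟩ := he.exists_dual_frame (isFrame_structureMod U)
  refine ⟨a, ha, fun i j ↦ (congrArg toFn (hae i j)).trans ?_⟩
  split_ifs
  · rfl
  · rfl

/-- Reflexivity on frames: if `a` is `P` times the dual frame of `e₀`, the inverse transpose of `P`
applied to `e₀` is dual to `a`. -/
theorem IsFrame.exists_predual (ha : IsFrame a) {e₀ : Fin r → Sec E U} (he₀ : IsFrame e₀) :
    ∃ e : Fin r → Sec E U, IsFrame e ∧
      ∀ i j, evalForm (a i) le_rfl (e j) = if i = j then 1 else 0 := by
  obtain ⟨a₀, ha₀, hae⟩ := he₀.exists_dual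
  obtain ⟨P, hP, hPa⟩ := ha₀.exists_matrix ha
  refine ⟨fun j ↦ ∑ k, P⁻¹.transpose j k • e₀ k, he₀.of_matrix ?_, fun i j ↦ ?_⟩
  · rw [Matrix.det_transpose]
    exact Matrix.isUnit_nonsing_inv_det P hP
  · rw [map_sum, hPa, ← Matrix.one_apply, ← Matrix.mul_nonsing_inv P hP, Matrix.mul_apply]
    refine Finset.sum_congr rfl fun k _ ↦ ?_
    rw [map_smul, evalForm_sum_smul, Finset.sum_eq_single k, hae, if_pos rfl, resFn_self, mul_one,
      Matrix.transpose_apply, smul_eq_mul, mul_comm]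
    · intro l _ hl
      rw [hae, if_neg hl, mul_zero]
    · simp

/-- A diagonal matrix is its own transpose. -/
theorem exists_transpose_frame {g : Fin r → Sec G U} (hg : IsFrame g) {d : Fin r → Fn X U}
    (hd : ∀ i, app ι U (g i) = d i • a i) {e : Fin r → Sec E U}
    (hae : ∀ i j, evalForm (a i) le_rfl (e j) = if i = j then 1 else 0) :
    ∃ f : Fin r → Sec (dual G) U, IsFrame f ∧ ∀ i, app (transpose ι) U (e i) = d i • f i := by
  obtain ⟨f, hf, hfg⟩ := hg.exists_dual
  refine ⟨f, hf, fun i ↦ hg.evalForm_eq fun j ↦ ?_⟩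
  have h1 : evalForm (app (transpose ι) U (e i)) le_rfl (g j) =
      evalForm (app ι U (g j)) le_rfl (res E le_rfl (e i)) := rfl
  rw [h1, hd, res_self, evalForm_smul_left, hae]
  refine Eq.trans ?_ (evalForm_smul_left (d i) (f i) le_rfl (g j)).symm
  rw [hfg, resFn_self, resFn_self]
  split_ifs with h h' h'
  · rw [h]
  · exact (h' h.symm).elim
  · exact (h h'.symm).elim
  · rw [mul_zero, mul_zero]

variable {x : X} {T : Submodule (κ x) (Fiber (dual E) x)}

theorem IsElementaryTransform.exists_isTransfer_of_ne (h : IsElementaryTransform ι x T)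
    (hE : IsVectorBundle E r) (hL : IsLineBundle L) (hx : IsClosed ({x} : Set X)) {p : X}
    (hp : p ≠ x) :
    ∃ (U : Opens X) (_ : p ∈ U) (e : Fin r → Sec E U) (f : Fin r → Sec (dual G) U) (m : Sec L U)
      (m' : Sec (twistUp L x) U),
      IsTransfer (transpose ι) (toTwistUp L x) 1 Finset.univ e f m m' := by
  obtain ⟨U₀, hp₀, e₀, he₀⟩ := hE p
  obtain ⟨U₁, hp₁, hU₁, m, hm⟩ := hL.exists_frame_le hp₀
  obtain ⟨U, hpU, hU, hxU⟩ := exists_open_notMem hx hp hp₁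
  obtain ⟨a, ha, -⟩ := (he₀.restrict (hU.trans hU₁)).exists_dual
  obtain ⟨g, hg, hga⟩ := h.exists_frame_of_notMem hxU ha
  obtain ⟨e, he, hae⟩ := IsFrame.exists_predual ha (he₀.restrict (hU.trans hU₁))
  obtain ⟨f, hf, hef⟩ := exists_transpose_frame hg (d := fun _ ↦ 1)
    (fun i ↦ (hga i).trans (one_smul _ _).symm) hae
  obtain ⟨τ, hτ, hτ'⟩ := exists_twistDown_of_notMem hxU (isFrame_structureMod U)
  obtain ⟨m', hm', hmm⟩ := (hm.restrict hU).exists_twistUp hτ (hτ'.trans (one_smul _ _).symm)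
  exact ⟨U, hpU, e, f, _, m', he, hf, hm.restrict hU, hm', fun j ↦ by
    rw [hef, if_pos (Finset.mem_univ j)]; rfl, hmm, fun V hV a b hab ↦ by simpa using hab⟩

theorem IsElementaryTransform.exists_isTransfer (h : IsElementaryTransform ι x T)
    (hE : IsVectorBundle E r) (hL : IsLineBundle L) {U₀ : Opens X} {hx₀ : x ∈ U₀} {t : Fn X U₀}
    (ht : IsParameter hx₀ t) :
    ∃ (U : Opens X) (_ : x ∈ U) (hU : U ≤ U₀) (I : Finset (Fin r)) (e : Fin r → Sec E U)
      (f : Fin r → Sec (dual G) U) (m : Sec L U) (m' : Sec (twistUp L x) U),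
      I.card = finrank (κ x) T ∧
      IsTransfer (transpose ι) (toTwistUp L x) (resFn hU t) I e f m m' := by
  obtain ⟨U₁, hx₁, hU₁, a, g, I, ha, hg, hI, hga, -⟩ := h.exists_frames (isVectorBundle_dual hE) ht
  obtain ⟨U₂, hx₂, hU₂, e₀, he₀⟩ := hE.exists_frame_le hx₁
  obtain ⟨U, hxU, hU, m, hm⟩ := hL.exists_frame_le hx₂
  have ht' := ht.restrict (hU.trans (hU₂.trans hU₁)) hxU
  obtain ⟨e, he, hae⟩ := IsFrame.exists_predual (ha.restrict (hU.trans hU₂)) (he₀.restrict hU)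
  obtain ⟨f, hf, hef⟩ := exists_transpose_frame (hg.restrict (hU.trans hU₂))
    (d := fun i ↦ if i ∈ I then 1 else resFn (hU.trans (hU₂.trans hU₁)) t) (fun i ↦ by
      rw [app_res, hga, (res _ _).map_smulₛₗ]
      split_ifs
      · rw [map_one]
      · rw [resFn_resFn]) hae
  obtain ⟨τ, hτ, hτ'⟩ := ht'.exists_twistDown (isFrame_structureMod U)
  obtain ⟨m', hm', hmm⟩ := hm.exists_twistUp hτ hτ'
  exact ⟨U, hxU, _, I, e, f, m, m', hI, he, hf, hm, hm', hef, hmm, fun V hV a b ↦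
    ht'.mul_cancel hV⟩

end Transpose

/-! ### Orthogonality for the inverse form and divisibility of `φ` -/

section Lagrangian
variable {E L : OMod X} {φ : BilinForm E L} {φ' : BilinForm (dual E) (dual L)} {r : ℕ} {x : X}

theorem IsInverseForm.exists_isGram (h : IsInverseForm φ φ') (hφ : IsOrthogonalBundle φ r)
    (x : X) : ∃ (U : Opens X) (_ : x ∈ U) (a : Fin r → Sec (dual E) U) (ν : Sec (dual L) U)
      (B : Matrix (Fin r) (Fin r) (Fn X U)), IsUnit B.det ∧ B.IsSymm ∧ IsGram φ' a ν B := by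
  obtain ⟨U, hxU, -, e, m, A, hu, hA⟩ :=
    (hφ.nondegenerate x).exists_isGram hφ.bundle hφ.line (Opens.mem_top x)
  obtain ⟨a, ha, hae⟩ := hA.frame.exists_dual
  obtain ⟨ν, hν, hνm⟩ := hA.line.exists_dual_line
  refine ⟨U, hxU, a, ν, A⁻¹, Matrix.isUnit_nonsing_inv_det A hu, ?_,
    h.isGram hA hu ha hae hν hνm⟩
  have : A.IsSymm := Matrix.IsSymm.ext fun i j ↦ hA.symm hφ.symm j i
  rw [Matrix.IsSymm, Matrix.transpose_nonsing_inv, this]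

theorem IsInverseForm.fiber_symm (h : IsInverseForm φ φ') (hφ : IsOrthogonalBundle φ r)
    (v w : Fiber (dual E) x) : φ'.fiber x v w = φ'.fiber x w v := by
  obtain ⟨U, hxU, a, ν, B, -, hs, hB⟩ := h.exists_isGram hφ x
  have : φ'.fiber x = (φ'.fiber x).flip := by
    refine (hB.frame.fiberBasis hxU).ext fun i ↦ (hB.frame.fiberBasis hxU).ext fun j ↦ ?_
    rw [LinearMap.flip_apply, hB.fiber_eq hxU, hB.fiber_eq hxU, hs.apply]
  conv_lhs => rw [this]
  rfl

/-- A coordinate on the line in which the form takes its values gives a nondegenerate scalar form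
with the same orthogonal subspaces. -/
theorem IsInverseForm.finrank_orthogonalBilin (h : IsInverseForm φ φ')
    (hφ : IsOrthogonalBundle φ r) (W : Submodule (κ x) (Fiber (dual E) x)) :
    finrank (κ x) (W.orthogonalBilin (φ'.fiber x)) = r - finrank (κ x) W := by
  have hE := isVectorBundle_dual hφ.bundle
  have := hE.finite_fiber x
  obtain ⟨U, hxU, a, ν, B, hu, -, hB⟩ := h.exists_isGram hφ x
  have hn := (hB.nondegenerateAt_iff hxU).2 (hu.map _)
  let c : Fiber (dual L) x →ₗ[κ x] κ x := (hB.line.fiberBasis hxU).coord 0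
  have hc (v : Fiber (dual L) x) : c v = 0 ↔ v = 0 := by
    refine ⟨fun h ↦ (hB.line.fiberBasis hxU).ext_elem fun i ↦ ?_, fun h ↦ by rw [h, map_zero]⟩
    rw [Subsingleton.elim i 0]
    exact Eq.trans h (map_zero c).symm
  let b : LinearMap.BilinForm (κ x) (Fiber (dual E) x) := (φ'.fiber x).compr₂ c
  have hrefl : LinearMap.IsRefl b := fun v w hvw ↦ by
    rw [LinearMap.compr₂_apply, hc] at hvw ⊢
    rw [h.fiber_symm hφ, hvw]
  have hb : b.Nondegenerate := by
    rw [LinearMap.BilinForm.Nondegenerate, hrefl.nondegenerate_iff_separatingLeft]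
    intro v hv
    have : v ∈ φ'.annihilator x := LinearMap.ext fun w ↦ (hc _).1 (hv w)
    rwa [hn, Submodule.mem_bot] at this
  have hW : W.orthogonalBilin (φ'.fiber x) = b.orthogonal W := by
    ext v
    simp only [Submodule.mem_orthogonalBilin_iff, LinearMap.BilinForm.mem_orthogonal_iff]
    exact forall₂_congr fun w _ ↦ (hc _).symm
  rw [hW, LinearMap.BilinForm.finrank_orthogonal hb, hE.finrank_fiber]

theorem res_compForm {U V : Opens X} (h : V ≤ U) (e : Sec E U) (ν : Sec (dual L) U) :
    res (dual E) h (compForm φ e ν) = compForm φ (res E h e) (res (dual L) h ν) :=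
  evalForm_ext fun W hW s ↦ by
    rw [res_evalForm, evalForm_compForm, evalForm_compForm, res_res, res_evalForm]

variable {W : Submodule (κ x) (Fiber (dual E) x)} {G : OMod X} {ι : G ⟶ dual E}

/-- If `e` is divisible by a parameter as a section of the dual of `G`, then `φ(e, -)` lies in the
subspace orthogonal to all of `W^⊥`. -/
theorem IsInverseForm.fiber_compForm_eq_zero (h : IsInverseForm φ φ')
    (hι : IsElementaryTransform ι x (W.orthogonalBilin (φ'.fiber x))) {U : Opens X} {hx : x ∈ U}
    {t : Fn X U} (ht : valueFn x hx t = 0) {e : Sec E U} {s : Sec (dual G) U}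
    (he : app (transpose ι) U e = t • s) (ν : Sec (dual L) U) {v : Fiber (dual E) x}
    (hv : v ∈ W.orthogonalBilin (φ'.fiber x)) :
    φ'.fiber x (value _ hx (compForm φ e ν)) v = 0 := by
  obtain ⟨V, hxV, hV, b, rfl⟩ := exists_value_eq hx v
  -- Once `v` is lifted to a section `g` of `G`, the product is `g(e) ν`, and `g(e) = t s(g)`
  -- vanishes at `x`.
  obtain ⟨g, rfl⟩ := hι.exists_lift b fun _ ↦ hv
  rw [← value_res hV hxV, φ'.fiber_value, res_compForm, h.pair_compForm, value_smul]
  have : evalForm (app ι V g) le_rfl (res E hV e) = resFn hV t * evalForm s hV g := by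
    rw [← evalForm_smul_left, ← he]
    rfl
  rw [this, map_mul, valueFn_resFn, ht, zero_mul, zero_smul]

/-- Writing `φ(a, a') = c m` with `m ↦ t m'`, divisibility of `t c m'` by `t²` amounts to `c`
vanishing at `x`, and this is where isotropy of `W` enters. -/
theorem IsInverseForm.isExtendable (h : IsInverseForm φ φ') (hφ : IsOrthogonalBundle φ r)
    (hW : IsIsotropicIn φ' x W)
    (hι : IsElementaryTransform ι x (W.orthogonalBilin (φ'.fiber x))) {U : Opens X} {hx : x ∈ U}
    {t : Fn X U} (ht : IsParameter hx t) {I : Finset (Fin r)} {e : Fin r → Sec E U}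
    {f : Fin r → Sec (dual G) U} {m : Sec L U} {m' : Sec (twistUp L x) U}
    (hT : IsTransfer (transpose ι) (toTwistUp L x) t I e f m m') :
    IsExtendable φ (transpose ι) (toTwistUp L x) t := by
  intro V hV s s' a a' ha ha'
  obtain ⟨c, hc⟩ := hT.line_source.exists_smul hV (φ.pair V a a')
  obtain ⟨g, rfl⟩ := ht.exists_mul hV c fun hxV ↦ by
    have ht0 : valueFn x hxV (resFn hV t) = 0 := by rw [valueFn_resFn, ht.value_eq_zero]
    obtain ⟨ν, hν, hνm⟩ := (hT.line_source.restrict hV).exists_dual_line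
    -- The form `ν φ(a', -)` is orthogonal to `W^⊥`, hence to `W ⊆ W^⊥`, so it lies in `W^⊥`; in
    -- turn `ν φ(a, -)` is orthogonal to it.
    have h1 : value _ hxV (compForm φ a' ν) ∈ W.orthogonalBilin (φ'.fiber x) := fun w hw ↦
      (h.fiber_symm hφ w _).trans (h.fiber_compForm_eq_zero hι ht0 ha' ν (hW hw))
    have h2 := h.fiber_compForm_eq_zero hι ht0 ha ν h1
    rw [φ'.fiber_value, h.pair_compForm, hν.value_smul_eq_zero_iff, evalForm_compForm, res_self,
      hφ.symm, ← hc] at h2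
    have := hνm V le_rfl c
    rw [res_self] at this
    rwa [this] at h2
  refine ⟨g • res _ hV m', ?_⟩
  rw [← hc, map_smul, app_res, hT.map_line, (res _ hV).map_smulₛₗ]
  simp only [smul_smul]
  congr 1
  ring

end Lagrangian

/-! ### A matrix criterion for simple degeneracy -/

section SimplyDegenerate
variable {F M : OMod X} {ψ : BilinForm F M} {x : X} {r : ℕ}

/-- The adjoint map sends `e` to a frame of `ℋom(F, M)` with the vector of index `i₀` multiplied by
`t`. Its image is the kernel of the `i₀`-th coordinate at `x`, a surjection to `ℂ_x`. -/
theorem IsGram.isSimplyDegenerate (hc : IsCurvePoint x) (hF : IsVectorBundle F r)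
    (hM : IsLineBundle M) (hs : ψ.IsSymmetric) (hn : ∀ p, p ≠ x → ψ.NondegenerateAt p)
    {U : Opens X} {hx : x ∈ U} {t : Fn X U} (ht : IsParameter hx t) {e : Fin r → Sec F U}
    {m : Sec M U} {Q : Matrix (Fin r) (Fin r) (Fn X U)} (hQ : IsUnit Q.det) {i₀ : Fin r}
    (h : IsGram ψ e m (Matrix.diagonal (fun i ↦ if i = i₀ then t else 1) * Q)) :
    IsSimplyDegenerate ψ x r := by
  obtain ⟨a, ha, hae⟩ := h.frame.exists_dual_frame h.line
  have hf := ha.of_matrix hQ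
  have hd (i : Fin r) : app ψ.adjoint U (e i) =
      (if i ∈ ({i₀} : Finset (Fin r))ᶜ then 1 else t) • ∑ j, Q i j • a j := by
    simp only [h.app_adjoint hae, Matrix.diagonal_mul, mul_smul, ← Finset.smul_sum,
      Finset.mem_compl, Finset.mem_singleton, ite_not]
  have hb := isVectorBundle_ihom hF hM
  refine ⟨hF, hM, hs, shortExact_toSkyscraper (g := (hf.fiberBasis hx).coord i₀)
    (isElementaryTransform_of_frame hc.closed (fun V hxV ↦ OrthogonalHecke.bijective_adjoint hF hM fun p hp ↦
      hn p (ne_of_mem_of_not_mem hp hxV)) ht h.frame hf hd fun v ↦ ?_) ?_ hc.closed fun v ↦ ?_⟩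
  · simp
  · intro c
    exact ⟨c • hf.fiberBasis hx i₀, by simp⟩
  · obtain ⟨V, hV, -, s, hs⟩ := exists_value_eq (Opens.mem_top x) v
    exact ⟨V, hV, s, hs⟩

theorem standardEntry_eq_diagonal_mul {R : Type*} [CommRing R] (n : ℕ) (w t : R) :
    Matrix.of (standardEntry n (w * t)) =
      Matrix.diagonal (fun i ↦ if i = ⟨n, by omega⟩ then t else 1) *
        Matrix.of (standardEntry n w) := by
  ext i j
  rw [Matrix.diagonal_mul, Matrix.of_apply, Matrix.of_apply]
  unfold standardEntry
  have hi := i.2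
  have hj := j.2
  simp only [Fin.ext_iff]
  split_ifs <;> first | omega | ring

/-- Invertibility of the matrix left after pulling out `t` is read off from the discriminant, known
to be a unit times `t`, rather than from the entries. -/
theorem IsGram.isSimplyDegenerate_of_standardEntry {n : ℕ} (hc : IsCurvePoint x)
    (hF : IsVectorBundle F (2 * n + 1)) (hM : IsLineBundle M) (hs : ψ.IsSymmetric)
    (hn : ∀ p, p ≠ x → ψ.NondegenerateAt p) {U : Opens X} {hx : x ∈ U} {t : Fn X U}
    (ht : IsParameter hx t) {e e' : Fin (2 * n + 1) → Sec F U} {m : Sec M U} {w : Fn X U}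
    (h : IsGram ψ e m (.of (standardEntry n (w * t))))
    {A : Matrix (Fin (2 * n + 1)) (Fin (2 * n + 1)) (Fn X U)} (hA : IsGram ψ e' m A)
    {u : Fn X U} (hu : IsUnit u) (hdet : A.det = u * t) : IsSimplyDegenerate ψ x (2 * n + 1) := by
  obtain ⟨v, hv, hAv⟩ := hA.exists_det h
  rw [standardEntry_eq_diagonal_mul] at h hAv
  refine h.isSimplyDegenerate hc hF hM hs hn ht ?_
  rw [Matrix.det_mul, Matrix.det_diagonal, Finset.prod_ite_eq' Finset.univ, if_pos (Finset.mem_univ _),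
    hdet] at hAv
  rw [ht.mul_cancel le_rfl (f := (Matrix.of (standardEntry n w)).det) (g := v * u)
    (by rw [resFn_self, hAv]; ring)]
  exact hv.mul hu

end SimplyDegenerate

/-! ### From orthogonal bundles to simply degenerate forms -/

section InverseTransform
variable {E L : OMod X} {φ : BilinForm E L} {φ' : BilinForm (dual E) (dual L)} {n : ℕ} {x : X}
  {W : Submodule (κ x) (Fiber (dual E) x)}

/-- A Lagrangian subspace of the fibre at `x` of the dual of an orthogonal bundle of odd rank
determines a simply degenerate form. -/
theorem exists_isSimplyDegenerate (hc : IsCurvePoint x) (hφ : IsOrthogonalBundle φ (2 * n + 1))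
    (h : IsInverseForm φ φ') (hn : finrank (κ x) W = n) (hW : IsIsotropicIn φ' x W) :
    ∃ ψ : BilinForm (dual (elementaryTransform (dual E) x (W.orthogonalBilin (φ'.fiber x))))
        (twistUp L x),
      FormsCompatible φ ψ
        (transpose (elementaryTransformι (dual E) x (W.orthogonalBilin (φ'.fiber x))))
        (toTwistUp L x) ∧
      (∀ ψ₁ : BilinForm (dual (elementaryTransform (dual E) x (W.orthogonalBilin (φ'.fiber x))))
          (twistUp L x),
        FormsCompatible φ ψ₁
          (transpose (elementaryTransformι (dual E) x (W.orthogonalBilin (φ'.fiber x))))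
          (toTwistUp L x) → ψ₁ = ψ) ∧
      IsSimplyDegenerate ψ x (2 * n + 1) ∧ (∀ p : X, p ≠ x → ψ.NondegenerateAt p) ∧
      HasStandardFormAt ψ x n := by
  have hι := isElementaryTransform_elementaryTransform (dual E) x (W.orthogonalBilin (φ'.fiber x))
  obtain ⟨U₀, hx₀, t, ht⟩ := hc.exists_parameter
  obtain ⟨U, hxU, hU, I, e, f, m, m', hI, hT⟩ := hι.exists_isTransfer hφ.bundle hφ.line ht
  have ht' := ht.restrict hU hxU
  have hne (p : X) (hp : p ≠ x) := hι.exists_isTransfer_of_ne hφ.bundle hφ.line hc.closed hp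
  obtain ⟨ψ, hψ⟩ := exists_extension (φ := φ)
    (β := transpose (elementaryTransformι (dual E) x (W.orthogonalBilin (φ'.fiber x))))
    (i := toTwistUp L x) fun p ↦ by
      by_cases hp : p = x
      · exact ⟨U, by rwa [hp], _, I, e, f, m, m', hT, h.isExtendable hφ hW hι ht' hT⟩
      · obtain ⟨V, hpV, e, f, m, m', hT⟩ := hne p hp
        -- Away from `x` the multiplier is `1` and there is nothing to divide by.
        exact ⟨V, hpV, 1, _, e, f, m, m', hT, fun V' hV' s s' a a' _ _ ↦
          ⟨_, by rw [map_one, one_smul, one_smul]⟩⟩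
  have H (p : X) : ∃ (U : Opens X) (_ : p ∈ U) (τ : Fn X U) (I : Finset (Fin (2 * n + 1)))
      (e : Fin (2 * n + 1) → Sec E U) (f : Fin (2 * n + 1) → Sec (dual (elementaryTransform
        (dual E) x (W.orthogonalBilin (φ'.fiber x)))) U) (m : Sec L U) (m' : Sec (twistUp L x) U),
      IsTransfer (transpose (elementaryTransformι (dual E) x (W.orthogonalBilin (φ'.fiber x))))
        (toTwistUp L x) τ I e f m m' := by
    by_cases hp : p = x
    · exact ⟨U, by rwa [hp], _, I, e, f, m, m', hT⟩
    · obtain ⟨V, hpV, hV⟩ := hne p hp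
      exact ⟨V, hpV, 1, _, hV⟩
  have hF := isVectorBundle_dual (hι.isVectorBundle hc (isVectorBundle_dual hφ.bundle))
  have hN := isLineBundle_twistUp (L := L) hc hφ.line
  have hs := hψ.isSymmetric_of_transfer H hφ.symm
  have hnd (p : X) (hp : p ≠ x) : ψ.NondegenerateAt p := by
    obtain ⟨V, hpV, e, f, m, m', hT⟩ := hne p hp
    obtain ⟨A, hA⟩ := exists_isGram φ hT.frame_source hT.line_source
    obtain ⟨C, hC⟩ := exists_isGram ψ hT.frame hT.line
    have : C = A := by
      ext i j
      simpa using hT.mul_gram_eq hψ hA hC i j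
    rw [hC.nondegenerateAt_iff hpV, this, ← hA.nondegenerateAt_iff hpV]
    exact hφ.nondegenerate p
  obtain ⟨A, hA⟩ := exists_isGram φ hT.frame_source hT.line_source
  obtain ⟨C, hC⟩ := exists_isGram ψ hT.frame hT.line
  have hdet : C.det = A.det * resFn hU t := by
    have hd := det_of_smul_eq (hT.mul_gram_eq hψ hA hC)
    -- `W^⊥` has dimension `(2n + 1) - n = n + 1`, so `n` diagonal entries are `t` and `t^(2n) det C
    -- = t^(2n+1) det A`.
    rw [prod_ite_mem_one (k := n) (by
      rw [hI, h.finrank_orthogonalBilin hφ, hn]; omega), Fintype.card_fin] at hd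
    refine ht'.pow_mul_cancel (2 * n) ?_
    rw [mul_comm A.det, ← mul_assoc, ← pow_succ, ← hd]
    ring
  have hu := hA.isUnit_det fun p _ ↦ hφ.nondegenerate p
  obtain ⟨V, hxV, hV, e', w, hw, hG⟩ := hC.exists_standard hs hc ht' hu hdet
  have ht'' := ht'.restrict hV hxV
  refine ⟨ψ, hψ, fun ψ₁ h₁ ↦ h₁.ext_of_transfer H hψ, ?_, hnd, hG.hasStandardFormAt ht'' hw⟩
  refine hG.isSimplyDegenerate_of_standardEntry hc hF hN hs hnd ht'' (hC.restrict hV)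
    (hu.map (resFn hV)) ?_
  rw [← RingHom.mapMatrix_apply, ← RingHom.map_det, hdet, map_mul]

end InverseTransform

/-! ### Points of a Riemann surface: parameters and square roots -/

section HolomorphicFunctions
variable {X : Type} [TopologicalSpace X] [ChartedSpace ℂ X] {U V : Opens X}

/-- A holomorphic function on an open subset. -/
def mkFn (U : Opens X) (f : X → ℂ)
    (hf : ContMDiffOn 𝓘(ℂ) 𝓘(ℂ) ∞ f (U : Set X)) : Fn (holomorphicSpace X) U :=
  (⟨fun y : U ↦ f y, fun y ↦ contMDiffAt_subtype_iff.2
    ((hf y y.2).contMDiffAt (U.isOpen.mem_nhds y.2))⟩ : C^∞⟮𝓘(ℂ), U; 𝓘(ℂ), ℂ⟯)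

/-- The underlying map of a local section of the structure sheaf. -/
def toMap (f : Fn (holomorphicSpace X) U) : C^∞⟮𝓘(ℂ), U; 𝓘(ℂ), ℂ⟯ := f

/-- The underlying function of a local section of the structure sheaf, extended by zero. -/
def extFn (f : Fn (holomorphicSpace X) U) (y : X) : ℂ :=
  open Classical in
  if h : y ∈ U then (toMap f) ⟨y, h⟩ else 0

theorem extFn_of_mem (f : Fn (holomorphicSpace X) U) {y : X} (h : y ∈ U) :
    extFn f y = (toMap f) ⟨y, h⟩ := dif_pos h

theorem extFn_of_notMem (f : Fn (holomorphicSpace X) U) {y : X} (h : y ∉ U) :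
    extFn f y = 0 := dif_neg h

theorem extFn_mkFn {f : X → ℂ} (hf : ContMDiffOn 𝓘(ℂ) 𝓘(ℂ) ∞ f (U : Set X)) {y : X}
    (h : y ∈ U) : extFn (mkFn U f hf) y = f y := extFn_of_mem _ h

theorem extFn_ext {f g : Fn (holomorphicSpace X) U}
    (h : ∀ y ∈ U, extFn f y = extFn g y) : f = g := by
  refine Subtype.ext (funext fun y ↦ ?_)
  have := h y.1 y.2
  rwa [extFn_of_mem f y.2, extFn_of_mem g y.2] at this

theorem extFn_mul (f g : Fn (holomorphicSpace X) U) (y : X) :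
    extFn (f * g) y = extFn f y * extFn g y := by
  by_cases h : y ∈ U
  · rw [extFn_of_mem _ h, extFn_of_mem _ h, extFn_of_mem _ h]
    rfl
  · rw [extFn_of_notMem _ h, extFn_of_notMem _ h, zero_mul]

theorem extFn_resFn (h : V ≤ U) (f : Fn (holomorphicSpace X) U) {y : X} (hy : y ∈ V) :
    extFn (resFn h f) y = extFn f y := by
  rw [extFn_of_mem _ hy, extFn_of_mem _ (h hy)]
  rfl

theorem contMDiffOn_extFn (f : Fn (holomorphicSpace X) U) :
    ContMDiffOn 𝓘(ℂ) 𝓘(ℂ) ∞ (extFn f) (U : Set X) := by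
  intro y hy
  refine ContMDiffAt.contMDiffWithinAt ?_
  have h : ContMDiffAt 𝓘(ℂ) 𝓘(ℂ) ∞ (fun y : U ↦ extFn f y) ⟨y, hy⟩ := by
    convert (toMap f).contMDiff ⟨y, hy⟩ using 1
    exact funext fun z ↦ extFn_of_mem f z.2
  exact contMDiffAt_subtype_iff.1 h

variable {x : holomorphicSpace X}

theorem isUnit_germFn_iff (hx : x ∈ U) (f : Fn (holomorphicSpace X) U) :
    IsUnit (germFn hx f) ↔ extFn f x ≠ 0 := by
  rw [extFn_of_mem f hx]
  refine (smoothSheafCommRing.isUnit_stalk_iff 𝓘(ℂ) _).trans (not_congr ?_)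
  rw [RingHom.mem_ker]
  refine iff_of_eq (congrArg (· = 0) ?_)
  exact smoothSheafCommRing.eval_germ U x hx f

theorem valueFn_eq_zero_iff (hx : x ∈ U) (f : Fn (holomorphicSpace X) U) :
    valueFn x hx f = 0 ↔ extFn f x = 0 :=
  not_iff_not.1 ((valueFn_ne_zero_iff hx f).trans (isUnit_germFn_iff hx f))

/-- A continuous function vanishing on a punctured neighbourhood of a point vanishes there. -/
theorem eq_zero_of_punctured {f : X → ℂ} {U : Opens X} {x : X} (hx : x ∈ U)
    (hf : ContinuousOn f U) (h : ∀ y ∈ U, y ≠ x → f y = 0) : f x = 0 := by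
  set e := chartAt ℂ x with he
  have hxe : x ∈ e.source := mem_chart_source ℂ x
  have hc : Filter.Tendsto e.symm (nhds (e x)) (nhds x) := by
    have := e.continuousAt_symm (e.map_source hxe)
    rwa [ContinuousAt, e.left_inv hxe] at this
  have h1 : Filter.Tendsto (f ∘ e.symm) (nhdsWithin (e x) {e x}ᶜ) (nhds (f x)) :=
    ((hf.continuousAt (U.isOpen.mem_nhds hx)).tendsto.comp hc).mono_left nhdsWithin_le_nhds
  refine tendsto_nhds_unique h1 (tendsto_const_nhds.congr' ?_)
  filter_upwards [nhdsWithin_le_nhds (e.open_target.mem_nhds (e.map_source hxe)),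
    nhdsWithin_le_nhds (hc (U.isOpen.mem_nhds hx)), self_mem_nhdsWithin] with z hz hzU hne
  refine (h _ hzU fun hzx ↦ hne ?_).symm
  rw [Set.mem_singleton_iff, ← hzx, e.right_inv hz]

/-- The parameter is a chart centred at `x`; in that chart the quotient `f / t` is the slope of `f`
at the centre, which is holomorphic by the removable singularity theorem. -/
theorem exists_isParameter [IsManifold 𝓘(ℂ) ω X] (x : X) :
    ∃ (U : Opens X) (hx : x ∈ U) (t : Fn (holomorphicSpace X) U),
      IsParameter (X := holomorphicSpace X) hx t := by
  have : IsManifold 𝓘(ℂ) ∞ X := IsManifold.of_le (n := ω) le_top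
  set e := chartAt ℂ x with he
  have hxe : x ∈ e.source := mem_chart_source ℂ x
  have hes : ContMDiffOn 𝓘(ℂ) 𝓘(ℂ) ∞ e e.source := contMDiffOn_chart
  have hes' : ContMDiffOn 𝓘(ℂ) 𝓘(ℂ) ∞ e.symm e.target := contMDiffOn_chart_symm
  let U : Opens X := ⟨e.source, e.open_source⟩
  have hsub : ContDiff ℂ ∞ fun z : ℂ ↦ z - e x := contDiff_id.sub contDiff_const
  have ht : ContMDiffOn 𝓘(ℂ) 𝓘(ℂ) ∞ (fun y ↦ e y - e x) U := hsub.contMDiff.comp_contMDiffOn hes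
  have hne {y : X} (hy : y ∈ U) (hyx : y ≠ x) : e y - e x ≠ 0 :=
    sub_ne_zero.2 fun h ↦ hyx (e.injOn hy hxe h)
  refine ⟨U, hxe, mkFn U _ ht, ⟨(valueFn_eq_zero_iff _ _).2 ?_, fun {V : Opens X} hV f hf ↦ ?_⟩⟩
  · rw [extFn_mkFn ht hxe, sub_self]
  -- If `x ∉ V`, the extension by zero supplies this value, so one slope formula covers both cases.
  · have hf0 : extFn f x = 0 := by
      by_cases hxV : x ∈ V
      · exact (valueFn_eq_zero_iff hxV f).1 (hf hxV)
      · exact extFn_of_notMem f hxV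
    have hW : IsOpen (e.target ∩ e.symm ⁻¹' (V : Opens X)) := e.isOpen_inter_preimage_symm V.isOpen
    have hFd : DifferentiableOn ℂ (extFn f ∘ e.symm) (e.target ∩ e.symm ⁻¹' (V : Opens X)) := by
      refine ContDiffOn.differentiableOn (n := ∞) ?_ (by simp)
      rw [← contMDiffOn_iff_contDiffOn]
      exact (contMDiffOn_extFn f).comp (hes'.mono Set.inter_subset_left) fun z hz ↦ hz.2
    have hD : DifferentiableOn ℂ (dslope (extFn f ∘ e.symm) (e x))
        (e.target ∩ e.symm ⁻¹' (V : Opens X)) := by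
      by_cases hxW : e x ∈ e.target ∩ e.symm ⁻¹' (V : Opens X)
      · exact (Complex.differentiableOn_dslope (hW.mem_nhds hxW)).2 hFd
      · exact (differentiableOn_dslope_of_notMem hxW).2 hFd
    have hg : ContMDiffOn 𝓘(ℂ) 𝓘(ℂ) ∞ (fun y ↦ dslope (extFn f ∘ e.symm) (e x) (e y))
        (V : Opens X) := by
      refine (hD.contDiffOn hW).contMDiffOn.comp (hes.mono hV) fun y hy ↦ ?_
      refine ⟨e.map_source (hV hy), ?_⟩
      rw [Set.mem_preimage, e.left_inv (hV hy)]
      exact hy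
    refine ⟨mkFn V _ hg, extFn_ext fun y hy ↦ ?_, fun g' hg' ↦ ?_⟩
    · rw [extFn_mul, extFn_resFn hV _ hy, extFn_mkFn ht (hV hy), extFn_mkFn hg hy, ← smul_eq_mul,
        sub_smul_dslope, Function.comp_apply, Function.comp_apply, e.left_inv (hV hy),
        e.left_inv hxe, hf0, sub_zero]
    -- Two quotients agree where `t ≠ 0`, that is off `x`, and then at `x` by continuity.
    · have key {y : X} (hy : y ∈ V) (hyx : y ≠ x) :
          extFn g' y - dslope (extFn f ∘ e.symm) (e x) (e y) = 0 := by
        refine sub_eq_zero.2 (mul_left_cancel₀ (hne (hV hy) hyx) ?_)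
        rw [← smul_eq_mul (e y - e x) (dslope _ _ _), sub_smul_dslope, Function.comp_apply,
          Function.comp_apply, e.left_inv (hV hy), e.left_inv hxe, hf0, sub_zero, ← hg', extFn_mul,
          extFn_resFn hV _ hy, extFn_mkFn ht (hV hy)]
      refine extFn_ext fun y hy ↦ ?_
      rw [extFn_mkFn hg hy]
      by_cases hyx : y = x
      · subst hyx
        exact sub_eq_zero.1 (eq_zero_of_punctured (f := fun z ↦ extFn g' z -
          dslope (extFn f ∘ e.symm) (e y) (e z)) hy
          ((contMDiffOn_extFn g').continuousOn.sub hg.continuousOn) fun y hy hyx ↦ key hy hyx)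
      · exact sub_eq_zero.1 (key hy hyx)

theorem exists_mul_self_eq_resFn {U : Opens X} {x : X} (hxU : x ∈ U)
    (f : Fn (holomorphicSpace X) U) (hc : extFn f x ≠ 0) :
    ∃ (V : Opens X) (_ : x ∈ V) (hV : V ≤ U) (s : Fn (holomorphicSpace X) V),
      s * s = resFn (X := holomorphicSpace X) hV f := by
  set c := extFn f x with hcf
  have hf := contMDiffOn_extFn f
  -- Dividing by `c = f(x)` puts the argument of the logarithm near `1`, off the branch cut; a fixed
  -- square root of `c` is multiplied back.
  let g (z : ℂ) : ℂ := Complex.exp (Complex.log (z / c) / 2) * Complex.exp (Complex.log c / 2)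
  have hgg {z : ℂ} (hz : z / c ∈ Complex.slitPlane) : g z * g z = z := by
    rw [mul_mul_mul_comm, ← Complex.exp_add, ← Complex.exp_add, add_halves, add_halves,
      Complex.exp_log (Complex.slitPlane_ne_zero hz), Complex.exp_log hc, div_mul_cancel₀ _ hc]
  let S : Set ℂ := {z | z / c ∈ Complex.slitPlane}
  have hS : IsOpen S := Complex.isOpen_slitPlane.preimage (continuous_id.div_const c)
  have hg : ContDiffOn ℂ ∞ g S := fun z hz ↦ by
    refine ContDiffAt.contDiffWithinAt ?_
    exact ((((Complex.contDiffAt_log hz).comp z (contDiffAt_id.div_const c)).div_const 2).cexp).mul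
      contDiffAt_const
  let V : Opens X := ⟨_, hf.continuousOn.isOpen_inter_preimage U.isOpen hS⟩
  have hVU : V ≤ U := Set.inter_subset_left
  have hxV : x ∈ V := ⟨hxU, by
    change c / c ∈ Complex.slitPlane
    rw [div_self hc]
    exact Complex.one_mem_slitPlane⟩
  have hs : ContMDiffOn 𝓘(ℂ) 𝓘(ℂ) ∞ (g ∘ extFn f) V :=
    hg.contMDiffOn.comp (hf.mono hVU) fun y hy ↦ hy.2
  refine ⟨V, hxV, hVU, mkFn V _ hs, extFn_ext fun y hy ↦ ?_⟩
  rw [extFn_resFn hVU f hy, extFn_mul, extFn_mkFn hs hy]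
  exact hgg hy.2

theorem isCurvePoint_holomorphicSpace [T1Space X] [IsManifold 𝓘(ℂ) ω X] (x : holomorphicSpace X) :
    IsCurvePoint x where
  closed := isClosed_singleton (X := X)
  exists_parameter := exists_isParameter (X := X) x
  isUnit_two := by
    rw [← one_add_one_eq_two, ← map_one (germFn (X := holomorphicSpace X) (Opens.mem_top x)), ← map_add, isUnit_germFn_iff (X := X),
      extFn_of_mem (X := X) _ (Opens.mem_top x)]
    change (1 + 1 : ℂ) ≠ 0
    norm_num
  isSquare a ha := by
    obtain ⟨U, hxU, f, rfl⟩ := TopCat.Presheaf.exists_germ_eq (holomorphicSpace X).presheaf a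
    obtain ⟨V, hxV, hV, s, hs⟩ :=
      exists_mul_self_eq_resFn (X := X) hxU f ((isUnit_germFn_iff (X := X) hxU f).1 ha)
    exact ⟨germFn (X := holomorphicSpace X) hxV s, by
      rw [← map_mul, hs]
      exact (germFn_res hV hxV f).symm⟩

end HolomorphicFunctions

end

end OrthogonalHecke

theorem mainTheorem9 (X : Type) [TopologicalSpace X] [T2Space X] [CompactSpace X]
    [ConnectedSpace X] [ChartedSpace ℂ X] [IsManifold 𝓘(ℂ) ω X]
    (x : holomorphicSpace X) (n : ℕ) :
    -- from a simply degenerate form `ψ` on `F` to an orthogonal structure `φ` on `E`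
    (∀ (F M : OMod (holomorphicSpace X)) (ψ : BilinForm F M),
      IsSimplyDegenerate ψ x (2 * n + 1) →
      ∀ S : Submodule (κ x) (Fiber F x ⧸ ψ.annihilator x),
        Module.finrank (κ x) S = n → IsIsotropicModAnnihilator ψ x S →
        ∃ φ : BilinForm (heckeTransform ψ x S) (twistDown M x),
          FormsCompatible φ ψ (heckeTransformι ψ x S) (twistDownι M x) ∧
          (∀ φ₁ : BilinForm (heckeTransform ψ x S) (twistDown M x),
            FormsCompatible φ₁ ψ (heckeTransformι ψ x S) (twistDownι M x) → φ₁ = φ) ∧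
          IsOrthogonalBundle φ (2 * n + 1)) ∧
    -- conversely, from an orthogonal bundle `(E, φ)` to a simply degenerate form `ψ` on `F`
    (∀ (E L : OMod (holomorphicSpace X)) (φ : BilinForm E L),
      IsOrthogonalBundle φ (2 * n + 1) →
      (∃! φ' : BilinForm (dual E) (dual L), IsInverseForm φ φ') ∧
      ∀ φ' : BilinForm (dual E) (dual L), IsInverseForm φ φ' →
        ∀ W : Submodule (κ x) (Fiber (dual E) x),
          Module.finrank (κ x) W = n → IsIsotropicIn φ' x W →
          ∃ ψ : BilinForm
              (dual (elementaryTransform (dual E) x (W.orthogonalBilin (φ'.fiber x))))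
              (twistUp L x),
            FormsCompatible φ ψ
              (transpose (elementaryTransformι (dual E) x (W.orthogonalBilin (φ'.fiber x))))
              (toTwistUp L x) ∧
            (∀ ψ₁ : BilinForm
                (dual (elementaryTransform (dual E) x (W.orthogonalBilin (φ'.fiber x))))
                (twistUp L x),
              FormsCompatible φ ψ₁
                (transpose (elementaryTransformι (dual E) x (W.orthogonalBilin (φ'.fiber x))))
                (toTwistUp L x) → ψ₁ = ψ) ∧
            IsSimplyDegenerate ψ x (2 * n + 1) ∧
            (∀ p : holomorphicSpace X, p ≠ x → ψ.NondegenerateAt p) ∧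
            HasStandardFormAt ψ x n) := by
  have hc := isCurvePoint_holomorphicSpace (X := X) x
  refine ⟨fun F M ψ h S hn hS ↦ exists_orthogonal_heckeTransform hc h hn hS, fun E L φ hφ ↦ ?_⟩
  obtain ⟨φ₀, h₀⟩ := exists_isInverseForm hφ
  exact ⟨⟨φ₀, h₀, fun φ₁ h₁ ↦ h₁.eq hφ h₀⟩, fun φ' h W hn hW ↦
    exists_isSimplyDegenerate hc hφ h hn hW⟩
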